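/- Color every site of the triangular lattice (mesh one, embedded in the complex plane $\mathbb{C}$, with a site at the origin) black or white, in an arbitrary way. For a positive integer $n$, let $S_n$ be the set of sites in the closed Euclidean disc of radius $n$ around the origin, $\partial^i S_n$ the set of sites in $S_n$ having a neighbor outside $S_n$, and $\partial^e S_n$ the set of sites outside $S_n$ having a neighbor in $S_n$. Let $1 \le n < N$ be integers and $S_{n,N} = S_N \setminus S_n$. For $j \ge 1$ and a sequence of colors $\sigma = (\sigma_1, \dots, \sigma_j)$, a $(j,\sigma)$-arm configuration in $S_{n,N}$ consists of $j$ pairwise disjoint, non-self-intersecting lattice paths in $S_{n,N}$ (the arms), ordered counterclockwise in a cyclic way, each going from $\partial^e S_n$ to $\partial^i S_N$, the sites of the $i$-th arm all having color $\sigma_i$. The winding angle of an arm is the overall variation of a continuous determination of the argument along the arm. Let $I_{j,\sigma}(n,N)$ be the set of all winding angles of arms belonging to some $(j,\sigma)$-arm configuration in $S_{n,N}$, and $$\bar I_{j,\sigma}(n,N) = \bigcup_{\alpha \in I_{j,\sigma}(n,N)} (\alpha - \pi, \alpha + \pi].$$ Suppose that $\sigma$ is constant. Then for all $\alpha < \alpha'$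 in $I_{j,\sigma}(n,N)$ there are an integer $r$ and elements $\alpha = \alpha_0 < \alpha_1 < \dots < \alpha_r = \alpha'$ of $I_{j,\sigma}(n,N)$ such that, for every $i \in \{0, \dots, r-1\}$, $\alpha_{i+1} - \alpha_i < 2\pi$ if $j \ge 2$, and $\alpha_{i+1} - \alpha_i \le 2\pi$ if $j = 1$. Moreover $\bar I_{j,\sigma}(n,N)$ is an interval (possibly empty). -/

import Mathlib

namespace Percolation

/-- The two colors of sites. -/
inductive Color where
  | black : Color
  | white : Color

/-- The position in the complex plane of the site with coordinates `v`: the triangular lattice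
of mesh one is generated by `1` and `exp (iπ/3) = 1/2 + (√3/2) i`. -/
noncomputable def pos (v : ℤ × ℤ) : ℂ :=
  ⟨(v.1 : ℝ) + (v.2 : ℝ) / 2, (v.2 : ℝ) * (Real.sqrt 3 / 2)⟩

/-- The triangular lattice as a graph: two sites are adjacent when they are at distance one
(see `triangular_adj_iff`). -/
def triangular : SimpleGraph (ℤ × ℤ) where
  Adj u v := (u.1 - v.1) ^ 2 + (u.1 - v.1) * (u.2 - v.2) + (u.2 - v.2) ^ 2 = 1
  symm := ⟨fun u v h => by rw [← h]; ring⟩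
  loopless := ⟨fun u h => by simp at h⟩

theorem triangular_adj_iff (u v : ℤ × ℤ) :
    triangular.Adj u v ↔ ‖pos u - pos v‖ = 1 := by
  have h3 : Real.sqrt 3 * Real.sqrt 3 = 3 := Real.mul_self_sqrt (by norm_num)
  have key : ‖pos u - pos v‖ ^ 2 =
      (((u.1 - v.1) ^ 2 + (u.1 - v.1) * (u.2 - v.2) + (u.2 - v.2) ^ 2 : ℤ) : ℝ) := by
    rw [← Complex.normSq_eq_norm_sq, Complex.normSq_apply]
    simp only [pos, Complex.sub_re, Complex.sub_im]
    push_cast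
    linear_combination (((u.2 : ℝ) - v.2) ^ 2 / 4) * h3
  rw [← pow_eq_one_iff_of_nonneg (norm_nonneg _) two_ne_zero, key]
  exact_mod_cast Iff.rfl

/-- The ball `S_n`: the sites in the closed Euclidean disc of radius `n`. -/
def ball (n : ℕ) : Set (ℤ × ℤ) := {v | ‖pos v‖ ≤ n}

/-- The internal boundary of `S_n`: sites of `S_n` with a neighbor outside `S_n`. -/
def internalBoundary (n : ℕ) : Set (ℤ × ℤ) :=
  {v | v ∈ ball n ∧ ∃ u, triangular.Adj v u ∧ u ∉ ball n}

/-- The external boundary of `S_n`: sites outside `S_n` with a neighbor in `S_n`. -/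
def externalBoundary (n : ℕ) : Set (ℤ × ℤ) :=
  {v | v ∉ ball n ∧ ∃ u, triangular.Adj v u ∧ u ∈ ball n}

/-- The annulus `S_{n,N} = S_N \ S_n`. -/
def annulus (n N : ℕ) : Set (ℤ × ℤ) := ball N \ ball n

/-- An arm of color `c` in the configuration `ω`: a non-self-intersecting lattice path in the
annulus `S_{n,N}`, all of whose sites have color `c`, from the external boundary of `S_n` to the
internal boundary of `S_N`. -/
structure Arm (ω : ℤ × ℤ → Color) (c : Color) (n N : ℕ) where
  start : ℤ × ℤ
  finish : ℤ × ℤ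
  path : triangular.Walk start finish
  isPath : path.IsPath
  start_mem : start ∈ externalBoundary n
  finish_mem : finish ∈ internalBoundary N
  mem_annulus : ∀ v ∈ path.support, v ∈ annulus n N
  color_eq : ∀ v ∈ path.support, ω v = c

/-- The points `z i` are in counterclockwise cyclic order around the origin: they have arguments
`θ 0 < θ 1 < ⋯ < θ (j - 1) < θ 0 + 2π`. -/
def CyclicallyOrdered {j : ℕ} (z : Fin j → ℂ) : Prop :=
  ∃ θ : Fin j → ℝ, StrictMono θ ∧ (∀ i k, θ k < θ i + 2 * Real.pi) ∧
    ∀ i, z i = (‖z i‖ : ℂ) * Complex.exp ((θ i : ℂ) * Complex.I)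

/-- A `(j, σ)`-arm configuration in `S_{n,N}`: `j` pairwise disjoint arms, the `i`-th of color
`σ i`, in counterclockwise cyclic order (read off at their starting sites). -/
structure ArmConfiguration (ω : ℤ × ℤ → Color) {j : ℕ} (σ : Fin j → Color) (n N : ℕ) where
  arm : (i : Fin j) → Arm ω (σ i) n N
  disjoint : ∀ i k, i ≠ k → ∀ v ∈ (arm i).path.support, v ∉ (arm k).path.support
  ordered : CyclicallyOrdered fun i => pos (arm i).start

/-- The polygonal curve in the plane drawn by a lattice path `p`, parametrized by
`[0, p.length]`: it is at the `m`-th site of `p` at time `m`, and affine in between. -/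
noncomputable def curve {u v : ℤ × ℤ} (p : triangular.Walk u v) (t : ℝ) : ℂ :=
  AffineMap.lineMap (pos (p.getVert ⌊t⌋₊)) (pos (p.getVert (⌊t⌋₊ + 1))) (t - ⌊t⌋₊)

/-- `α` is the winding angle of `p`: the overall variation, along the curve drawn by `p`, of a
continuous determination `θ` of the argument. -/
def IsWindingAngle {u v : ℤ × ℤ} (p : triangular.Walk u v) (α : ℝ) : Prop :=
  ∃ θ : ℝ → ℝ, ContinuousOn θ (Set.Icc 0 (p.length : ℝ)) ∧
    (∀ t ∈ Set.Icc (0 : ℝ) (p.length : ℝ),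
      curve p t = (‖curve p t‖ : ℂ) * Complex.exp ((θ t : ℂ) * Complex.I)) ∧
    α = θ (p.length : ℝ) - θ 0

/-- `I_{j,σ}(n,N)`: the winding angles of the arms of all the `(j, σ)`-arm configurations present
in `ω`. -/
def angleSet (ω : ℤ × ℤ → Color) {j : ℕ} (σ : Fin j → Color) (n N : ℕ) : Set ℝ :=
  {α | ∃ r : ArmConfiguration ω σ n N, ∃ i, IsWindingAngle (r.arm i).path α}

/-- The completed set of angles: the union of the `(α - π, α + π]` for `α` in `I_{j,σ}(n,N)`. -/
def completedAngleSet (ω : ℤ × ℤ → Color) {j : ℕ} (σ : Fin j → Color) (n N : ℕ) : Set ℝ :=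
  ⋃ α ∈ angleSet ω σ n N, Set.Ioc (α - Real.pi) (α + Real.pi)

end Percolation

namespace Percolation

/-! Unroll the lattice around the origin. The arms of a configuration lift to a family `C i`,
indexed by all integers `i`, of pairwise disjoint crossings of the lifted annulus, increasing in
starting angle, where `C (i + j)` is `C i` turned by `2π`. By planarity the final angles increase
with `i` as well. The winding angle of an arm is the final angle of a lift minus its initial angle.

Let `Γ` and `Δ` be the families of two configurations, of angles `S`, `E` and `S'`, `E'` at the
starts and ends, and let `α` be read on `Γ i₀` and `α'` on `Δ i₁`. For an integer `k`, take for
every `i` the clockwise-most envelope of `Γ i` and `Δ (i + k)`. As all arms have the same color, it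
contains a monochromatic crossing from the first of the two starts to the first of the two ends.
Envelopes for different `i` are disjoint and compatible with full turns, so they project to a
configuration in the same coloring (`ArmFamily.exists_configuration`). Its arm `i₀` has winding
angle `W k = min (E i₀) (E' (i₀ + k)) - min (S i₀) (S' (i₀ + k))`. For `k` large this is `α`; for
`k` very negative with `i₀ + k` congruent to `i₁` modulo `j` it is `α'`. When `k` increases by one,
both minima grow by an amount between `0` and `2π`, less than `2π` if `j ≥ 2`, so `W` drops by no
more than that (`exists_sequence`). Going from `α` to `α'` with upward steps so bounded, the sorted
values in between have gaps so bounded (`exists_chain`), and half-open intervals of length `2π`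
around them leave no hole.

The planar topology is combinatorial. A crossing is extended to a path from the origin to a distant
ring. Such a path is a unit flow, and this flow has a stream function on the triangular faces, its
height. That the height takes only the values `0` and `1` (`RingPath.ht_mem`) plays the role of the
Jordan curve theorem. Disjoint crossings have ordered heights (`Crossing.Disj.ht_le`), hence ordered
ends (`Crossing.Disj.angleLt_end`). The envelope is the maximum of two heights; conservation of its
flow gives the new crossing (`Crossing.reachable_env`), and `Crossing.not_bd_env` the disjointness.
-/

/-! ### The unrolled lattice: hexagonal rings, with the origin as apex, and the numbering of the
edges between rings. -/

/-- Upward edges of the cover: from ring `k` to ring `k + 1`. -/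
def Up (u v : ℤ × ℤ) : Prop :=
  0 ≤ u.1 ∧ v.1 = u.1 + 1 ∧ (u.1 + 1) * u.2 - u.1 * v.2 ≤ u.1 ∧
    -u.1 ≤ (u.1 + 1) * u.2 - u.1 * v.2

instance : DecidableRel Up := fun u v => by unfold Up; infer_instance

/-- Edges of the cover inside a ring, directed counterclockwise. -/
def Rt (u v : ℤ × ℤ) : Prop := 1 ≤ u.1 ∧ v.1 = u.1 ∧ v.2 = u.2 + 1

instance : DecidableRel Rt := fun u v => by unfold Rt; infer_instance

/-- Adjacency in the cover. -/
def CovAdj (u v : ℤ × ℤ) : Prop := Up u v ∨ Up v u ∨ Rt u v ∨ Rt v u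

theorem CovAdj.symm {u v : ℤ × ℤ} (h : CovAdj u v) : CovAdj v u := by
  unfold CovAdj at *; tauto

/-- The last index of an upward edge from `(k, m)`. -/
def lastUp (k m : ℤ) : ℤ := ((2 * k + 1) * m + k) / k

/-- The last index of a downward edge from `(k, m)`. -/
def lastDown (k m : ℤ) : ℤ := ((2 * k - 1) * m + k - 1) / k

theorem le_lastUp {k m q : ℤ} (hk : 1 ≤ k) : q ≤ lastUp k m ↔ k * q ≤ (2 * k + 1) * m + k := by
  unfold lastUp
  rw [Int.le_ediv_iff_mul_le (by omega), mul_comm]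

theorem le_lastDown {k m q : ℤ} (hk : 1 ≤ k) :
    q ≤ lastDown k m ↔ k * q ≤ (2 * k - 1) * m + k - 1 := by
  unfold lastDown
  rw [Int.le_ediv_iff_mul_le (by omega), mul_comm]

/-- The upward edges of a layer do not cross, so their indices (the sums of the positions of the two
endpoints) are monotone in each endpoint. A bound on the index can thus be read as a bound on the
lower endpoint here, and on the upper one in `up_le_lastDown`. -/
theorem up_le_lastUp {u v : ℤ × ℤ} (h : Up u v) (hk : 1 ≤ u.1) (m : ℤ) :
    u.2 + v.2 ≤ lastUp u.1 m ↔ u.2 ≤ m := by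
  obtain ⟨_, _, h1, h2⟩ := h
  rw [le_lastUp hk]
  constructor
  · intro h
    by_contra! hc
    nlinarith
  · intro h
    nlinarith

theorem up_le_lastDown {u v : ℤ × ℤ} (h : Up u v) (m : ℤ) :
    u.2 + v.2 ≤ lastDown v.1 m ↔ v.2 ≤ m := by
  obtain ⟨h0, hv, h1, h2⟩ := h
  rw [le_lastDown (by omega), hv]
  constructor
  · intro h
    by_contra! hc
    nlinarith
  · intro h
    nlinarith

theorem up_iff_lastUp {k m q : ℤ} (hk : 1 ≤ k) :
    Up (k, m) (k + 1, q - m) ↔ lastUp k (m - 1) < q ∧ q ≤ lastUp k m := by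
  rw [← not_le, le_lastUp hk, le_lastUp hk]
  simp only [Up]
  constructor
  · rintro ⟨_, _, h1, h2⟩
    constructor <;> nlinarith
  · rintro ⟨h1, h2⟩
    refine ⟨by omega, trivial, ?_, ?_⟩ <;> nlinarith

theorem up_iff_lastDown {k m q : ℤ} (hk : 1 ≤ k) :
    Up (k - 1, q - m) (k, m) ↔ lastDown k (m - 1) < q ∧ q ≤ lastDown k m := by
  rw [← not_le, le_lastDown hk, le_lastDown hk]
  simp only [Up]
  constructor
  · rintro ⟨_, _, h1, h2⟩
    constructor <;> nlinarith
  · rintro ⟨h1, h2⟩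
    refine ⟨by omega, by ring, ?_, ?_⟩ <;> nlinarith

/-- For an edge of index `q` out of position `m` of ring `k`, the defining inequalities say that
`(2k + 1) m - k q` lies in `[-k, k]`. This interval contains each residue modulo `2k + 1` once, so
each index belongs to exactly one edge; existence is `exists_up`. -/
theorem up_unique {u v u' v' : ℤ × ℤ} (h : Up u v) (h' : Up u' v') (hk : u.1 = u'.1)
    (hq : u.2 + v.2 = u'.2 + v'.2) : u = u' ∧ v = v' := by
  obtain ⟨a0, a1, a2, a3⟩ := h
  obtain ⟨b0, b1, b2, b3⟩ := h'
  have hm : u.2 = u'.2 := by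
    rw [← hk] at b2 b3
    have e1 : v.2 = u'.2 + v'.2 - u.2 := by omega
    rw [e1] at a2 a3
    rcases lt_trichotomy u.2 u'.2 with h | h | h
    · nlinarith
    · exact h
    · nlinarith
  exact ⟨Prod.ext hk hm, Prod.ext (by omega) (by omega)⟩

theorem exists_up (k q : ℤ) (hk : 0 ≤ k) : ∃ u v, Up u v ∧ u.1 = k ∧ u.2 + v.2 = q := by
  refine ⟨(k, (k * q + k) / (2 * k + 1)), (k + 1, q - (k * q + k) / (2 * k + 1)),
    ⟨hk, rfl, ?_, ?_⟩, rfl, by simp⟩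
  · have := Int.mul_ediv_self_le (x := k * q + k) (k := 2 * k + 1) (by omega)
    simp only
    nlinarith
  · have := Int.lt_mul_ediv_self_add (x := k * q + k) (k := 2 * k + 1) (by omega)
    simp only
    nlinarith

theorem Up.not_symm {u v : ℤ × ℤ} (h : Up u v) : ¬ Up v u := by
  rintro ⟨_, h2, _⟩
  have := h.2.1
  omega

theorem lastUp_mono {k m : ℤ} (hk : 1 ≤ k) : lastUp k (m - 1) ≤ lastUp k m := by
  have h := (le_lastUp hk (m := m - 1)).1 le_rfl
  rw [le_lastUp hk]
  nlinarith

theorem lastDown_mono {k m : ℤ} (hk : 1 ≤ k) : lastDown k (m - 1) ≤ lastDown k m := by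
  have h := (le_lastDown hk (m := m - 1)).1 le_rfl
  rw [le_lastDown hk]
  nlinarith

/-! ### Functions on faces as stream functions of conservative flows. -/

/-- The positively directed part of `bd`. -/
def fwd (g : ℤ → ℤ → ℤ) (u v : ℤ × ℤ) : ℤ :=
  (if Up u v then g u.1 (u.2 + v.2) - g u.1 (u.2 + v.2 - 1) else 0) +
  (if Rt u v then g (u.1 - 1) (lastDown u.1 u.2) - g u.1 (lastUp u.1 u.2) else 0)

/-- The flow along the edges of the cover whose potential is the function `g` on faces. Faces
are pairs `(k, q)`, lying between the upward edges from ring `k` of indices `q` and `q + 1`. -/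
def bd (g : ℤ → ℤ → ℤ) (u v : ℤ × ℤ) : ℤ := fwd g u v - fwd g v u

theorem bd_swap (g : ℤ → ℤ → ℤ) (u v : ℤ × ℤ) : bd g v u = - bd g u v := by
  unfold bd; ring

theorem bd_up (g : ℤ → ℤ → ℤ) {u v : ℤ × ℤ} (h : Up u v) :
    bd g u v = g u.1 (u.2 + v.2) - g u.1 (u.2 + v.2 - 1) := by
  have h1 : ¬ Rt u v := fun h' => by have := h.2.1; have := h'.2.1; omega
  have h2 : ¬ Rt v u := fun h' => by have := h.2.1; have := h'.2.1; omega
  simp [bd, fwd, h, h1, h2, h.not_symm]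

theorem bd_rt (g : ℤ → ℤ → ℤ) {u v : ℤ × ℤ} (h : Rt u v) :
    bd g u v = g (u.1 - 1) (lastDown u.1 u.2) - g u.1 (lastUp u.1 u.2) := by
  have h1 : ¬ Up u v := fun h' => by have := h.2.1; have := h'.2.1; omega
  have h2 : ¬ Up v u := fun h' => by have := h.2.1; have := h'.2.1; omega
  have h3 : ¬ Rt v u := fun h' => by have := h.2.2; have := h'.2.2; omega
  simp [bd, fwd, h, h1, h2, h3]

theorem covAdj_of_bd_ne_zero {g : ℤ → ℤ → ℤ} {u v : ℤ × ℤ} (h : bd g u v ≠ 0) :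
    CovAdj u v := by
  by_contra hc
  unfold CovAdj at hc
  push Not at hc
  obtain ⟨h1, h2, h3, h4⟩ := hc
  simp [bd, fwd, h1, h2, h3, h4] at h

theorem sum_Ioc_sub (f : ℤ → ℤ) {a b : ℤ} (h : a ≤ b) :
    ∑ q ∈ Finset.Ioc a b, (f q - f (q - 1)) = f b - f a := by
  induction b, h using Int.leInduction with
  | base => simp
  | succ b hb ih =>
    have : Finset.Ioc a (b + 1) = insert (b + 1) (Finset.Ioc a b) := by
      ext x; simp; omega
    rw [this, Finset.sum_insert (by simp), ih]
    ring_nf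

/-- The neighbors of a vertex of the cover. -/
noncomputable def nbrs (v : ℤ × ℤ) : Finset (ℤ × ℤ) :=
  ({(v.1, v.2 + 1), (v.1, v.2 - 1)} ∪
    (Finset.Ioc (lastUp v.1 (v.2 - 1)) (lastUp v.1 v.2)).image fun q => (v.1 + 1, q - v.2)) ∪
    (Finset.Ioc (lastDown v.1 (v.2 - 1)) (lastDown v.1 v.2)).image fun q => (v.1 - 1, q - v.2)

theorem mem_nbrs {v w : ℤ × ℤ} (hv : 1 ≤ v.1) (h : CovAdj v w) : w ∈ nbrs v := by
  obtain ⟨k, m⟩ := v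
  obtain ⟨k', m'⟩ := w
  simp only [nbrs, Finset.mem_union, Finset.mem_image, Finset.mem_Ioc, Finset.mem_insert,
    Finset.mem_singleton, Prod.mk.injEq]
  simp only at hv
  rcases h with h | h | h | h
  · have e : k' = k + 1 := h.2.1
    subst e
    refine Or.inl (Or.inr ⟨m + m', ?_, rfl, by ring⟩)
    rw [← up_iff_lastUp hv]
    simpa using h
  · have e : k = k' + 1 := h.2.1
    obtain rfl : k' = k - 1 := by omega
    refine Or.inr ⟨m + m', ?_, rfl, by ring⟩
    rw [← up_iff_lastDown hv]
    simpa using h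
  · exact Or.inl (Or.inl (Or.inl ⟨h.2.1, h.2.2⟩))
  · have h1 : k = k' := h.2.1
    have h2 : m = m' + 1 := h.2.2
    exact Or.inl (Or.inl (Or.inr ⟨h1.symm, by omega⟩))

/-- Kirchhoff's law: the edges out of a vertex separate consecutive faces of the cycle around it, so
the differences of `g` telescope to zero. -/
theorem sum_nbrs_bd (g : ℤ → ℤ → ℤ) {v : ℤ × ℤ} (hv : 1 ≤ v.1) :
    ∑ w ∈ nbrs v, bd g v w = 0 := by
  obtain ⟨k, m⟩ := v
  simp only at hv
  unfold nbrs
  rw [Finset.sum_union, Finset.sum_union, Finset.sum_image, Finset.sum_image, Finset.sum_pair]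
  · have h1 : bd g (k, m) (k, m + 1) = g (k - 1) (lastDown k m) - g k (lastUp k m) :=
      bd_rt g (u := (k, m)) (v := (k, m + 1)) ⟨hv, rfl, rfl⟩
    have h2 : bd g (k, m) (k, m - 1) =
        -(g (k - 1) (lastDown k (m - 1)) - g k (lastUp k (m - 1))) := by
      rw [bd_swap, bd_rt g (u := (k, m - 1)) (v := (k, m)) ⟨hv, rfl, by simp⟩]
    have h3 : ∑ q ∈ Finset.Ioc (lastUp k (m - 1)) (lastUp k m), bd g (k, m) (k + 1, q - m) =
        g k (lastUp k m) - g k (lastUp k (m - 1)) := by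
      rw [← sum_Ioc_sub (g k) (lastUp_mono hv)]
      refine Finset.sum_congr rfl fun q hq => ?_
      rw [bd_up g ((up_iff_lastUp hv).2 (Finset.mem_Ioc.1 hq))]
      simp
    have h4 : ∑ q ∈ Finset.Ioc (lastDown k (m - 1)) (lastDown k m), bd g (k, m) (k - 1, q - m) =
        -(g (k - 1) (lastDown k m) - g (k - 1) (lastDown k (m - 1))) := by
      rw [← sum_Ioc_sub (g (k - 1)) (lastDown_mono hv), ← Finset.sum_neg_distrib]
      refine Finset.sum_congr rfl fun q hq => ?_
      rw [bd_swap, bd_up g ((up_iff_lastDown hv).2 (Finset.mem_Ioc.1 hq))]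
      simp
    simp only [h1, h2, h3, h4]
    ring
  · simp; omega
  · intro a _ b _ h
    simp at h; omega
  · intro a _ b _ h
    simp at h; omega
  · rw [Finset.disjoint_left]
    rintro ⟨x, y⟩ hx hy
    simp at hx hy
    omega
  · rw [Finset.disjoint_left]
    rintro ⟨x, y⟩ hx hy
    simp at hx hy
    omega

/-- The face `f` lies on one of the two sides of the edge between `u` and `v`. -/
def OnEdge (u v f : ℤ × ℤ) : Prop :=
  (Up u v ∧ f.1 = u.1 ∧ (f.2 = u.2 + v.2 ∨ f.2 = u.2 + v.2 - 1)) ∨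
  (Up v u ∧ f.1 = v.1 ∧ (f.2 = v.2 + u.2 ∨ f.2 = v.2 + u.2 - 1)) ∨
  (Rt u v ∧ (f = (u.1 - 1, lastDown u.1 u.2) ∨ f = (u.1, lastUp u.1 u.2))) ∨
  (Rt v u ∧ (f = (v.1 - 1, lastDown v.1 v.2) ∨ f = (v.1, lastUp v.1 v.2)))

theorem OnEdge.symm {u v f : ℤ × ℤ} (h : OnEdge u v f) : OnEdge v u f := by
  unfold OnEdge at *; tauto

/-- The two faces do not depend on `g`, so that the jumps of several functions across one edge can
be compared. -/
theorem bd_eq_of_covAdj {u v : ℤ × ℤ} (h : CovAdj u v) : ∃ f₁ f₂, OnEdge u v f₁ ∧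
    OnEdge u v f₂ ∧ ∀ g : ℤ → ℤ → ℤ, bd g u v = g f₁.1 f₁.2 - g f₂.1 f₂.2 := by
  rcases h with h | h | h | h
  · exact ⟨(u.1, u.2 + v.2), (u.1, u.2 + v.2 - 1), Or.inl ⟨h, rfl, Or.inl rfl⟩,
      Or.inl ⟨h, rfl, Or.inr rfl⟩, fun g => bd_up g h⟩
  · exact ⟨(v.1, v.2 + u.2 - 1), (v.1, v.2 + u.2), Or.inr (Or.inl ⟨h, rfl, Or.inr rfl⟩),
      Or.inr (Or.inl ⟨h, rfl, Or.inl rfl⟩), fun g => by rw [bd_swap, bd_up g h]; ring⟩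
  · exact ⟨(u.1 - 1, lastDown u.1 u.2), (u.1, lastUp u.1 u.2),
      Or.inr (Or.inr (Or.inl ⟨h, Or.inl rfl⟩)), Or.inr (Or.inr (Or.inl ⟨h, Or.inr rfl⟩)),
      fun g => bd_rt g h⟩
  · exact ⟨(v.1, lastUp v.1 v.2), (v.1 - 1, lastDown v.1 v.2),
      Or.inr (Or.inr (Or.inr ⟨h, Or.inr rfl⟩)), Or.inr (Or.inr (Or.inr ⟨h, Or.inl rfl⟩)),
      fun g => by rw [bd_swap, bd_rt g h]; ring⟩

theorem OnEdge.row {u v f : ℤ × ℤ} (h : OnEdge u v f) {K : ℤ} (hK : u.1 < K ∨ v.1 < K) :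
    0 ≤ f.1 ∧ f.1 < K := by
  rcases h with ⟨h, h', _⟩ | ⟨h, h', _⟩ | ⟨h, h' | h'⟩ | ⟨h, h' | h'⟩
  · have := h.1; have := h.2.1; omega
  · have := h.1; have := h.2.1; omega
  all_goals
    have := h.1; have := h.2.1; rw [h']; simp only; omega

/-- If no flow of `bd g` passes at `v` then `g` is constant around `v`. -/
theorem eq_around {g : ℤ → ℤ → ℤ} {v : ℤ × ℤ} (hv : 1 ≤ v.1)
    (h : ∀ w, CovAdj v w → bd g v w = 0) {w w' f f' : ℤ × ℤ}
    (hf : OnEdge v w f) (hf' : OnEdge v w' f') : g f.1 f.2 = g f'.1 f'.2 := by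
  suffices key : ∀ w f, OnEdge v w f → g f.1 f.2 = g v.1 (lastUp v.1 v.2) by
    rw [key w f hf, key w' f' hf']
  clear hf hf' f f' w w'
  obtain ⟨k, m⟩ := v
  simp only at hv
  -- The faces just outside ring `k` at this vertex are visited backwards from the last one, `d`
  -- counting the upward edges crossed; `hdn` does the same on the inner side.
  have hup : ∀ d : ℕ, ∀ q, q = lastUp k m - d → lastUp k (m - 1) ≤ q →
      g k q = g k (lastUp k m) := by
    intro d
    induction d with
    | zero => rintro q rfl _; simp
    | succ d ih =>
      intro q hq hl
      rw [← ih (q + 1) (by push_cast at hq; omega) (by omega)]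
      have hU : Up (k, m) (k + 1, q + 1 - m) := (up_iff_lastUp hv).2 ⟨by omega, by omega⟩
      have := h _ (Or.inl hU)
      rw [bd_up g hU] at this
      simp at this
      omega
  have hdn : ∀ d : ℕ, ∀ q, q = lastDown k m - d → lastDown k (m - 1) ≤ q →
      g (k - 1) q = g (k - 1) (lastDown k m) := by
    intro d
    induction d with
    | zero => rintro q rfl _; simp
    | succ d ih =>
      intro q hq hl
      rw [← ih (q + 1) (by push_cast at hq; omega) (by omega)]
      have hU : Up (k - 1, q + 1 - m) (k, m) := (up_iff_lastDown hv).2 ⟨by omega, by omega⟩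
      have := h _ (Or.inr (Or.inl hU))
      rw [bd_swap, bd_up g hU] at this
      simp at this
      omega
  have hup' : ∀ q, lastUp k (m - 1) ≤ q → q ≤ lastUp k m → g k q = g k (lastUp k m) :=
    fun q h1 h2 => hup (lastUp k m - q).toNat q (by omega) h1
  have hr : g (k - 1) (lastDown k m) = g k (lastUp k m) := by
    have hR : Rt (k, m) (k, m + 1) := ⟨hv, rfl, rfl⟩
    have := h _ (Or.inr (Or.inr (Or.inl hR)))
    rw [bd_rt g hR] at this
    simp only at this
    omega
  have hdn' : ∀ q, lastDown k (m - 1) ≤ q → q ≤ lastDown k m →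
      g (k - 1) q = g k (lastUp k m) :=
    fun q h1 h2 => (hdn (lastDown k m - q).toNat q (by omega) h1).trans hr
  rintro ⟨k', m'⟩ ⟨a, q⟩ (⟨h1, h2, h3⟩ | ⟨h1, h2, h3⟩ | ⟨h1, h3⟩ | ⟨h1, h3⟩)
  · simp only at h2 h3
    subst h2
    obtain rfl : k' = a + 1 := h1.2.1
    obtain ⟨h4, h5⟩ := (up_iff_lastUp (m := m) (q := m + m') hv).1 (by simpa using h1)
    exact hup' q (by omega) (by omega)
  · simp only at h2 h3
    subst h2
    have e : k = a + 1 := h1.2.1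
    obtain rfl : a = k - 1 := by omega
    obtain ⟨h4, h5⟩ := (up_iff_lastDown (m := m) (q := m' + m) hv).1 (by simpa using h1)
    exact hdn' q (by omega) (by omega)
  · rcases h3 with h3 | h3
    · obtain ⟨rfl, rfl⟩ := Prod.mk.inj h3
      exact hr
    · obtain ⟨rfl, rfl⟩ := Prod.mk.inj h3
      rfl
  · have e1 : k = k' := h1.2.1
    have e2 : m = m' + 1 := h1.2.2
    subst e1
    obtain rfl : m' = m - 1 := by omega
    rcases h3 with h3 | h3
    · obtain ⟨rfl, rfl⟩ := Prod.mk.inj h3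
      exact hdn' _ le_rfl (lastDown_mono hv)
    · obtain ⟨rfl, rfl⟩ := Prod.mk.inj h3
      exact hup' _ le_rfl (lastUp_mono hv)

/-- A function on faces without flow is constant. -/
theorem eq_of_bd_eq_zero {g : ℤ → ℤ → ℤ} {K : ℤ}
    (h : ∀ u v, CovAdj u v → u.1 < K ∨ v.1 < K → bd g u v = 0) (q₀ : ℤ) :
    ∀ k q, 0 ≤ k → k < K → g k q = g 0 q₀ := by
  have hstep : ∀ k q, 0 ≤ k → k < K → g k q = g k (q - 1) := by
    intro k q h0 hk
    obtain ⟨u, v, huv, hu, hq⟩ := exists_up k q h0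
    have := h u v (Or.inl huv) (Or.inl (by omega))
    rw [bd_up g huv, hu, hq] at this
    omega
  have hlayer : ∀ k q q', 0 ≤ k → k < K → g k q = g k q' := by
    intro k q q' h0 hk
    have key : ∀ d : ℕ, ∀ q, g k (q + d) = g k q := by
      intro d
      induction d with
      | zero => simp
      | succ d ih =>
        intro q
        rw [hstep k _ h0 hk, ← ih q]
        congr 1
        push_cast; ring
    rcases le_total q q' with hq | hq
    · rw [← key (q' - q).toNat q]; congr 1; omega
    · rw [← key (q - q').toNat q']; congr 1; omega
  intro k q h0
  obtain ⟨d, rfl⟩ := Int.eq_ofNat_of_zero_le h0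
  clear h0
  induction d generalizing q with
  | zero => intro hk; exact hlayer 0 _ _ le_rfl hk
  | succ d ih =>
    intro hk
    have hR : Rt (((d + 1 : ℕ) : ℤ), 0) (((d + 1 : ℕ) : ℤ), 0 + 1) :=
      ⟨by push_cast; omega, rfl, rfl⟩
    have := h _ _ (Or.inr (Or.inr (Or.inl hR))) (Or.inl hk)
    rw [bd_rt g hR] at this
    simp only at this
    have e : ((d + 1 : ℕ) : ℤ) - 1 = d := by push_cast; ring
    rw [e, ih _ (by push_cast at hk; omega)] at this
    rw [hlayer _ q (lastUp ((d + 1 : ℕ) : ℤ) 0) (by omega) hk]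
    omega

/-! ### Paths from the apex, their heights, and a discrete Jordan theorem. -/

/-- A path in the cover from the apex `(0, 0)` to ring `K`. -/
structure RingPath (K : ℤ) where
  p : ℕ → ℤ × ℤ
  L : ℕ
  adj : ∀ i < L, CovAdj (p i) (p (i + 1))
  inj : ∀ i ≤ L, ∀ l ≤ L, p i = p l → i = l
  zero : p 0 = (0, 0)
  top : (p L).1 = K
  lt_top : ∀ i < L, (p i).1 < K
  pos : ∀ i, 0 < i → i ≤ L → 1 ≤ (p i).1

/-- Indicator of an upward edge of the layer `k`, of index at most `q`. -/
def upInd (k q : ℤ) (u v : ℤ × ℤ) : ℤ := if Up u v ∧ u.1 = k ∧ u.2 + v.2 ≤ q then 1 else 0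

theorem upInd_sub (k q : ℤ) (u v : ℤ × ℤ) :
    upInd k q u v - upInd k (q - 1) u v = if Up u v ∧ u.1 = k ∧ u.2 + v.2 = q then 1 else 0 := by
  unfold upInd
  by_cases h : Up u v ∧ u.1 = k
  · simp only [h, true_and]
    split_ifs <;> omega
  · have e : ∀ P : Prop, ¬ (Up u v ∧ u.1 = k ∧ P) := fun P h' => h ⟨h'.1, h'.2.1⟩
    simp [e]

/-- Balance for the half ring of positions at most `m` in ring `k`: what enters from the layer
below, minus what leaves to the layer above, is the change of the indicator of the half ring plus
what escapes through the ring edge from `m` to `m + 1`. -/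
theorem upInd_row {k m : ℤ} (hk : 1 ≤ k) {u v : ℤ × ℤ} (huv : CovAdj u v) :
    (upInd (k - 1) (lastDown k m) u v - upInd (k - 1) (lastDown k m) v u) -
      (upInd k (lastUp k m) u v - upInd k (lastUp k m) v u) =
    ((if v.1 = k ∧ v.2 ≤ m then 1 else 0) - (if u.1 = k ∧ u.2 ≤ m then 1 else 0)) +
      ((if u = (k, m) ∧ v = (k, m + 1) then 1 else 0) -
        (if v = (k, m) ∧ u = (k, m + 1) then 1 else 0)) := by
  have key : ∀ u v, Up u v → upInd (k - 1) (lastDown k m) u v - upInd k (lastUp k m) u v =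
      (if v.1 = k ∧ v.2 ≤ m then 1 else 0) - (if u.1 = k ∧ u.2 ≤ m then 1 else 0) := by
    intro u v h
    have e := h.2.1
    congr 1
    · unfold upInd
      congr 1
      simp only [h, true_and, eq_iff_iff]
      constructor
      · rintro ⟨h1, h2⟩
        have : v.1 = k := by omega
        rw [← this] at h2
        exact ⟨this, (up_le_lastDown h m).1 h2⟩
      · rintro ⟨h1, h2⟩
        refine ⟨by omega, ?_⟩
        rw [← h1]
        exact (up_le_lastDown h m).2 h2
    · unfold upInd
      congr 1
      simp only [h, true_and, eq_iff_iff]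
      constructor
      · rintro ⟨h1, h2⟩
        rw [← h1] at h2
        exact ⟨h1, (up_le_lastUp h (by omega) m).1 h2⟩
      · rintro ⟨h1, h2⟩
        refine ⟨h1, ?_⟩
        rw [← h1]
        exact (up_le_lastUp h (by omega) m).2 h2
  have hz : ∀ u v, ¬ Up u v → ∀ k q, upInd k q u v = 0 := by
    intro u v h k q; simp [upInd, h]
  have hne : ∀ u v : ℤ × ℤ, u.1 ≠ v.1 → ¬ (u = (k, m) ∧ v = (k, m + 1)) := by
    rintro u v h ⟨rfl, rfl⟩; exact h rfl
  rcases huv with h | h | h | h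
  · have e := h.2.1
    have h1 := key u v h
    have h2 := hz v u h.not_symm
    rw [if_neg (hne u v (by omega)), if_neg (hne v u (by omega)), h2, h2]
    omega
  · have e := h.2.1
    have h1 := key v u h
    have h2 := hz u v h.not_symm
    rw [if_neg (hne u v (by omega)), if_neg (hne v u (by omega)), h2, h2]
    omega
  · obtain ⟨h1, h2, h3⟩ := h
    have n1 : ¬ Up u v := fun h' => by have := h'.2.1; omega
    have n2 : ¬ Up v u := fun h' => by have := h'.2.1; omega
    simp only [hz _ _ n1, hz _ _ n2, Prod.ext_iff, h2, h3]
    split_ifs <;> omega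
  · obtain ⟨h1, h2, h3⟩ := h
    have n1 : ¬ Up u v := fun h' => by have := h'.2.1; omega
    have n2 : ¬ Up v u := fun h' => by have := h'.2.1; omega
    simp only [hz _ _ n1, hz _ _ n2, Prod.ext_iff, h2, h3]
    split_ifs <;> omega

namespace RingPath

variable {K : ℤ} (P : RingPath K)

/-- The height function of a path: the signed number of crossings of the layer `k` at indices
at most `q`. -/
def ht (k q : ℤ) : ℤ :=
  ∑ i ∈ Finset.range P.L, (upInd k q (P.p i) (P.p (i + 1)) - upInd k q (P.p (i + 1)) (P.p i))

/-- The flow of a path through an edge. -/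
def flow (u v : ℤ × ℤ) : ℤ :=
  ∑ i ∈ Finset.range P.L, ((if P.p i = u ∧ P.p (i + 1) = v then 1 else 0) -
    (if P.p (i + 1) = u ∧ P.p i = v then 1 else 0))

theorem flow_swap (u v : ℤ × ℤ) : P.flow v u = - P.flow u v := by
  unfold flow
  rw [← Finset.sum_neg_distrib]
  refine Finset.sum_congr rfl fun i _ => ?_
  rw [neg_sub]
  congr 1 <;> (congr 1; rw [and_comm])

theorem flow_ne_zero {u v : ℤ × ℤ} (h : P.flow u v ≠ 0) :
    ∃ i < P.L, (P.p i = u ∧ P.p (i + 1) = v) ∨ (P.p (i + 1) = u ∧ P.p i = v) := by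
  by_contra! hc
  apply h
  unfold flow
  refine Finset.sum_eq_zero fun i hi => ?_
  obtain ⟨h1, h2⟩ := hc i (Finset.mem_range.1 hi)
  rw [if_neg (fun h => h1 h.1 h.2), if_neg (fun h => h2 h.1 h.2), sub_zero]

theorem flow_edge {i : ℕ} (hi : i < P.L) : P.flow (P.p i) (P.p (i + 1)) = 1 := by
  unfold flow
  rw [Finset.sum_eq_single i]
  · rw [if_pos ⟨rfl, rfl⟩, if_neg, sub_zero]
    rintro ⟨h, _⟩
    have := P.inj _ (by omega) _ (by omega) h
    omega
  · intro l hl hli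
    have hl := Finset.mem_range.1 hl
    rw [if_neg, if_neg, sub_zero]
    · rintro ⟨h, h'⟩
      have := P.inj _ (by omega) _ (by omega) h
      have := P.inj _ (by omega) _ (by omega) h'
      omega
    · rintro ⟨h, h'⟩
      have := P.inj _ (by omega) _ (by omega) h
      omega
  · intro h; simp at h; omega

theorem bd_ht_up {u v : ℤ × ℤ} (h : Up u v) : bd P.ht u v = P.flow u v := by
  rw [bd_up _ h]
  unfold ht flow
  rw [← Finset.sum_sub_distrib]
  refine Finset.sum_congr rfl fun i hi => ?_
  have key : ∀ a b : ℤ × ℤ, upInd u.1 (u.2 + v.2) a b - upInd u.1 (u.2 + v.2 - 1) a b =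
      if a = u ∧ b = v then 1 else 0 := by
    intro a b
    rw [upInd_sub]
    congr 1
    rw [eq_iff_iff]
    constructor
    · rintro ⟨h1, h2, h3⟩
      exact up_unique h1 h h2 h3
    · rintro ⟨rfl, rfl⟩
      exact ⟨h, rfl, rfl⟩
  have h1 := key (P.p i) (P.p (i + 1))
  have h2 := key (P.p (i + 1)) (P.p i)
  omega

/-- Summing `upInd_row` along the path, the indicator of the half ring telescopes to zero, since the
path starts in ring `0` and ends in ring `K`. Only the flow through the ring edge remains. -/
theorem bd_ht_rt {u v : ℤ × ℤ} (h : Rt u v) (hK : u.1 < K) : bd P.ht u v = P.flow u v := by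
  rw [bd_rt _ h]
  obtain ⟨k, m⟩ := u
  obtain ⟨k', m'⟩ := v
  obtain ⟨hk, h1, h2⟩ := h
  simp only at hk h1 h2 hK
  subst h1 h2
  have hφ := Finset.sum_range_sub
    (fun i => (if (P.p i).1 = k' ∧ (P.p i).2 ≤ m then 1 else 0 : ℤ)) P.L
  rw [if_neg (by rw [P.top]; omega), if_neg (by rw [P.zero]; simp; omega), sub_zero] at hφ
  have e := Finset.sum_congr (s₁ := Finset.range P.L) rfl fun i hi =>
    upInd_row (m := m) hk (P.adj i (Finset.mem_range.1 hi))
  rw [Finset.sum_add_distrib, hφ, zero_add, Finset.sum_sub_distrib] at e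
  exact e

theorem bd_ht {u v : ℤ × ℤ} (h : CovAdj u v) (hK : u.1 < K ∨ v.1 < K) :
    bd P.ht u v = P.flow u v := by
  rcases h with h | h | h | h
  · exact P.bd_ht_up h
  · rw [bd_swap, P.bd_ht_up h, ← P.flow_swap]
  · exact P.bd_ht_rt h (by have := h.2.1; omega)
  · rw [bd_swap, P.bd_ht_rt h (by have := h.2.1; omega), ← P.flow_swap]

theorem L_pos (hK : 0 < K) : 0 < P.L := by
  rcases Nat.eq_zero_or_pos P.L with h | h
  · have := P.top
    rw [h, P.zero] at this
    simp at this
    omega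
  · exact h

/-- The path never returns to the apex, so its first edge is its only crossing of the innermost
layer. -/
theorem ht_zero (hK : 0 < K) (q : ℤ) : P.ht 0 q = if (P.p 1).2 ≤ q then 1 else 0 := by
  have hL := P.L_pos hK
  unfold ht
  rw [Finset.sum_eq_single 0]
  · have h1 : ¬ (Up (P.p (0 + 1)) (P.p 0) ∧ (P.p (0 + 1)).1 = 0 ∧
        (P.p (0 + 1)).2 + (P.p 0).2 ≤ q) := by
      rintro ⟨_, h, _⟩
      have := P.pos 1 (by omega) (by omega)
      rw [zero_add] at h; omega
    have h2 : Up (P.p 0) (P.p (0 + 1)) := by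
      have e0 : (P.p 0).1 = 0 := by rw [P.zero]
      have e1 := P.pos 1 (by omega) (by omega)
      rcases P.adj 0 hL with h | h | h | h
      · exact h
      · have := h.2.1
        rw [zero_add] at this; omega
      · have := h.1; omega
      · have := h.2.1; rw [zero_add] at this; omega
    unfold upInd
    rw [if_neg h1, sub_zero]
    congr 1
    simp [P.zero] at h2 ⊢
    exact fun _ => h2
  · intro i hi hi0
    have hi := Finset.mem_range.1 hi
    have h1 := P.pos i (by omega) (by omega)
    have h2 := P.pos (i + 1) (by omega) (by omega)
    unfold upInd
    rw [if_neg (by rintro ⟨_, h, _⟩; omega), if_neg (by rintro ⟨_, h, _⟩; omega), sub_zero]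
  · intro h; simp at h; omega

/-- A flow which is a potential and vanishes off the path is constant along the path. -/
theorem bd_const {g : ℤ → ℤ → ℤ}
    (hg : ∀ u v, CovAdj u v → u.1 < K ∨ v.1 < K → bd g u v ≠ 0 → P.flow u v ≠ 0) :
    ∀ i < P.L, bd g (P.p i) (P.p (i + 1)) = bd g (P.p 0) (P.p 1) := by
  intro i
  induction i with
  | zero => intro _; rfl
  | succ i ih =>
    intro hi
    rw [← ih (by omega)]
    have hpos := P.pos (i + 1) (by omega) (by omega)
    have hs := sum_nbrs_bd g hpos
    have hlt := P.lt_top (i + 1) hi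
    have hne : P.p i ≠ P.p (i + 1 + 1) := fun h => by
      have := P.inj _ (by omega) _ (by omega) h; omega
    have hsub : ({P.p i, P.p (i + 1 + 1)} : Finset _) ⊆ nbrs (P.p (i + 1)) := by
      intro w hw
      simp only [Finset.mem_insert, Finset.mem_singleton] at hw
      rcases hw with rfl | rfl
      · exact mem_nbrs hpos (P.adj i (by omega)).symm
      · exact mem_nbrs hpos (P.adj (i + 1) hi)
    -- By self-avoidance only the two path edges at this vertex can carry flow; conservation then
    -- equates their values.
    rw [← Finset.sum_subset hsub, Finset.sum_pair hne, bd_swap] at hs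
    · omega
    · intro w _ hw
      by_contra hc
      obtain ⟨l, hl, ⟨h1, h2⟩ | ⟨h1, h2⟩⟩ :=
        P.flow_ne_zero (hg _ _ (covAdj_of_bd_ne_zero hc) (Or.inl hlt) hc)
      · have := P.inj _ (by omega) _ (by omega) h1
        subst this; simp [h2] at hw
      · have := P.inj _ (by omega) _ (by omega) h1
        obtain rfl : l = i := by omega
        simp [h2] at hw

/-- The flow of `g` is constant along the path, and on the first edge it is a difference of two
values of `g` in layer `0`, hence zero. So `g` has no flow at all and is constant. -/
theorem eq_zero_of_bd {g : ℤ → ℤ → ℤ} (hK : 0 < K)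
    (hg : ∀ u v, CovAdj u v → u.1 < K ∨ v.1 < K → bd g u v ≠ 0 → P.flow u v ≠ 0)
    (h0 : ∀ q, g 0 q = 0) : ∀ k q, 0 ≤ k → k < K → g k q = 0 := by
  intro k q hk hkK
  rw [eq_of_bd_eq_zero (K := K) (g := g) ?_ 0 k q hk hkK, h0]
  intro u v huv hK'
  by_contra hc
  have key : ∀ i < P.L, bd g (P.p i) (P.p (i + 1)) = 0 := by
    intro i hi
    rw [P.bd_const hg i hi]
    obtain ⟨f₁, f₂, h1, h2, h⟩ := bd_eq_of_covAdj (P.adj 0 (P.L_pos hK))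
    rw [zero_add] at h
    have hu : (P.p 0).1 < 1 ∨ (P.p 1).1 < 1 := Or.inl (by rw [P.zero]; simp)
    have r1 := h1.row hu
    have r2 := h2.row hu
    rw [h, show f₁.1 = 0 by omega, show f₂.1 = 0 by omega, h0, h0, sub_zero]
  obtain ⟨l, hl, ⟨h1, h2⟩ | ⟨h1, h2⟩⟩ := P.flow_ne_zero (hg _ _ huv hK' hc)
  · rw [← h1, ← h2] at hc; exact hc (key l hl)
  · rw [← h1, ← h2, bd_swap] at hc; exact hc (by rw [key l hl, neg_zero])

/-- Jordan's theorem in discrete form: the path has two sides only. The indicator of the faces where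
the height is neither `0` nor `1` can jump only where the height does, that is on the path, and
vanishes in layer `0`; `eq_zero_of_bd` makes it vanish everywhere. -/
theorem ht_mem (hK : 0 < K) {k q : ℤ} (hk : 0 ≤ k) (hkK : k < K) :
    P.ht k q = 0 ∨ P.ht k q = 1 := by
  have := P.eq_zero_of_bd (g := fun k q => if P.ht k q = 0 ∨ P.ht k q = 1 then 0 else 1) hK
    ?_ ?_ k q hk hkK
  · by_contra hc
    simp [hc] at this
  · intro u v huv hK' h
    rw [← P.bd_ht huv hK']
    obtain ⟨f₁, f₂, h1, h2, h'⟩ := bd_eq_of_covAdj huv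
    rw [h'] at h ⊢
    intro hc
    rw [sub_eq_zero] at hc
    apply h
    simp only [hc, sub_self]
  · intro q
    rw [P.ht_zero hK]
    split_ifs <;> simp_all

/-- The counterpart of `ht_zero`: ring `K` is reached only at the end, so the last edge is the only
crossing of the outermost layer. -/
theorem ht_top (hK : 0 < K) (q : ℤ) :
    P.ht (K - 1) q = if (P.p (P.L - 1)).2 + (P.p P.L).2 ≤ q then 1 else 0 := by
  have hL := P.L_pos hK
  obtain ⟨l, hl⟩ : ∃ l, P.L = l + 1 := ⟨P.L - 1, by omega⟩
  have htop := P.top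
  have hlt := P.lt_top l (by omega)
  unfold ht
  rw [Finset.sum_eq_single l]
  · rw [hl] at htop
    have h1 : ¬ (Up (P.p (l + 1)) (P.p l) ∧ (P.p (l + 1)).1 = K - 1 ∧
        (P.p (l + 1)).2 + (P.p l).2 ≤ q) := by
      rintro ⟨_, h, _⟩
      omega
    have h2 : Up (P.p l) (P.p (l + 1)) := by
      rcases P.adj l (by omega) with h | h | h | h
      · exact h
      · have := h.2.1
        omega
      · have := h.2.1
        omega
      · have := h.2.1
        omega
    have h3 := h2.2.1
    unfold upInd
    rw [if_neg h1, sub_zero, hl, Nat.add_sub_cancel]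
    congr 1
    rw [eq_iff_iff]
    exact ⟨fun h => h.2.2, fun h => ⟨h2, by omega, h⟩⟩
  · intro i hi hi0
    have hi := Finset.mem_range.1 hi
    have h1 := P.lt_top i (by omega)
    have h2 := P.lt_top (i + 1) (by omega)
    unfold upInd
    rw [if_neg (by rintro ⟨h, h', _⟩; have := h.2.1; omega),
      if_neg (by rintro ⟨h, h', _⟩; have := h.2.1; omega), sub_zero]
  · intro h; simp at h; omega

/-- The height function of a path is constant around the vertices off the path. -/
theorem ht_around {v : ℤ × ℤ} (hv : 1 ≤ v.1) (hvK : v.1 < K) (hn : ∀ i ≤ P.L, P.p i ≠ v)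
    {w w' f f' : ℤ × ℤ} (hf : OnEdge v w f) (hf' : OnEdge v w' f') :
    P.ht f.1 f.2 = P.ht f'.1 f'.2 := by
  refine eq_around hv (fun w hw => ?_) hf hf'
  rw [P.bd_ht hw (Or.inl hvK)]
  by_contra hc
  obtain ⟨l, hl, ⟨h1, h2⟩ | ⟨h1, h2⟩⟩ := P.flow_ne_zero hc
  · exact hn _ (by omega) h1
  · exact hn _ (by omega) h1

end RingPath

/-! ### Sector coordinates, distance to the origin, ancestor and descendant lines. -/

/-- The nearest axis of a vertex of the cover: the nearest integer to `m / k`. -/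
def ax (v : ℤ × ℤ) : ℤ := (2 * v.2 + v.1 - 1) / (2 * v.1)

/-- The position of a vertex with respect to its nearest axis. -/
def off (v : ℤ × ℤ) : ℤ := v.2 - v.1 * ax v

/-- The neighbor of `v` nearest to the origin. -/
def par (v : ℤ × ℤ) : ℤ × ℤ := (v.1 - 1, v.2 - ax v)

/-- The neighbor of `v` farthest from the origin. -/
def child (v : ℤ × ℤ) : ℤ × ℤ := (v.1 + 1, v.2 + ax v)

/-- The squared distance to the origin. -/
def nsq (v : ℤ × ℤ) : ℤ := v.1 ^ 2 - v.1 * |off v| + off v ^ 2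

theorem snd_eq (v : ℤ × ℤ) : v.2 = v.1 * ax v + off v := by unfold off; ring

theorem off_bounds {v : ℤ × ℤ} (hv : 1 ≤ v.1) : -v.1 < 2 * off v ∧ 2 * off v ≤ v.1 := by
  have h1 := Int.mul_ediv_self_le (x := 2 * v.2 + v.1 - 1) (k := 2 * v.1) (by omega)
  have h2 := Int.lt_mul_ediv_self_add (x := 2 * v.2 + v.1 - 1) (k := 2 * v.1) (by omega)
  unfold off ax
  constructor <;> nlinarith

theorem ax_eq {v : ℤ × ℤ} {c : ℤ} (hv : 1 ≤ v.1) (h1 : -v.1 < 2 * (v.2 - v.1 * c))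
    (h2 : 2 * (v.2 - v.1 * c) ≤ v.1) : ax v = c := by
  obtain ⟨h3, h4⟩ := off_bounds hv
  unfold off at h3 h4
  rcases lt_trichotomy (ax v) c with h | h | h
  · nlinarith
  · exact h
  · nlinarith

/-- Either axis bounding the sector may be used: passing from one to the other replaces the absolute
offset `|d|` by `k - |d|`, which preserves `k² - k|d| + d²`. -/
theorem nsq_eq {v : ℤ × ℤ} {c : ℤ} (hv : 1 ≤ v.1) (h : |v.2 - v.1 * c| ≤ v.1) :
    nsq v = v.1 ^ 2 - v.1 * |v.2 - v.1 * c| + (v.2 - v.1 * c) ^ 2 := by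
  obtain ⟨h3, h4⟩ := off_bounds hv
  unfold nsq
  have e := snd_eq v
  generalize off v = d at *
  obtain ⟨t, ht⟩ : ∃ t, ax v = c + t := ⟨ax v - c, by ring⟩
  have e2 : v.2 - v.1 * c = v.1 * t + d := by rw [e, ht]; ring
  rw [e2] at h ⊢
  rw [abs_le] at h
  obtain ⟨h1, h2⟩ := h
  have t1 : t ≤ 1 := by nlinarith
  have t2 : -1 ≤ t := by nlinarith
  have : t = -1 ∨ t = 0 ∨ t = 1 := by omega
  rcases this with rfl | rfl | rfl
  · have hd : 0 ≤ d := by linarith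
    rw [abs_of_nonneg hd, abs_of_nonpos (by linarith)]
    ring
  · simp
  · have hd : d ≤ 0 := by linarith
    rw [abs_of_nonpos hd, abs_of_nonneg (by linarith)]
    ring

theorem up_par {v : ℤ × ℤ} (hv : 1 ≤ v.1) : Up (par v) v := by
  obtain ⟨h1, h2⟩ := off_bounds hv
  have e : (v.1 - 1 + 1) * (v.2 - ax v) - (v.1 - 1) * v.2 = off v := by unfold off; ring
  simp only [Up, par]
  rw [e]
  omega

theorem up_child {v : ℤ × ℤ} (hv : 1 ≤ v.1) : Up v (child v) := by
  obtain ⟨h1, h2⟩ := off_bounds hv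
  have e : (v.1 + 1) * v.2 - v.1 * (v.2 + ax v) = off v := by unfold off; ring
  refine ⟨by omega, rfl, ?_, ?_⟩ <;> simp only [child] <;> rw [e] <;> omega

theorem ax_child {v : ℤ × ℤ} (hv : 1 ≤ v.1) : ax (child v) = ax v := by
  obtain ⟨h1, h2⟩ := off_bounds hv
  have e := snd_eq v
  refine ax_eq ?_ ?_ ?_ <;> simp only [child]
  · omega
  · rw [e]; ring_nf at *; omega
  · rw [e]; ring_nf at *; omega

theorem off_child {v : ℤ × ℤ} (hv : 1 ≤ v.1) : off (child v) = off v := by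
  have := ax_child hv
  unfold off
  rw [this]
  simp only [child]
  ring

theorem nsq_child {v : ℤ × ℤ} (hv : 1 ≤ v.1) :
    nsq (child v) = (v.1 + 1) ^ 2 - (v.1 + 1) * |off v| + off v ^ 2 := by
  unfold nsq
  rw [off_child hv]
  rfl

theorem nsq_par {v : ℤ × ℤ} (hv : 2 ≤ v.1) :
    nsq (par v) = (v.1 - 1) ^ 2 - (v.1 - 1) * |off v| + off v ^ 2 := by
  obtain ⟨h1, h2⟩ := off_bounds (v := v) (by omega)
  have e : (par v).2 - (par v).1 * ax v = off v := by
    simp only [par]; unfold off; ring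
  rw [nsq_eq (c := ax v)]
  · rw [e]; rfl
  · simp only [par]; omega
  · rw [e, abs_le]; simp only [par]; constructor <;> omega

theorem form_mono {x y x' y' : ℤ} (hx' : 0 ≤ x') (hy' : 0 ≤ y') (hx : x' ≤ x) (hy : y' ≤ y) :
    x' ^ 2 + x' * y' + y' ^ 2 ≤ x ^ 2 + x * y + y ^ 2 := by
  have : 0 ≤ x := by omega
  have : 0 ≤ y := by omega
  gcongr

/-- Ancestor lines do not cross. The parent sits at `(k - 1) ax + off`; a larger axis contributes at
least `k - 1`, and two offsets in ring `k` differ by at most `k - 1`. -/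
theorem par_mono {u v : ℤ × ℤ} (hu : 1 ≤ u.1) (h : u.1 = v.1) (hle : u.2 ≤ v.2) :
    (par u).2 ≤ (par v).2 := by
  obtain ⟨h1, h2⟩ := off_bounds hu
  obtain ⟨h3, h4⟩ := off_bounds (v := v) (by omega)
  have e1 := snd_eq u
  have e2 := snd_eq v
  simp only [par]
  rcases lt_trichotomy (ax u) (ax v) with hc | hc | hc
  · rw [← h] at e2 h3 h4
    have : (u.1 - 1) * (ax v - ax u) ≥ u.1 - 1 := by nlinarith
    rw [e1, e2]
    nlinarith
  · omega
  · rw [← h] at e2 h3 h4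
    nlinarith

/-- Parallels to an axis are barriers: a site on the counterclockwise side of the line at offset `d`
from the axis `c` keeps its parent on that side. `par_le` is the clockwise version. -/
theorem le_par {v : ℤ × ℤ} {c d : ℤ} (hv : 1 ≤ v.1) (h : v.1 * c + d ≤ v.2) (hd : 2 * d ≤ v.1) :
    (v.1 - 1) * c + d ≤ (par v).2 := by
  obtain ⟨h3, h4⟩ := off_bounds hv
  have e := snd_eq v
  simp only [par]
  rcases le_or_gt (ax v) c with hc | hc
  · nlinarith
  · have : (v.1 - 1) * (ax v - c) ≥ v.1 - 1 := by nlinarith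
    have : v.2 - ax v - ((v.1 - 1) * c + d) = (v.1 - 1) * (ax v - c) + off v - d := by
      rw [e]; ring
    omega

theorem par_le {v : ℤ × ℤ} {c d : ℤ} (hv : 1 ≤ v.1) (h : v.2 ≤ v.1 * c + d) (hd : -v.1 < 2 * d) :
    (par v).2 ≤ (v.1 - 1) * c + d := by
  obtain ⟨h3, h4⟩ := off_bounds hv
  have e := snd_eq v
  simp only [par]
  rcases le_or_gt c (ax v) with hc | hc
  · nlinarith
  · have : (v.1 - 1) * (c - ax v) ≥ v.1 - 1 := by nlinarith
    have : ((v.1 - 1) * c + d) - (v.2 - ax v) = (v.1 - 1) * (c - ax v) + d - off v := by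
      rw [e]; ring
    omega

/-- The sites along the half-line between the axes `c` and `c + 1` are preserved by `par`. -/
theorem par_diag {k c : ℤ} (hk : 1 ≤ k) :
    (par (k, k * c + (k + 1) / 2)).2 = (k - 1) * c + k / 2 := by
  rcases Int.even_or_odd' k with ⟨t, rfl | rfl⟩
  · have e1 : (2 * t + 1) / 2 = t := by omega
    have e2 : 2 * t / 2 = t := by omega
    have : ax (2 * t, 2 * t * c + t) = c := by
      refine ax_eq hk ?_ ?_ <;> simp only <;> ring_nf <;> omega
    simp only [par, e1, e2, this]
    ring
  · have e1 : (2 * t + 1 + 1) / 2 = t + 1 := by omega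
    have e2 : (2 * t + 1) / 2 = t := by omega
    have : ax (2 * t + 1, (2 * t + 1) * c + (t + 1)) = c + 1 := by
      refine ax_eq hk ?_ ?_ <;> simp only <;> ring_nf <;> omega
    simp only [par, e1, e2, this]
    ring

/-- The lexicographic order on the nearest axis and the position with respect to it. -/
def KeyLe (u v : ℤ × ℤ) : Prop := ax u < ax v ∨ (ax u = ax v ∧ off u ≤ off v)

def KeyLt (u v : ℤ × ℤ) : Prop := ax u < ax v ∨ (ax u = ax v ∧ off u < off v)

theorem ax_le_of_angle {u v : ℤ × ℤ} (hu : 1 ≤ u.1) (hv : 1 ≤ v.1)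
    (h : u.2 * v.1 ≤ v.2 * u.1) : ax u ≤ ax v := by
  by_contra! hc
  obtain ⟨h1, h2⟩ := off_bounds hu
  obtain ⟨h3, h4⟩ := off_bounds hv
  rw [snd_eq u, snd_eq v] at h
  have h5 : u.1 * v.1 * 1 ≤ u.1 * v.1 * (ax u - ax v) := by
    apply mul_le_mul_of_nonneg_left <;> [omega; positivity]
  nlinarith

/-- A first site outside the ball of squared radius `A`. -/
def InnerBd (A : ℤ) (s : ℤ × ℤ) : Prop := 2 ≤ s.1 ∧ A < nsq s ∧ nsq (par s) ≤ A

/-- A last site inside the ball of squared radius `B`. -/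
def OuterBd (B : ℤ) (e : ℤ × ℤ) : Prop := 1 ≤ e.1 ∧ nsq e ≤ B ∧ B < nsq (child e)

/-- In the coordinates `x = k - |d|`, `y = |d|` the squared distance is `x² + xy + y²`, and passing
to the child adds one to `x`. It remains to use monotonicity in `x` and `y`. -/
theorem nsq_child_le {u v : ℤ × ℤ} (hu : 1 ≤ u.1) (h1 : v.1 - |off v| ≥ u.1 - |off u| + 1)
    (h2 : |off u| ≤ |off v|) : nsq (child u) ≤ nsq v := by
  rw [nsq_child hu]
  unfold nsq
  obtain ⟨h3, h4⟩ := off_bounds hu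
  have h5 : |off u| ≤ u.1 := by rw [abs_le]; omega
  have := form_mono (x' := u.1 + 1 - |off u|) (y' := |off u|) (x := v.1 - |off v|) (y := |off v|)
    (by omega) (abs_nonneg _) (by omega) h2
  rw [← sq_abs (off u), ← sq_abs (off v)]
  nlinarith

theorem nsq_le_par {u v : ℤ × ℤ} (hu : 2 ≤ u.1) (hv : 1 ≤ v.1)
    (h1 : v.1 - |off v| + 1 ≤ u.1 - |off u|)
    (h2 : |off v| ≤ |off u|) : nsq v ≤ nsq (par u) := by
  rw [nsq_par hu]
  unfold nsq
  obtain ⟨h3, h4⟩ := off_bounds hv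
  have h5 : |off v| ≤ v.1 := by rw [abs_le]; omega
  have := form_mono (x' := v.1 - |off v|) (y' := |off v|) (x := u.1 - 1 - |off u|) (y := |off u|)
    (by omega) (abs_nonneg _) (by omega) h2
  rw [← sq_abs (off u), ← sq_abs (off v)]
  nlinarith

/-- On an axis, a site which is further from the axis but at a smaller angle is dominated. -/
theorem dominated {u v : ℤ × ℤ} (hu : 1 ≤ u.1) (hv : 1 ≤ v.1)
    (h : u.2 * v.1 ≤ v.2 * u.1) (hax : ax u = ax v) (hoff : off v < off u) :
    (v.1 - |off v| + 1 ≤ u.1 - |off u| ∧ |off v| ≤ |off u|) ∨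
    (u.1 - |off u| + 1 ≤ v.1 - |off v| ∧ |off u| ≤ |off v|) := by
  obtain ⟨h1, h2⟩ := off_bounds hu
  obtain ⟨h3, h4⟩ := off_bounds hv
  rw [snd_eq u, snd_eq v, hax] at h
  have h : off u * v.1 ≤ off v * u.1 := by nlinarith
  rcases le_or_gt 0 (off v) with h0 | h0
  · left
    rw [abs_of_nonneg h0, abs_of_nonneg (by omega)]
    refine ⟨?_, hoff.le⟩
    by_contra! hc
    nlinarith
  · right
    have : off u < 0 := by
      by_contra! hc
      nlinarith
    rw [abs_of_neg h0, abs_of_neg this]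
    refine ⟨?_, by omega⟩
    by_contra! hc
    nlinarith

/-- Otherwise both sites have the same nearest axis and, by `dominated`, one of them lies so far
beyond the other that its parent is at least as far as the other site. That parent would be outside
the ball, contrary to the definition of a first site outside. -/
theorem InnerBd.keyLe {A : ℤ} {s s' : ℤ × ℤ} (hs : InnerBd A s) (hs' : InnerBd A s')
    (h : s.2 * s'.1 ≤ s'.2 * s.1) : KeyLe s s' := by
  obtain ⟨h1, h2, h3⟩ := hs
  obtain ⟨h1', h2', h3'⟩ := hs'
  have h4 := ax_le_of_angle (by omega) (by omega) h
  by_contra hc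
  have hc : ax s = ax s' ∧ off s' < off s := by unfold KeyLe at hc; omega
  rcases dominated (by omega) (by omega) h hc.1 hc.2 with ⟨h5, h6⟩ | ⟨h5, h6⟩
  · have := nsq_le_par h1 (by omega) h5 h6
    omega
  · have := nsq_le_par h1' (by omega) h5 h6
    omega

theorem InnerBd.eq_of_angle {A : ℤ} {s s' : ℤ × ℤ} (hs : InnerBd A s) (hs' : InnerBd A s')
    (h : s.2 * s'.1 = s'.2 * s.1) : s = s' := by
  have k1 := hs.keyLe hs' h.le
  have k2 := hs'.keyLe hs h.ge
  have hax : ax s = ax s' := by unfold KeyLe at *; omega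
  have hoff : off s = off s' := by unfold KeyLe at *; omega
  have e1 := snd_eq s
  have e2 := snd_eq s'
  rw [hax, hoff] at e1
  obtain ⟨h1, h2, h3⟩ := hs
  obtain ⟨h1', h2', h3'⟩ := hs'
  rcases lt_trichotomy s.1 s'.1 with hk | hk | hk
  · have := nsq_le_par (u := s') (v := s) h1' (by omega) (by rw [hoff]; omega) (by rw [hoff])
    omega
  · exact Prod.ext hk (by rw [e1, e2, hk])
  · have := nsq_le_par (u := s) (v := s') h1 (by omega) (by rw [hoff]; omega) (by rw [hoff])
    omega

theorem OuterBd.keyLe {B : ℤ} {s s' : ℤ × ℤ} (hs : OuterBd B s) (hs' : OuterBd B s')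
    (h : s.2 * s'.1 ≤ s'.2 * s.1) : KeyLe s s' := by
  obtain ⟨h1, h2, h3⟩ := hs
  obtain ⟨h1', h2', h3'⟩ := hs'
  have h4 := ax_le_of_angle (by omega) (by omega) h
  by_contra hc
  have hc : ax s = ax s' ∧ off s' < off s := by unfold KeyLe at hc; omega
  rcases dominated (by omega) (by omega) h hc.1 hc.2 with ⟨h5, h6⟩ | ⟨h5, h6⟩
  · have := nsq_child_le h1' (by omega) h6
    omega
  · have := nsq_child_le h1 (by omega) h6
    omega

theorem OuterBd.eq_of_key {B : ℤ} {s s' : ℤ × ℤ} (hs : OuterBd B s) (hs' : OuterBd B s')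
    (hax : ax s = ax s') (hoff : off s = off s') : s = s' := by
  have e1 := snd_eq s
  have e2 := snd_eq s'
  rw [hax, hoff] at e1
  obtain ⟨h1, h2, h3⟩ := hs
  obtain ⟨h1', h2', h3'⟩ := hs'
  rcases lt_trichotomy s.1 s'.1 with hk | hk | hk
  · have := nsq_child_le (u := s) (v := s') h1 (by rw [hoff]; omega) (by rw [hoff])
    omega
  · exact Prod.ext hk (by rw [e1, e2, hk])
  · have := nsq_child_le (u := s') (v := s) h1' (by rw [hoff]; omega) (by rw [hoff])
    omega

theorem OuterBd.eq_of_angle {B : ℤ} {s s' : ℤ × ℤ} (hs : OuterBd B s) (hs' : OuterBd B s')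
    (h : s.2 * s'.1 = s'.2 * s.1) : s = s' := by
  have k1 := hs.keyLe hs' h.le
  have k2 := hs'.keyLe hs h.ge
  refine hs.eq_of_key hs' ?_ ?_ <;> unfold KeyLe at * <;> omega

/-- Ancestors are in the same order as the sites. -/
theorem ancestors_le {p p' : ℕ → ℤ × ℤ} {a a' : ℕ} (hp : ∀ i < a, p i = par (p (i + 1)))
    (hp' : ∀ i < a', p' i = par (p' (i + 1))) (hr : ∀ i ≤ a, (p i).1 = i)
    (hr' : ∀ i ≤ a', (p' i).1 = i) (ha : 1 ≤ a) (ha' : 1 ≤ a') (hkey : KeyLe (p a) (p' a')) :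
    ∀ r, r ≤ a → r ≤ a' → (p r).2 ≤ (p' r).2 := by
  have h1 := off_bounds (v := p a) (by rw [hr a le_rfl]; omega)
  have h2 := off_bounds (v := p' a') (by rw [hr' a' le_rfl]; omega)
  have e1 := snd_eq (p a)
  have e2 := snd_eq (p' a')
  rw [hr a le_rfl] at h1 e1
  rw [hr' a' le_rfl] at h2 e2
  rcases hkey with hlt | ⟨heq, hle⟩
  -- Distinct nearest axes: the half-line midway between the axes `c` and `c + 1` is stable under
  -- `par` and separates the two ancestor lines.
  · set c := ax (p a)
    have k1 : ∀ r, r ≤ a → (p r).2 ≤ r * c + (r + 1) / 2 := by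
      intro r hra
      induction hra using Nat.decreasingInduction with
      | self => omega
      | of_succ r hra ih =>
        have := par_mono (u := p (r + 1))
          (v := (((r + 1 : ℕ) : ℤ), ((r + 1 : ℕ) : ℤ) * c + (((r + 1 : ℕ) : ℤ) + 1) / 2))
          (by rw [hr _ hra]; omega) (by rw [hr _ hra]) ih
        rw [← hp r hra, par_diag (by omega)] at this
        push_cast at this
        rw [add_sub_cancel_right] at this
        exact this
    have k2 : ∀ r, r ≤ a' → r * c + (r + 1) / 2 ≤ (p' r).2 := by
      intro r hra
      induction hra using Nat.decreasingInduction with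
      | self =>
        have : (a' : ℤ) * c + a' ≤ a' * ax (p' a') := by nlinarith
        omega
      | of_succ r hra ih =>
        have := par_mono (v := p' (r + 1))
          (u := (((r + 1 : ℕ) : ℤ), ((r + 1 : ℕ) : ℤ) * c + (((r + 1 : ℕ) : ℤ) + 1) / 2))
          (by simp only; omega) (by rw [hr' _ hra]) ih
        rw [← hp' r hra, par_diag (by omega)] at this
        push_cast at this
        rw [add_sub_cancel_right] at this
        exact this
    intro r h h'
    exact (k1 r h).trans (k2 r h')
  -- Same nearest axis: it suffices to compare in the lower of the two starting rings, because `par`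
  -- is monotone. There the longer ancestor line is controlled by its barrier parallel to the axis.
  · suffices hmin : (p (min a a')).2 ≤ (p' (min a a')).2 by
      intro r h h'
      have hm : r ≤ min a a' := le_min h h'
      induction hm using Nat.decreasingInduction with
      | self => exact hmin
      | of_succ r hm ih =>
        have hm := lt_min_iff.1 hm
        rw [hp r hm.1, hp' r hm.2]
        exact par_mono (by rw [hr _ hm.1]; omega) (by rw [hr _ hm.1, hr' _ hm.2])
          (ih (by omega) (by omega))
    set c := ax (p a)
    rcases le_total a a' with h | h
    · rw [min_eq_left h]
      have k2 : ∀ r, r ≤ a' → a ≤ r → r * c + off (p a) ≤ (p' r).2 := by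
        intro r hra
        induction hra using Nat.decreasingInduction with
        | self => intro _; rw [heq]; omega
        | of_succ r hra ih =>
          intro har
          have := le_par (v := p' (r + 1)) (c := c) (d := off (p a))
            (by rw [hr' _ hra]; omega) (by rw [hr' _ hra]; exact ih (by omega))
            (by rw [hr' _ hra]; omega)
          rw [hr' _ hra, ← hp' r hra] at this
          push_cast at this
          rw [add_sub_cancel_right] at this
          exact this
      have := k2 a h le_rfl
      omega
    · rw [min_eq_right h]
      have k2 : ∀ r, r ≤ a → a' ≤ r → (p r).2 ≤ r * c + off (p' a') := by
        intro r hra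
        induction hra using Nat.decreasingInduction with
        | self => intro _; omega
        | of_succ r hra ih =>
          intro har
          have := par_le (v := p (r + 1)) (c := c) (d := off (p' a'))
            (by rw [hr _ hra]; omega) (by rw [hr _ hra]; exact ih (by omega))
            (by rw [hr _ hra]; omega)
          rw [hr _ hra, ← hp r hra] at this
          push_cast at this
          rw [add_sub_cancel_right] at this
          exact this
      have := k2 a' h le_rfl
      rw [e2, ← heq]
      exact this

/-! ### Crossings of the annulus and the nesting of disjoint ones. -/

/-- The angle of `u` is less than that of `v`. -/
def AngleLt (u v : ℤ × ℤ) : Prop := u.2 * v.1 < v.2 * u.1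

/-- A crossing of the annulus of squared radii `A` and `B` in the cover, extended to a path from
the apex to ring `K`. -/
structure Crossing (A B K : ℤ) extends RingPath K where
  a : ℕ
  b : ℕ
  a_pos : 2 ≤ a
  hab : a ≤ b
  hbL : b < L
  low : ∀ i < a, p i = par (p (i + 1))
  high : ∀ i, b ≤ i → i < L → p (i + 1) = child (p i)
  inside : ∀ i < a, nsq (p i) ≤ A
  annular : ∀ i, a ≤ i → i ≤ b → A < nsq (p i) ∧ nsq (p i) ≤ B
  outside : ∀ i, b < i → i ≤ L → B < nsq (p i)

namespace Crossing

variable {A B K : ℤ} (C : Crossing A B K)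

theorem A_lt_B (C : Crossing A B K) : A < B := by
  have := C.annular C.a le_rfl C.hab
  omega

theorem K_pos (C : Crossing A B K) : 0 < K := by
  have := C.top
  have := C.pos C.L (by have := C.hbL; omega) le_rfl
  omega

theorem row_low : ∀ i ≤ C.a, (C.p i).1 = i := by
  intro i
  induction i with
  | zero => intro _; rw [C.zero]; rfl
  | succ i ih =>
    intro hi
    have h1 := ih (by omega)
    have h2 := congrArg Prod.fst (C.low i (by omega))
    simp only [par] at h2
    push_cast
    omega

theorem innerBd : InnerBd A (C.p C.a) := by
  have h := C.a_pos
  refine ⟨by rw [C.row_low _ le_rfl]; omega, (C.annular _ le_rfl C.hab).1, ?_⟩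
  have h1 := C.low (C.a - 1) (by omega)
  have h2 := C.inside (C.a - 1) (by omega)
  rw [Nat.sub_add_cancel (by omega)] at h1
  rwa [← h1]

theorem pos_of_ge {i : ℕ} (h : C.a ≤ i) (hi : i ≤ C.L) : 1 ≤ (C.p i).1 :=
  C.pos i (by have := C.a_pos; omega) hi

theorem outerBd : OuterBd B (C.p C.b) := by
  refine ⟨C.pos_of_ge C.hab C.hbL.le, (C.annular _ C.hab le_rfl).2, ?_⟩
  rw [← C.high _ le_rfl C.hbL]
  exact C.outside _ (by omega) C.hbL

theorem lt_a_of_nsq {i : ℕ} (hi : i ≤ C.L) (h : nsq (C.p i) ≤ A) : i < C.a := by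
  by_contra! hc
  rcases le_or_gt i C.b with h1 | h1
  · have := C.annular i hc h1; omega
  · have := C.outside i h1 hi
    have := C.A_lt_B
    omega

theorem b_lt_of_nsq {i : ℕ} (h : B < nsq (C.p i)) : C.b < i := by
  by_contra! hc
  rcases lt_or_ge i C.a with h1 | h1
  · have := C.inside i h1
    have := C.A_lt_B
    omega
  · have := C.annular i h1 hc; omega

theorem annular_index {i : ℕ} (hi : i ≤ C.L) (h : A < nsq (C.p i)) (h' : nsq (C.p i) ≤ B) :
    C.a ≤ i ∧ i ≤ C.b := by
  constructor
  · by_contra! hc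
    have := C.inside i hc; omega
  · by_contra! hc
    have := C.outside i hc hi; omega

theorem key_high : ∀ i, C.b ≤ i → i ≤ C.L →
    ax (C.p i) = ax (C.p C.b) ∧ off (C.p i) = off (C.p C.b) := by
  intro i hi
  induction i, hi using Nat.le_induction with
  | base => intro _; exact ⟨rfl, rfl⟩
  | succ i hi ih =>
    intro hL
    rw [C.high i hi hL, ax_child (C.pos_of_ge (C.hab.trans hi) (by omega)),
      off_child (C.pos_of_ge (C.hab.trans hi) (by omega))]
    exact ih (by omega)

theorem high_eq {i : ℕ} (hi : C.b ≤ i) (hL : i ≤ C.L) :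
    (C.p i).2 = (C.p i).1 * ax (C.p C.b) + off (C.p C.b) := by
  rw [← (C.key_high i hi hL).1, ← (C.key_high i hi hL).2]
  exact snd_eq _

theorem up_low {i : ℕ} (hi : i < C.a) : Up (C.p i) (C.p (i + 1)) := by
  rw [C.low i hi]
  exact up_par (by rw [C.row_low _ hi]; omega)

theorem up_high {i : ℕ} (hi : C.b ≤ i) (hL : i < C.L) : Up (C.p i) (C.p (i + 1)) := by
  rw [C.high i hi hL]
  exact up_child (C.pos_of_ge (C.hab.trans hi) hL.le)

theorem last_eq : (C.p (C.L - 1)).2 + (C.p C.L).2 =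
    (2 * K - 1) * ax (C.p C.b) + 2 * off (C.p C.b) := by
  have h := C.hbL
  have h1 := C.high_eq (i := C.L - 1) (by omega) (by omega)
  have h2 := C.high_eq (i := C.L) (by omega) (by omega)
  have h3 := (C.up_high (i := C.L - 1) (by omega) (by omega)).2.1
  rw [Nat.sub_add_cancel (by omega)] at h3
  have h4 := C.top
  rw [h1, h2, show (C.p (C.L - 1)).1 = K - 1 by omega, h4]
  ring

theorem last_lt {C C₂ : Crossing A B K} (h : KeyLt (C.p C.b) (C₂.p C₂.b)) :
    (C.p (C.L - 1)).2 + (C.p C.L).2 < (C₂.p (C₂.L - 1)).2 + (C₂.p C₂.L).2 := by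
  rw [C.last_eq, C₂.last_eq]
  have h1 := off_bounds (C.pos_of_ge C.hab C.hbL.le)
  have h2 := off_bounds (C₂.pos_of_ge C₂.hab C₂.hbL.le)
  have h3 := C.lt_top _ C.hbL
  have h4 := C₂.lt_top _ C₂.hbL
  rcases h with h | ⟨h, h'⟩
  · have : (2 * K - 1) * 1 ≤ (2 * K - 1) * (ax (C₂.p C₂.b) - ax (C.p C.b)) := by
      apply mul_le_mul_of_nonneg_left <;> omega
    nlinarith
  · rw [h]; omega

/-- The height just right of an edge of a crossing leaving upwards is one, as long as one stays
around its lower endpoint. -/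
theorem ht_right {i : ℕ} (hi : i < C.a) {w : ℤ × ℤ} (hw : Up (C.p i) w)
    (hlt : (C.p (i + 1)).2 < w.2) :
    ∀ q, (C.p i).2 + (C.p (i + 1)).2 ≤ q → q ≤ (C.p i).2 + w.2 → C.ht i q = 1 := by
  have hiL : i < C.L := by have := C.hab; have := C.hbL; omega
  have hrow := C.row_low i hi.le
  have hU := C.up_low hi
  have hiK := C.lt_top i hiL
  intro q hq
  induction q, hq using Int.leInduction with
  | base =>
    intro _
    have h1 := C.bd_ht_up hU
    rw [bd_up _ hU, C.flow_edge hiL, hrow] at h1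
    have h2 := C.ht_mem C.K_pos (k := i) (q := (C.p i).2 + (C.p (i + 1)).2) (by omega) (by omega)
    have h3 := C.ht_mem C.K_pos (k := i) (q := (C.p i).2 + (C.p (i + 1)).2 - 1)
      (by omega) (by omega)
    omega
  | succ q hq ih =>
    intro hle
    have hX : Up (C.p i) ((i : ℤ) + 1, q + 1 - (C.p i).2) := by
      obtain ⟨a1, a2, a3, a4⟩ := hU
      obtain ⟨b1, b2, b3, b4⟩ := hw
      refine ⟨by omega, by rw [hrow], ?_, ?_⟩ <;> simp only <;> nlinarith
    have h0 : C.flow (C.p i) ((i : ℤ) + 1, q + 1 - (C.p i).2) = 0 := by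
      by_contra hc
      obtain ⟨l, hl, ⟨h1, h2⟩ | ⟨h1, h2⟩⟩ := C.flow_ne_zero hc
      · obtain rfl := C.inj _ (by omega) _ (by omega) h1
        have := congrArg Prod.snd h2
        simp only at this
        omega
      · obtain rfl := C.inj _ (by omega) _ (by omega) h1
        have := congrArg Prod.fst h2
        rw [C.row_low l (by omega)] at this
        push_cast at this
        omega
    have h1 := C.bd_ht_up hX
    rw [bd_up _ hX, h0, hrow] at h1
    simp only at h1
    rw [show (C.p i).2 + (q + 1 - (C.p i).2) = q + 1 by ring, add_sub_cancel_right,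
      ih (by omega)] at h1
    omega

theorem ht_left {i : ℕ} (hi : i < C.a) {w : ℤ × ℤ} (hw : Up (C.p i) w)
    (hlt : w.2 < (C.p (i + 1)).2) :
    ∀ q, q ≤ (C.p i).2 + (C.p (i + 1)).2 - 1 → (C.p i).2 + w.2 - 1 ≤ q → C.ht i q = 0 := by
  have hiL : i < C.L := by have := C.hab; have := C.hbL; omega
  have hrow := C.row_low i hi.le
  have hU := C.up_low hi
  have hiK := C.lt_top i hiL
  intro q hq
  induction q, hq using Int.leInductionDown with
  | base =>
    intro _
    have h1 := C.bd_ht_up hU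
    rw [bd_up _ hU, C.flow_edge hiL, hrow] at h1
    have h2 := C.ht_mem C.K_pos (k := i) (q := (C.p i).2 + (C.p (i + 1)).2) (by omega) (by omega)
    have h3 := C.ht_mem C.K_pos (k := i) (q := (C.p i).2 + (C.p (i + 1)).2 - 1)
      (by omega) (by omega)
    omega
  | pred q hq ih =>
    intro hle
    have hX : Up (C.p i) ((i : ℤ) + 1, q - (C.p i).2) := by
      obtain ⟨a1, a2, a3, a4⟩ := hU
      obtain ⟨b1, b2, b3, b4⟩ := hw
      refine ⟨by omega, by rw [hrow], ?_, ?_⟩ <;> simp only <;> nlinarith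
    have h0 : C.flow (C.p i) ((i : ℤ) + 1, q - (C.p i).2) = 0 := by
      by_contra hc
      obtain ⟨l, hl, ⟨h1, h2⟩ | ⟨h1, h2⟩⟩ := C.flow_ne_zero hc
      · obtain rfl := C.inj _ (by omega) _ (by omega) h1
        have := congrArg Prod.snd h2
        simp only at this
        omega
      · obtain rfl := C.inj _ (by omega) _ (by omega) h1
        have := congrArg Prod.fst h2
        rw [C.row_low l (by omega)] at this
        push_cast at this
        omega
    have h1 := C.bd_ht_up hX
    rw [bd_up _ hX, h0, hrow] at h1
    simp only at h1
    rw [show (C.p i).2 + (q - (C.p i).2) = q by ring, ih (by omega)] at h1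
    omega

theorem onEdge_up {u v f : ℤ × ℤ} (h : Up u v) (hf : OnEdge u v f) :
    f.1 = u.1 ∧ (f.2 = u.2 + v.2 ∨ f.2 = u.2 + v.2 - 1) := by
  have h' := h.2.1
  rcases hf with ⟨_, h2⟩ | ⟨h1, _⟩ | ⟨h1, _⟩ | ⟨h1, _⟩
  · exact h2
  · have := h1.2.1; omega
  · have := h1.2.1; omega
  · have := h1.2.1; omega

/-- A crossing visits the inner ball only along its ancestor line, which meets ring `i` at index `i`
alone; so a single site has to be compared. -/
theorem low_not_mem {C C₂ : Crossing A B K} {i : ℕ} (hi : i < C₂.a)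
    (hne : i ≤ C.a → C.p i ≠ C₂.p i) : ∀ l ≤ C.L, C.p l ≠ C₂.p i := by
  intro l hl h
  have h1 := C.lt_a_of_nsq hl (by rw [h]; exact C₂.inside i hi)
  have h2 := congrArg Prod.fst h
  rw [C.row_low l h1.le, C₂.row_low i hi.le] at h2
  obtain rfl : l = i := by omega
  exact hne h1.le h

/-- Right of the ancestors of the start of `C`, the height of `C` is one. -/
theorem ht_low_right {C C₂ : Crossing A B K}
    (h : ∀ r, r ≤ C.a → r ≤ C₂.a → (C.p r).2 ≤ (C₂.p r).2) :
    ∀ i < C₂.a, (i + 1 ≤ C.a → C.p (i + 1) ≠ C₂.p (i + 1)) →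
      ∀ f, OnEdge (C₂.p i) (C₂.p (i + 1)) f → C.ht f.1 f.2 = 1 := by
  intro i
  induction i with
  | zero =>
    intro hi hne f hf
    have ha := C.a_pos
    have h0 : C.p 0 = C₂.p 0 := by rw [C.zero, C₂.zero]
    have hU := C₂.up_low hi
    have hne' := hne (by omega)
    have hle := h 1 (by omega) (by omega)
    obtain ⟨h1, h2⟩ := onEdge_up hU hf
    rw [← h0] at hU h1 h2
    have hlt : (C.p (0 + 1)).2 < (C₂.p (0 + 1)).2 := by
      refine lt_of_le_of_ne hle fun h' => hne' (Prod.ext ?_ h')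
      rw [C.row_low _ (by omega), C₂.row_low _ hi]
    rw [h1, C.row_low 0 (by omega)]
    exact C.ht_right (by omega) hU hlt f.2 (by omega) (by omega)
  | succ i ih =>
    intro hi hne f hf
    have hbL := C₂.hbL
    have hab := C₂.hab
    -- Either `C₂` leaves `C` exactly at this vertex, and the height is read off around it, or the
    -- vertex is already off `C`, and the height is carried over from the previous edge.
    by_cases hs : i + 1 ≤ C.a ∧ C.p (i + 1) = C₂.p (i + 1)
    · obtain ⟨hia, h0⟩ := hs
      have hia : i + 1 < C.a := C.lt_a_of_nsq (by have := C.hbL; have := C.hab; omega)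
        (by rw [h0]; exact C₂.inside _ hi)
      have hU := C₂.up_low hi
      have hne' := hne (by omega)
      have hle := h (i + 1 + 1) (by omega) (by omega)
      obtain ⟨h1, h2⟩ := onEdge_up hU hf
      rw [← h0] at hU h1 h2
      have hlt : (C.p (i + 1 + 1)).2 < (C₂.p (i + 1 + 1)).2 := by
        refine lt_of_le_of_ne hle fun h' => hne' (Prod.ext ?_ h')
        rw [C.row_low _ (by omega), C₂.row_low _ hi]
      rw [h1, C.row_low _ (by omega)]
      exact C.ht_right hia hU hlt f.2 (by omega) (by omega)
    · have hs : i + 1 ≤ C.a → C.p (i + 1) ≠ C₂.p (i + 1) := fun h h' => hs ⟨h, h'⟩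
      obtain ⟨f₁, _, hf₁, _⟩ := bd_eq_of_covAdj (C₂.adj i (by omega))
      rw [← ih (by omega) hs f₁ hf₁]
      exact C.ht_around (C₂.pos _ (by omega) (by omega)) (C₂.lt_top _ (by omega))
        (low_not_mem hi hs) hf hf₁.symm

theorem ht_low_left {C C₂ : Crossing A B K}
    (h : ∀ r, r ≤ C₂.a → r ≤ C.a → (C₂.p r).2 ≤ (C.p r).2) :
    ∀ i < C₂.a, (i + 1 ≤ C.a → C.p (i + 1) ≠ C₂.p (i + 1)) →
      ∀ f, OnEdge (C₂.p i) (C₂.p (i + 1)) f → C.ht f.1 f.2 = 0 := by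
  intro i
  induction i with
  | zero =>
    intro hi hne f hf
    have ha := C.a_pos
    have h0 : C.p 0 = C₂.p 0 := by rw [C.zero, C₂.zero]
    have hU := C₂.up_low hi
    have hne' := hne (by omega)
    have hle := h 1 (by omega) (by omega)
    obtain ⟨h1, h2⟩ := onEdge_up hU hf
    rw [← h0] at hU h1 h2
    have hlt : (C₂.p (0 + 1)).2 < (C.p (0 + 1)).2 := by
      refine lt_of_le_of_ne hle fun h' => hne' (Prod.ext ?_ h'.symm)
      rw [C.row_low _ (by omega), C₂.row_low _ hi]
    rw [h1, C.row_low 0 (by omega)]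
    exact C.ht_left (by omega) hU hlt f.2 (by omega) (by omega)
  | succ i ih =>
    intro hi hne f hf
    have hbL := C₂.hbL
    have hab := C₂.hab
    by_cases hs : i + 1 ≤ C.a ∧ C.p (i + 1) = C₂.p (i + 1)
    · obtain ⟨hia, h0⟩ := hs
      have hia : i + 1 < C.a := C.lt_a_of_nsq (by have := C.hbL; have := C.hab; omega)
        (by rw [h0]; exact C₂.inside _ hi)
      have hU := C₂.up_low hi
      have hne' := hne (by omega)
      have hle := h (i + 1 + 1) (by omega) (by omega)
      obtain ⟨h1, h2⟩ := onEdge_up hU hf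
      rw [← h0] at hU h1 h2
      have hlt : (C₂.p (i + 1 + 1)).2 < (C.p (i + 1 + 1)).2 := by
        refine lt_of_le_of_ne hle fun h' => hne' (Prod.ext ?_ h'.symm)
        rw [C.row_low _ (by omega), C₂.row_low _ hi]
      rw [h1, C.row_low _ (by omega)]
      exact C.ht_left hia hU hlt f.2 (by omega) (by omega)
    · have hs : i + 1 ≤ C.a → C.p (i + 1) ≠ C₂.p (i + 1) := fun h h' => hs ⟨h, h'⟩
      obtain ⟨f₁, _, hf₁, _⟩ := bd_eq_of_covAdj (C₂.adj i (by omega))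
      rw [← ih (by omega) hs f₁ hf₁]
      exact C.ht_around (C₂.pos _ (by omega) (by omega)) (C₂.lt_top _ (by omega))
        (low_not_mem hi hs) hf hf₁.symm

/-- Outside the outer ball a crossing is a line of descendants, along which the axis and the offset
are fixed. Lines with different keys cannot meet. -/
theorem high_not_mem {C C₂ : Crossing A B K}
    (hne : ¬ (ax (C.p C.b) = ax (C₂.p C₂.b) ∧ off (C.p C.b) = off (C₂.p C₂.b)))
    {i : ℕ} (hi : C₂.b < i) (hiL : i ≤ C₂.L) : ∀ l ≤ C.L, C.p l ≠ C₂.p i := by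
  intro l hl h
  have h1 := C.b_lt_of_nsq (i := l) (by rw [h]; exact C₂.outside i hi hiL)
  have h2 := C.key_high l h1.le hl
  have h3 := C₂.key_high i hi.le hiL
  rw [h] at h2
  exact hne ⟨h2.1.symm.trans h3.1, h2.2.symm.trans h3.2⟩

/-- Along the descendants of the end of `C₂`, the height of a different crossing `C` is constant,
equal to its value in the last layer. -/
theorem ht_high {C C₂ : Crossing A B K}
    (hne : ¬ (ax (C.p C.b) = ax (C₂.p C₂.b) ∧ off (C.p C.b) = off (C₂.p C₂.b))) {c : ℤ}
    (htop : ∀ q, (C₂.p (C₂.L - 1)).2 + (C₂.p C₂.L).2 - 1 ≤ q →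
      q ≤ (C₂.p (C₂.L - 1)).2 + (C₂.p C₂.L).2 → C.ht (K - 1) q = c) :
    ∀ i, C₂.b ≤ i → i < C₂.L → ∀ f, OnEdge (C₂.p i) (C₂.p (i + 1)) f → C.ht f.1 f.2 = c := by
  have hbL := C₂.hbL
  suffices key : ∀ j, j ≤ C₂.L - 1 → C₂.b ≤ j → ∀ f, OnEdge (C₂.p j) (C₂.p (j + 1)) f →
      C.ht f.1 f.2 = c from fun i h1 h2 f hf => key i (by omega) h1 f hf
  intro j hj
  induction hj using Nat.decreasingInduction with
  | self =>
    intro hb f hf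
    have hU := C₂.up_high (i := C₂.L - 1) (by omega) (by omega)
    obtain ⟨h1, h2⟩ := onEdge_up hU hf
    have h3 := hU.2.1
    rw [Nat.sub_add_cancel (by omega)] at h2 h3
    rw [C₂.top] at h3
    rw [h1, show (C₂.p (C₂.L - 1)).1 = K - 1 by omega]
    exact htop _ (by omega) (by omega)
  | of_succ i hi ih =>
    intro hb f hf
    obtain ⟨f₁, _, hf₁, _⟩ := bd_eq_of_covAdj (C₂.adj (i + 1) (by omega))
    rw [← ih (by omega) f₁ hf₁]
    exact C.ht_around (C₂.pos _ (by omega) (by omega)) (C₂.lt_top _ (by omega))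
      (high_not_mem hne (by omega) (by omega)) hf.symm hf₁

theorem ht_high_right {C C₂ : Crossing A B K} (h : KeyLt (C.p C.b) (C₂.p C₂.b)) :
    ∀ i, C₂.b ≤ i → i < C₂.L → ∀ f, OnEdge (C₂.p i) (C₂.p (i + 1)) f → C.ht f.1 f.2 = 1 := by
  have := last_lt h
  refine ht_high (by unfold KeyLt at h; omega) fun q h1 _ => ?_
  rw [C.ht_top C.K_pos, if_pos (by omega)]

theorem ht_high_left {C C₂ : Crossing A B K} (h : KeyLt (C₂.p C₂.b) (C.p C.b)) :
    ∀ i, C₂.b ≤ i → i < C₂.L → ∀ f, OnEdge (C₂.p i) (C₂.p (i + 1)) f → C.ht f.1 f.2 = 0 := by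
  have := last_lt h
  refine ht_high (by unfold KeyLt at h; omega) fun q _ h1 => ?_
  rw [C.ht_top C.K_pos, if_neg (by omega)]

theorem order_low {C C₂ : Crossing A B K} (h : AngleLt (C.p C.a) (C₂.p C₂.a)) :
    ∀ r, r ≤ C.a → r ≤ C₂.a → (C.p r).2 ≤ (C₂.p r).2 :=
  ancestors_le C.low C₂.low C.row_low C₂.row_low (by have := C.a_pos; omega)
    (by have := C₂.a_pos; omega) (C.innerBd.keyLe C₂.innerBd h.le)

/-- Disjointness of two crossings in the annulus. -/
def Disj (C C₂ : Crossing A B K) : Prop :=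
  ∀ i, C.a ≤ i → i ≤ C.b → ∀ l, C₂.a ≤ l → l ≤ C₂.b → C.p i ≠ C₂.p l

theorem Disj.symm {C C₂ : Crossing A B K} (h : Disj C C₂) : Disj C₂ C :=
  fun i h1 h2 l h3 h4 he => h l h3 h4 i h1 h2 he.symm

theorem Disj.not_mem {C C₂ : Crossing A B K} (h : Disj C C₂) {i : ℕ} (hi : C₂.a ≤ i)
    (hi' : i ≤ C₂.b) : ∀ l ≤ C.L, C.p l ≠ C₂.p i := by
  intro l hl he
  obtain ⟨h1, h2⟩ := C₂.annular i hi hi'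
  rw [← he] at h1 h2
  obtain ⟨h3, h4⟩ := C.annular_index hl h1 h2
  exact h l h3 h4 i hi hi' he

theorem Disj.key_ne {C C₂ : Crossing A B K} (h : Disj C C₂) :
    ¬ (ax (C.p C.b) = ax (C₂.p C₂.b) ∧ off (C.p C.b) = off (C₂.p C₂.b)) :=
  fun h' => h _ C.hab le_rfl _ C₂.hab le_rfl (C.outerBd.eq_of_key C₂.outerBd h'.1 h'.2)

/-- The value found on the ancestor line of `C₂` propagates along the rest of `C₂`, which avoids
`C`: by disjointness in the annulus, by the distinct keys beyond it. The excluded edges are those of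
the trunk common to the two ancestor lines. -/
theorem Disj.ht_const {C C₂ : Crossing A B K} (h : Disj C C₂) {c : ℤ}
    (hc : ∀ i < C₂.a, (i + 1 ≤ C.a → C.p (i + 1) ≠ C₂.p (i + 1)) →
      ∀ f, OnEdge (C₂.p i) (C₂.p (i + 1)) f → C.ht f.1 f.2 = c) :
    ∀ i < C₂.L, ¬ (i < C.a ∧ i < C₂.a ∧ C.p i = C₂.p i ∧ C.p (i + 1) = C₂.p (i + 1)) →
      ∀ f, OnEdge (C₂.p i) (C₂.p (i + 1)) f → C.ht f.1 f.2 = c := by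
  have ha := C₂.a_pos
  have hab := C₂.hab
  have hbL := C₂.hbL
  have hlow : ∀ i < C₂.a, ¬ (i < C.a ∧ i < C₂.a ∧ C.p i = C₂.p i ∧ C.p (i + 1) = C₂.p (i + 1)) →
      ∀ f, OnEdge (C₂.p i) (C₂.p (i + 1)) f → C.ht f.1 f.2 = c := by
    intro i hi hs
    refine hc i hi fun h' he => hs ⟨h', hi, ?_, he⟩
    rw [C.low i (by omega), C₂.low i hi, he]
  have hhigh : ∀ i, C₂.a - 1 ≤ i → i < C₂.L →
      ∀ f, OnEdge (C₂.p i) (C₂.p (i + 1)) f → C.ht f.1 f.2 = c := by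
    intro i hi
    induction i, hi using Nat.le_induction with
    | base =>
      intro hL
      refine hlow _ (by omega) ?_
      rintro ⟨h1, _, _, h2⟩
      rw [Nat.sub_add_cancel (by omega)] at h2
      exact h.not_mem le_rfl hab _ (by have := C.hab; have := C.hbL; omega) h2
    | succ i hi ih =>
      intro hL f hf
      obtain ⟨f₁, _, hf₁, _⟩ := bd_eq_of_covAdj (C₂.adj i (by omega))
      rw [← ih (by omega) f₁ hf₁]
      refine C.ht_around (C₂.pos _ (by omega) (by omega)) (C₂.lt_top _ (by omega))
        ?_ hf hf₁.symm
      rcases le_or_gt (i + 1) C₂.b with h1 | h1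
      · exact h.not_mem (by omega) h1
      · exact high_not_mem h.key_ne h1 (by omega)
  intro i hi hs
  rcases lt_or_ge i C₂.a with h1 | h1
  · exact hlow i h1 hs
  · exact hhigh i (by omega) hi

/-- Disjoint crossings are nested. -/
theorem Disj.ht_le {C C₂ : Crossing A B K} (h : Disj C C₂) (hlt : AngleLt (C.p C.a) (C₂.p C₂.a)) :
    ∀ k q, 0 ≤ k → k < K → C₂.ht k q ≤ C.ht k q := by
  have hK := C.K_pos
  have hord := order_low hlt
  have h1 := h.ht_const (ht_low_right hord)
  have h2 := h.symm.ht_const (ht_low_left hord)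
  -- The indicator of the faces where the inequality fails; it is shown to jump across no edge.
  let g : ℤ → ℤ → ℤ := fun k q => if C₂.ht k q ≤ C.ht k q then 0 else 1
  suffices hg : ∀ k q, 0 ≤ k → k < K → g k q = 0 by
    intro k q h0 hk
    by_contra hc
    have := hg k q h0 hk
    simp [g, hc] at this
  have hbd : ∀ u v, CovAdj u v → u.1 < K ∨ v.1 < K → bd g u v = 0 := by
    intro u v huv hK'
    by_contra hc
    obtain ⟨f₁, f₂, hf₁, hf₂, he⟩ := bd_eq_of_covAdj huv
    rw [he] at hc
    have e1 := C.bd_ht huv hK'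
    have e2 := C₂.bd_ht huv hK'
    rw [he] at e1 e2
    have r1 := hf₁.row hK'
    have r2 := hf₂.row hK'
    have m1 := C.ht_mem hK (q := f₁.2) r1.1 r1.2
    have m2 := C.ht_mem hK (q := f₂.2) r2.1 r2.2
    have m3 := C₂.ht_mem hK (q := f₁.2) r1.1 r1.2
    have m4 := C₂.ht_mem hK (q := f₂.2) r2.1 r2.2
    by_cases z1 : C.flow u v = 0
    · by_cases z2 : C₂.flow u v = 0
      · apply hc
        rw [z1] at e1
        rw [z2] at e2
        have e3 : C.ht f₁.1 f₁.2 = C.ht f₂.1 f₂.2 := by omega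
        have e4 : C₂.ht f₁.1 f₁.2 = C₂.ht f₂.1 f₂.2 := by omega
        simp only [g, e3, e4, sub_self]
      · obtain ⟨l, hl, hl'⟩ := C₂.flow_ne_zero z2
        have hs : ¬ (l < C.a ∧ l < C₂.a ∧ C.p l = C₂.p l ∧ C.p (l + 1) = C₂.p (l + 1)) := by
          rintro ⟨h3, h4, h5, h6⟩
          have hfl := C.flow_edge (i := l) (by have := C.hab; have := C.hbL; omega)
          rw [h5, h6] at hfl
          rcases hl' with ⟨rfl, rfl⟩ | ⟨rfl, rfl⟩
          · omega
          · rw [C.flow_swap] at z1; omega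
        have h3 : ∀ f, OnEdge u v f → C.ht f.1 f.2 = 1 := by
          rcases hl' with ⟨rfl, rfl⟩ | ⟨rfl, rfl⟩
          · exact h1 l hl hs
          · exact fun f hf => h1 l hl hs f hf.symm
        apply hc
        have h4 := h3 _ hf₁
        have h5 := h3 _ hf₂
        simp only [g]
        rw [if_pos (by omega), if_pos (by omega), sub_self]
    · obtain ⟨l, hl, hl'⟩ := C.flow_ne_zero z1
      -- On a common edge both heights jump together between `0` and `1`, so they agree on each
      -- side. On an edge of `C` alone, `C₂` has height `0` on both sides.
      by_cases hs : l < C₂.a ∧ l < C.a ∧ C₂.p l = C.p l ∧ C₂.p (l + 1) = C.p (l + 1)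
      · obtain ⟨h3, h4, h5, h6⟩ := hs
        have i1 := C.flow_edge hl
        have i2 := C₂.flow_edge (i := l) (by have := C₂.hab; have := C₂.hbL; omega)
        rw [h5, h6] at i2
        have i3 : C.flow u v = C₂.flow u v ∧ (C.flow u v = 1 ∨ C.flow u v = -1) := by
          rcases hl' with ⟨rfl, rfl⟩ | ⟨rfl, rfl⟩
          · omega
          · rw [C.flow_swap, C₂.flow_swap]; omega
        apply hc
        simp only [g]
        rw [if_pos (by omega), if_pos (by omega), sub_self]
      · have h3 : ∀ f, OnEdge u v f → C₂.ht f.1 f.2 = 0 := by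
          rcases hl' with ⟨rfl, rfl⟩ | ⟨rfl, rfl⟩
          · exact h2 l hl hs
          · exact fun f hf => h2 l hl hs f hf.symm
        apply hc
        have h4 := h3 _ hf₁
        have h5 := h3 _ hf₂
        simp only [g]
        rw [if_pos (by omega), if_pos (by omega), sub_self]
  intro k q h0 hk
  -- The reference face is the one just before the first edge of `C₂`, where `C₂` has height `0`.
  rw [eq_of_bd_eq_zero hbd ((C₂.p 1).2 - 1) k q h0 hk]
  have e1 := C₂.ht_zero hK ((C₂.p 1).2 - 1)
  rw [if_neg (by omega)] at e1
  have m := C.ht_mem hK (k := 0) (q := (C₂.p 1).2 - 1) le_rfl hK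
  simp only [g]
  rw [if_pos (by omega)]

/-- Disjoint crossings end in the order in which they start. -/
theorem Disj.angleLt_end {C C₂ : Crossing A B K} (h : Disj C C₂)
    (hlt : AngleLt (C.p C.a) (C₂.p C₂.a)) : AngleLt (C.p C.b) (C₂.p C₂.b) := by
  have hK := C.K_pos
  have hle := h.ht_le hlt
  by_contra hc
  unfold AngleLt at hc
  rw [not_lt] at hc
  have h1 := C₂.outerBd.keyLe C.outerBd hc
  have h2 : KeyLt (C₂.p C₂.b) (C.p C.b) := by
    have := h.key_ne
    unfold KeyLe at h1; unfold KeyLt; omega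
  have h3 := last_lt h2
  -- Were the ends in the wrong order, then in the last layer, just after the last edge of `C₂`, the
  -- height of `C₂` would be `1` and that of `C` still `0`.
  have h4 := hle (K - 1) ((C₂.p (C₂.L - 1)).2 + (C₂.p C₂.L).2) (by omega) (by omega)
  rw [C₂.ht_top hK, C.ht_top hK, if_pos le_rfl, if_neg (by omega)] at h4
  omega

end Crossing
-- The envelope of two crossings, and disjointness of the envelopes of nested pairs.
namespace Crossing

variable {A B K : ℤ}

/-- The height function of the left envelope of two crossings. -/
def env (C D : Crossing A B K) (k q : ℤ) : ℤ := max (C.ht k q) (D.ht k q)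

theorem env_comm (C D : Crossing A B K) : env C D = env D C := by
  funext k q; exact max_comm _ _

/-- The vertices of the cover lying over the annulus. -/
def Annular (A B K : ℤ) (v : ℤ × ℤ) : Prop := 1 ≤ v.1 ∧ v.1 < K ∧ A < nsq v ∧ nsq v ≤ B

theorem flow_of_env {C D : Crossing A B K} {u v : ℤ × ℤ} (huK : u.1 < K)
    (h : bd (env C D) u v ≠ 0) : C.flow u v ≠ 0 ∨ D.flow u v ≠ 0 := by
  have huv := covAdj_of_bd_ne_zero h
  rw [← C.bd_ht huv (Or.inl huK), ← D.bd_ht huv (Or.inl huK)]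
  obtain ⟨f₁, f₂, _, _, he⟩ := bd_eq_of_covAdj huv
  rw [he] at h
  rw [he, he]
  by_contra! hc
  apply h
  simp only [env]
  rw [sub_eq_zero.1 hc.1, sub_eq_zero.1 hc.2, sub_self]

theorem flow_low (C : Crossing A B K) {v w : ℤ × ℤ} (hv : A < nsq v) (hw : nsq w ≤ A)
    (h : C.flow v w ≠ 0) : v = C.p C.a ∧ w = C.p (C.a - 1) := by
  obtain ⟨l, hl, ⟨rfl, rfl⟩ | ⟨rfl, rfl⟩⟩ := C.flow_ne_zero h
  · have h1 := C.lt_a_of_nsq hl hw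
    have := C.inside l (by omega)
    omega
  · have h1 := C.lt_a_of_nsq hl.le hw
    have h2 : ¬ l + 1 < C.a := fun h' => by have := C.inside _ h'; omega
    have : C.a = l + 1 := by omega
    rw [this]
    exact ⟨rfl, rfl⟩

theorem flow_high (C : Crossing A B K) {v w : ℤ × ℤ} (hv : nsq v ≤ B) (hw : B < nsq w)
    (h : C.flow v w ≠ 0) : v = C.p C.b ∧ w = C.p (C.b + 1) := by
  obtain ⟨l, hl, ⟨rfl, rfl⟩ | ⟨rfl, rfl⟩⟩ := C.flow_ne_zero h
  · have h1 := C.b_lt_of_nsq hw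
    have h2 : ¬ C.b < l := fun h' => by have := C.outside _ h' hl.le; omega
    have : C.b = l := by omega
    rw [this]
    exact ⟨rfl, rfl⟩
  · have h1 := C.b_lt_of_nsq hw
    have := C.outside (l + 1) (by omega) hl
    omega

theorem p_pred (C : Crossing A B K) : C.p (C.a - 1) = par (C.p C.a) := by
  have h := C.a_pos
  have h1 := C.low (C.a - 1) (by omega)
  rwa [Nat.sub_add_cancel (by omega)] at h1

theorem p_succ (C : Crossing A B K) : C.p (C.b + 1) = child (C.p C.b) := C.high _ le_rfl C.hbL

theorem a_lt_L (C : Crossing A B K) : C.a < C.L := C.hab.trans_lt C.hbL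

theorem angleLt_irrefl {u : ℤ × ℤ} : ¬ AngleLt u u := by simp [AngleLt]

theorem low_ne_of_angleLt {C D : Crossing A B K} (h : C.p C.a ≠ D.p D.a) :
    C.a ≤ D.a → D.p C.a ≠ C.p C.a := by
  intro hle he
  rcases hle.lt_or_eq with h' | h'
  · have h1 := D.inside _ h'
    have h2 := (C.annular _ le_rfl C.hab).1
    rw [he] at h1
    omega
  · rw [h'] at he h; exact h he.symm

/-- Where `D` has height `0` the maximum is the height of `C`; where it has height `1` the maximum
is `1` and does not jump. -/
theorem bd_env_of_eq {C D : Crossing A B K} {u v : ℤ × ℤ} {c : ℤ}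
    (h : ∀ f, OnEdge u v f → D.ht f.1 f.2 = c) (huK : u.1 < K ∨ v.1 < K) (huv : CovAdj u v) :
    (c = 0 → bd (env C D) u v = C.flow u v) ∧ (c = 1 → bd (env C D) u v = 0) := by
  rw [← C.bd_ht huv huK]
  obtain ⟨f₁, f₂, h1, h2, he⟩ := bd_eq_of_covAdj huv
  have r1 := h1.row huK
  have r2 := h2.row huK
  have m1 := C.ht_mem C.K_pos (q := f₁.2) r1.1 r1.2
  have m2 := C.ht_mem C.K_pos (q := f₂.2) r2.1 r2.2
  rw [he, he]
  simp only [env]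
  rw [h _ h1, h _ h2]
  omega

theorem bd_env_of_flow_eq {C D : Crossing A B K} {u v : ℤ × ℤ}
    (h : C.flow u v = D.flow u v) (h1 : C.flow u v = 1 ∨ C.flow u v = -1)
    (huK : u.1 < K ∨ v.1 < K) (huv : CovAdj u v) : bd (env C D) u v = C.flow u v := by
  rw [← C.bd_ht huv huK] at h h1 ⊢
  rw [← D.bd_ht huv huK] at h
  obtain ⟨f₁, f₂, h3, h4, he⟩ := bd_eq_of_covAdj huv
  have r1 := h3.row huK
  have r2 := h4.row huK
  have m1 := C.ht_mem C.K_pos (q := f₁.2) r1.1 r1.2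
  have m2 := C.ht_mem C.K_pos (q := f₂.2) r2.1 r2.2
  have m3 := D.ht_mem C.K_pos (q := f₁.2) r1.1 r1.2
  have m4 := D.ht_mem C.K_pos (q := f₂.2) r2.1 r2.2
  rw [he] at h1 ⊢
  rw [he, he] at h
  rw [he]
  simp only [env]
  omega

theorem flow_start (C : Crossing A B K) : C.flow (C.p C.a) (par (C.p C.a)) = -1 := by
  have h := C.a_pos
  have h1 := C.flow_edge (i := C.a - 1) (by have := C.a_lt_L; omega)
  rw [Nat.sub_add_cancel (by omega), C.p_pred] at h1
  rw [C.flow_swap, h1]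

theorem flow_end (C : Crossing A B K) : C.flow (C.p C.b) (child (C.p C.b)) = 1 := by
  rw [← C.p_succ]
  exact C.flow_edge C.hbL

/-- The flow of the envelope enters the annulus at the first of the two starts. -/
theorem bd_env_low {C D : Crossing A B K}
    (h : AngleLt (C.p C.a) (D.p D.a) ∨ C.p C.a = D.p D.a) {v w : ℤ × ℤ} (hv : Annular A B K v)
    (hw : nsq w ≤ A) :
    bd (env C D) v w = if v = C.p C.a ∧ w = par (C.p C.a) then -1 else 0 := by
  have haC := C.a_pos
  have haD := D.a_pos
  have hCL := C.a_lt_L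
  have hDL := D.a_lt_L
  have adjC : CovAdj (C.p C.a) (par (C.p C.a)) :=
    Or.inr (Or.inl (up_par (C.pos_of_ge le_rfl C.a_lt_L.le)))
  have adjD : CovAdj (D.p D.a) (par (D.p D.a)) :=
    Or.inr (Or.inl (up_par (D.pos_of_ge le_rfl D.a_lt_L.le)))
  have kC := C.lt_top _ C.a_lt_L
  have kD := D.lt_top _ D.a_lt_L
  have hCne : C.p C.a = D.p D.a ∨ ¬ C.p C.a = D.p D.a := em _
  split_ifs with hs
  · obtain ⟨rfl, rfl⟩ := hs
    rw [← C.flow_start]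
    rcases h with h | h
    · refine (bd_env_of_eq (C := C) (D := D) (c := 0) ?_ (Or.inl kC) adjC).1 rfl
      intro f hf
      have h3 := ht_low_left (C := D) (C₂ := C) (order_low h) (C.a - 1) (by omega)
      rw [Nat.sub_add_cancel (by omega), C.p_pred] at h3
      exact h3 (low_ne_of_angleLt fun h' => by rw [h'] at h; exact angleLt_irrefl h) f hf.symm
    · refine bd_env_of_flow_eq ?_ (Or.inr C.flow_start) (Or.inl kC) adjC
      rw [C.flow_start, h, D.flow_start]
  · by_contra hc
    rcases flow_of_env hv.2.1 hc with h1 | h1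
    · obtain ⟨rfl, rfl⟩ := C.flow_low hv.2.2.1 hw h1
      exact hs ⟨rfl, C.p_pred⟩
    · obtain ⟨rfl, rfl⟩ := D.flow_low hv.2.2.1 hw h1
      rcases h with h | h
      · apply hc
        rw [D.p_pred, env_comm]
        refine (bd_env_of_eq (C := D) (D := C) (c := 1) ?_ (Or.inl kD) adjD).2 rfl
        intro f hf
        have h3 := ht_low_right (C := C) (C₂ := D) (order_low h) (D.a - 1) (by omega)
        rw [Nat.sub_add_cancel (by omega), D.p_pred] at h3
        exact h3 (low_ne_of_angleLt fun h' => by rw [h'] at h; exact angleLt_irrefl h) f hf.symm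
      · rw [h, ← D.p_pred] at hs
        exact hs ⟨rfl, rfl⟩

theorem keyLt_of_angleLt {C D : Crossing A B K} (h : AngleLt (C.p C.b) (D.p D.b)) :
    KeyLt (C.p C.b) (D.p D.b) := by
  have h1 := C.outerBd.keyLe D.outerBd h.le
  have h2 : ¬ (ax (C.p C.b) = ax (D.p D.b) ∧ off (C.p C.b) = off (D.p D.b)) := fun h' => by
    have := C.outerBd.eq_of_key D.outerBd h'.1 h'.2
    rw [this] at h
    exact angleLt_irrefl h
  unfold KeyLe at h1; unfold KeyLt; omega

/-- The flow of the envelope leaves the annulus at the first of the two ends. -/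
theorem bd_env_high {C D : Crossing A B K}
    (h : AngleLt (C.p C.b) (D.p D.b) ∨ C.p C.b = D.p D.b) {v w : ℤ × ℤ} (hv : Annular A B K v)
    (hw : B < nsq w) :
    bd (env C D) v w = if v = C.p C.b ∧ w = child (C.p C.b) then 1 else 0 := by
  have hCL := C.hbL
  have hDL := D.hbL
  have adjC : CovAdj (C.p C.b) (child (C.p C.b)) := Or.inl (up_child (C.pos_of_ge C.hab hCL.le))
  have adjD : CovAdj (D.p D.b) (child (D.p D.b)) := Or.inl (up_child (D.pos_of_ge D.hab hDL.le))
  have kC := C.lt_top _ C.hbL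
  have kD := D.lt_top _ D.hbL
  split_ifs with hs
  · obtain ⟨rfl, rfl⟩ := hs
    rw [← C.flow_end]
    rcases h with h | h
    · refine (bd_env_of_eq (C := C) (D := D) (c := 0) ?_ (Or.inl kC) adjC).1 rfl
      rw [← C.p_succ]
      exact ht_high_left (C := D) (C₂ := C) (keyLt_of_angleLt h) C.b le_rfl hCL
    · refine bd_env_of_flow_eq ?_ (Or.inl C.flow_end) (Or.inl kC) adjC
      rw [C.flow_end, h, D.flow_end]
  · by_contra hc
    rcases flow_of_env hv.2.1 hc with h1 | h1
    · obtain ⟨rfl, rfl⟩ := C.flow_high hv.2.2.2 hw h1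
      exact hs ⟨rfl, C.p_succ⟩
    · obtain ⟨rfl, rfl⟩ := D.flow_high hv.2.2.2 hw h1
      rcases h with h | h
      · apply hc
        rw [D.p_succ, env_comm]
        refine (bd_env_of_eq (C := D) (D := C) (c := 1) ?_ (Or.inl kD) adjD).2 rfl
        rw [← D.p_succ]
        exact ht_high_right (C := C) (C₂ := D) (keyLt_of_angleLt h) D.b le_rfl hDL
      · rw [h, ← D.p_succ] at hs
        exact hs ⟨rfl, rfl⟩

/-- The first of two vertices. -/
noncomputable def firstOf (u v : ℤ × ℤ) : ℤ × ℤ :=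
  open Classical in if AngleLt v u then v else u

theorem start_cases (C D : Crossing A B K) :
    (firstOf (C.p C.a) (D.p D.a) = C.p C.a ∧
      (AngleLt (C.p C.a) (D.p D.a) ∨ C.p C.a = D.p D.a)) ∨
    (firstOf (C.p C.a) (D.p D.a) = D.p D.a ∧ AngleLt (D.p D.a) (C.p C.a)) := by
  unfold firstOf
  split_ifs with h
  · exact Or.inr ⟨rfl, h⟩
  · refine Or.inl ⟨rfl, ?_⟩
    unfold AngleLt at h ⊢
    rcases (not_lt.1 h).lt_or_eq with h | h
    · exact Or.inl h
    · exact Or.inr (C.innerBd.eq_of_angle D.innerBd h)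

theorem end_cases (C D : Crossing A B K) :
    (firstOf (C.p C.b) (D.p D.b) = C.p C.b ∧
      (AngleLt (C.p C.b) (D.p D.b) ∨ C.p C.b = D.p D.b)) ∨
    (firstOf (C.p C.b) (D.p D.b) = D.p D.b ∧ AngleLt (D.p D.b) (C.p C.b)) := by
  unfold firstOf
  split_ifs with h
  · exact Or.inr ⟨rfl, h⟩
  · refine Or.inl ⟨rfl, ?_⟩
    unfold AngleLt at h ⊢
    rcases (not_lt.1 h).lt_or_eq with h | h
    · exact Or.inl h
    · exact Or.inr (C.outerBd.eq_of_angle D.outerBd h)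

theorem bd_env_low' (C D : Crossing A B K) {v w : ℤ × ℤ} (hv : Annular A B K v)
    (hw : nsq w ≤ A) : bd (env C D) v w = if v = firstOf (C.p C.a) (D.p D.a) ∧
      w = par (firstOf (C.p C.a) (D.p D.a)) then -1 else 0 := by
  rcases start_cases C D with ⟨h1, h2⟩ | ⟨h1, h2⟩ <;> rw [h1]
  · exact bd_env_low h2 hv hw
  · rw [env_comm]; exact bd_env_low (Or.inl h2) hv hw

theorem bd_env_high' (C D : Crossing A B K) {v w : ℤ × ℤ} (hv : Annular A B K v)
    (hw : B < nsq w) : bd (env C D) v w = if v = firstOf (C.p C.b) (D.p D.b) ∧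
      w = child (firstOf (C.p C.b) (D.p D.b)) then 1 else 0 := by
  rcases end_cases C D with ⟨h1, h2⟩ | ⟨h1, h2⟩ <;> rw [h1]
  · exact bd_env_high h2 hv hw
  · rw [env_comm]; exact bd_env_high (Or.inl h2) hv hw

theorem annular_p (C : Crossing A B K) {i : ℕ} (h : C.a ≤ i) (h' : i ≤ C.b) :
    Annular A B K (C.p i) := by
  have := C.hbL
  exact ⟨C.pos_of_ge h (by omega), C.lt_top _ (by omega), C.annular i h h'⟩

/-- The support of the flow of the envelope in the annulus. -/
def envGraph (C D : Crossing A B K) : SimpleGraph (ℤ × ℤ) where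
  Adj u v := bd (env C D) u v ≠ 0 ∧ Annular A B K u ∧ Annular A B K v
  symm := ⟨fun u v h => ⟨by rw [bd_swap]; exact neg_ne_zero.2 h.1, h.2.2, h.2.1⟩⟩
  loopless := ⟨fun u h => h.1 (by simp [bd])⟩

theorem bd_start_ne_zero (C D : Crossing A B K) :
    bd (env C D) (firstOf (C.p C.a) (D.p D.a)) (par (firstOf (C.p C.a) (D.p D.a))) ≠ 0 := by
  have h1 : Annular A B K (firstOf (C.p C.a) (D.p D.a)) ∧
      nsq (par (firstOf (C.p C.a) (D.p D.a))) ≤ A := by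
    rcases start_cases C D with ⟨h1, h2⟩ | ⟨h1, h2⟩ <;> rw [h1]
    · exact ⟨C.annular_p le_rfl C.hab, C.innerBd.2.2⟩
    · exact ⟨D.annular_p le_rfl D.hab, D.innerBd.2.2⟩
  rw [bd_env_low' C D h1.1 h1.2, if_pos ⟨rfl, rfl⟩]
  simp

/-- Conservation of flow on the connected component of the start. The flow inside the component
cancels by antisymmetry, so the unit entering the annulus at the start has to leave it from the
component. The only exit is at the first of the two ends. -/
theorem reachable_env (C D : Crossing A B K) :
    (envGraph C D).Reachable (firstOf (C.p C.a) (D.p D.a)) (firstOf (C.p C.b) (D.p D.b)) := by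
  classical
  set s := firstOf (C.p C.a) (D.p D.a) with hs
  set e := firstOf (C.p C.b) (D.p D.b) with he
  -- A finite set containing every endpoint of an edge that carries flow out of the annulus sites
  -- considered, so that all sums are finite.
  let V : Finset (ℤ × ℤ) :=
    (Finset.range (C.L + 1)).image C.p ∪ (Finset.range (D.L + 1)).image D.p
  have hVC : ∀ i ≤ C.L, C.p i ∈ V := fun i hi =>
    Finset.mem_union_left _ (Finset.mem_image_of_mem _ (Finset.mem_range.2 (by omega)))
  have hVD : ∀ i ≤ D.L, D.p i ∈ V := fun i hi =>
    Finset.mem_union_right _ (Finset.mem_image_of_mem _ (Finset.mem_range.2 (by omega)))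
  have hVbd : ∀ v w, Annular A B K v → bd (env C D) v w ≠ 0 → w ∈ V := by
    intro v w hv h
    rcases flow_of_env hv.2.1 h with h | h
    · obtain ⟨l, hl, ⟨_, rfl⟩ | ⟨_, rfl⟩⟩ := C.flow_ne_zero h
      · exact hVC _ hl
      · exact hVC _ hl.le
    · obtain ⟨l, hl, ⟨_, rfl⟩ | ⟨_, rfl⟩⟩ := D.flow_ne_zero h
      · exact hVD _ hl
      · exact hVD _ hl.le
  have hsa : Annular A B K s ∧ s ∈ V ∧ par s ∈ V ∧ nsq (par s) ≤ A := by
    have := C.a_lt_L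
    have := D.a_lt_L
    rcases start_cases C D with ⟨h1, h2⟩ | ⟨h1, h2⟩ <;> rw [hs, h1]
    · exact ⟨C.annular_p le_rfl C.hab, hVC _ (by omega),
        by rw [← C.p_pred]; exact hVC _ (by omega), C.innerBd.2.2⟩
    · exact ⟨D.annular_p le_rfl D.hab, hVD _ (by omega),
        by rw [← D.p_pred]; exact hVD _ (by omega), D.innerBd.2.2⟩
  have hea : child e ∈ V ∧ B < nsq (child e) := by
    rcases end_cases C D with ⟨h1, h2⟩ | ⟨h1, h2⟩ <;> rw [he, h1]
    · exact ⟨by rw [← C.p_succ]; exact hVC _ C.hbL, C.outerBd.2.2⟩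
    · exact ⟨by rw [← D.p_succ]; exact hVD _ D.hbL, D.outerBd.2.2⟩
  have hreach : ∀ v, (envGraph C D).Reachable s v → Annular A B K v := by
    rintro v ⟨q⟩
    have key : ∀ {u v} (q : (envGraph C D).Walk u v), Annular A B K u → Annular A B K v := by
      intro u v q
      induction q with
      | nil => exact id
      | cons h q ih => exact fun _ => ih h.2.2
    exact key q hsa.1
  let S : Finset (ℤ × ℤ) := V.filter fun v => (envGraph C D).Reachable s v
  have hsS : s ∈ S := Finset.mem_filter.2 ⟨hsa.2.1, SimpleGraph.Reachable.refl _⟩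
  have hSann : ∀ v ∈ S, Annular A B K v := fun v hv => hreach v (Finset.mem_filter.1 hv).2
  have hsum : ∀ v ∈ S, ∑ w ∈ V, bd (env C D) v w = 0 := by
    intro v hv
    have hva := hSann v hv
    rw [← sum_nbrs_bd (env C D) hva.1]
    rw [← Finset.sum_subset (Finset.inter_subset_left : V ∩ nbrs v ⊆ V),
      ← Finset.sum_subset (Finset.inter_subset_right : V ∩ nbrs v ⊆ nbrs v)]
    · intro w hw hw'
      by_contra hc
      exact hw' (Finset.mem_inter.2 ⟨hVbd v w hva hc, hw⟩)
    · intro w hw hw'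
      by_contra hc
      exact hw' (Finset.mem_inter.2 ⟨hw, mem_nbrs hva.1 (covAdj_of_bd_ne_zero hc)⟩)
  have hAB := C.A_lt_B
  -- An edge with flow out of `S` either goes to an annular site, which is then in `S`, or leads
  -- into the inner ball from the start, or leaves the outer ball from the end.
  have hsplit : ∀ v ∈ S, ∀ w ∈ V, bd (env C D) v w = (if w ∈ S then bd (env C D) v w else 0) +
      (if v = s ∧ w = par s then -1 else 0) + (if v = e ∧ w = child e then 1 else 0) := by
    intro v hv w hw
    have hva := hSann v hv
    rcases le_or_gt (nsq w) A with h1 | h1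
    · have hwS : w ∉ S := fun h => by have := (hSann w h).2.2.1; omega
      have h2 : ¬ (v = e ∧ w = child e) := by
        rintro ⟨_, rfl⟩; omega
      rw [if_neg hwS, if_neg h2, bd_env_low' C D hva h1]
      ring
    · have h2 : ¬ (v = s ∧ w = par s) := by
        rintro ⟨_, rfl⟩; omega
      rcases le_or_gt (nsq w) B with h3 | h3
      · have h4 : ¬ (v = e ∧ w = child e) := by
          rintro ⟨_, rfl⟩; omega
        rw [if_neg h2, if_neg h4]
        split_ifs with h5
        · ring
        · by_contra hc
          rw [add_zero, add_zero] at hc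
          apply h5
          refine Finset.mem_filter.2 ⟨hw, (Finset.mem_filter.1 hv).2.trans
            (SimpleGraph.Adj.reachable (⟨hc, hva, ?_⟩ : (envGraph C D).Adj v w))⟩
          refine ⟨?_, ?_, h1, h3⟩
          · rcases flow_of_env hva.2.1 hc with h | h
            · obtain ⟨l, hl, ⟨_, rfl⟩ | ⟨_, rfl⟩⟩ := C.flow_ne_zero h
              · exact C.pos_of_ge (C.annular_index hl h1 h3).1 hl
              · exact C.pos_of_ge (C.annular_index hl.le h1 h3).1 hl.le
            · obtain ⟨l, hl, ⟨_, rfl⟩ | ⟨_, rfl⟩⟩ := D.flow_ne_zero h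
              · exact D.pos_of_ge (D.annular_index hl h1 h3).1 hl
              · exact D.pos_of_ge (D.annular_index hl.le h1 h3).1 hl.le
          · rcases flow_of_env hva.2.1 hc with h | h
            · obtain ⟨l, hl, ⟨_, rfl⟩ | ⟨_, rfl⟩⟩ := C.flow_ne_zero h
              · exact C.lt_top _ ((C.annular_index hl h1 h3).2.trans_lt C.hbL)
              · exact C.lt_top _ hl
            · obtain ⟨l, hl, ⟨_, rfl⟩ | ⟨_, rfl⟩⟩ := D.flow_ne_zero h
              · exact D.lt_top _ ((D.annular_index hl h1 h3).2.trans_lt D.hbL)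
              · exact D.lt_top _ hl
      · have hwS : w ∉ S := fun h => by have := (hSann w h).2.2.2; omega
        rw [if_neg hwS, if_neg h2, bd_env_high' C D hva h3]
        ring
  have hanti : ∑ v ∈ S, ∑ w ∈ S, bd (env C D) v w = 0 := by
    have h1 : ∑ v ∈ S, ∑ w ∈ S, bd (env C D) v w = -∑ v ∈ S, ∑ w ∈ S, bd (env C D) v w := by
      conv_lhs => rw [Finset.sum_comm]
      rw [← Finset.sum_neg_distrib]
      refine Finset.sum_congr rfl fun v _ => ?_
      rw [← Finset.sum_neg_distrib]
      exact Finset.sum_congr rfl fun w _ => bd_swap _ _ _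
    omega
  have hrow : ∀ v ∈ S, ∑ w ∈ S, bd (env C D) v w + (if v = s then -1 else 0) +
      (if v = e then 1 else 0) = 0 := by
    intro v hv
    have h0 := hsum v hv
    have e1 : ∑ w ∈ V, (if w ∈ S then bd (env C D) v w else 0) =
        ∑ w ∈ S, bd (env C D) v w := by
      rw [← Finset.sum_filter]
      refine Finset.sum_congr ?_ fun _ _ => rfl
      ext w
      simp only [S, Finset.mem_filter]
      tauto
    have e2 : ∑ w ∈ V, (if v = s ∧ w = par s then (-1 : ℤ) else 0) = if v = s then -1 else 0 := by
      by_cases h : v = s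
      · simp [h, hsa.2.2.1]
      · simp [h]
    have e3 : ∑ w ∈ V, (if v = e ∧ w = child e then (1 : ℤ) else 0) = if v = e then 1 else 0 := by
      by_cases h : v = e
      · simp [h, hea.1]
      · simp [h]
    rwa [Finset.sum_congr rfl (hsplit v hv), Finset.sum_add_distrib, Finset.sum_add_distrib,
      e1, e2, e3] at h0
  have htot := Finset.sum_eq_zero hrow
  rw [Finset.sum_add_distrib, Finset.sum_add_distrib, hanti, Finset.sum_ite_eq' S s,
    Finset.sum_ite_eq' S e, if_pos hsS] at htot
  by_contra hc
  rw [if_neg fun h => hc (Finset.mem_filter.1 h).2] at htot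
  omega

theorem exists_bd_of_reachable (C D : Crossing A B K) {v : ℤ × ℤ}
    (h : (envGraph C D).Reachable (firstOf (C.p C.a) (D.p D.a)) v) :
    ∃ w, bd (env C D) v w ≠ 0 := by
  obtain ⟨q⟩ := h.symm
  cases q with
  | nil => exact ⟨_, bd_start_ne_zero C D⟩
  | cons h q => exact ⟨_, h.1⟩

theorem mem_of_bd_env {C D : Crossing A B K} {v w : ℤ × ℤ} (hv : Annular A B K v)
    (h : bd (env C D) v w ≠ 0) :
    (∃ i, C.a ≤ i ∧ i ≤ C.b ∧ C.p i = v) ∨ (∃ i, D.a ≤ i ∧ i ≤ D.b ∧ D.p i = v) := by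
  have key : ∀ C : Crossing A B K, C.flow v w ≠ 0 → ∃ i, C.a ≤ i ∧ i ≤ C.b ∧ C.p i = v := by
    intro C h
    obtain ⟨l, hl, ⟨h1, _⟩ | ⟨h1, _⟩⟩ := C.flow_ne_zero h
    · obtain ⟨h2, h3⟩ := C.annular_index hl.le (by rw [h1]; exact hv.2.2.1)
        (by rw [h1]; exact hv.2.2.2)
      exact ⟨l, h2, h3, h1⟩
    · obtain ⟨h2, h3⟩ := C.annular_index hl (by rw [h1]; exact hv.2.2.1)
        (by rw [h1]; exact hv.2.2.2)
      exact ⟨_, h2, h3, h1⟩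
  exact (flow_of_env hv.2.1 h).imp (key C) (key D)

/-- A common vertex `v` on `C` is off `C'`, hence on `D'`, hence off `D`. So `D` has constant height
around `v`, and this is `0` since the maximum with `C` jumps there. As `D'` has smaller height than
`D`, it vanishes around `v` too. Since `C'` is constant around `v`, the envelope of `C'` and `D'`
cannot jump. -/
theorem not_bd_env_aux {C D C' D' : Crossing A B K} (hC : Disj C C') (hD : Disj D D')
    (hDs : AngleLt (D.p D.a) (D'.p D'.a)) {v w w' : ℤ × ℤ} (hv : Annular A B K v)
    (h : bd (env C D) v w ≠ 0) (h' : bd (env C' D') v w' ≠ 0)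
    (hi : ∃ i, C.a ≤ i ∧ i ≤ C.b ∧ C.p i = v) : False := by
  have hK := C.K_pos
  have hC'v : ∀ l ≤ C'.L, C'.p l ≠ v := by
    obtain ⟨i, h1, h2, rfl⟩ := hi
    exact hC.symm.not_mem h1 h2
  have hv' : ∃ i, D'.a ≤ i ∧ i ≤ D'.b ∧ D'.p i = v := by
    rcases mem_of_bd_env hv h' with ⟨i, h1, h2, h3⟩ | h1
    · exact absurd h3 (hC'v i (by have := C'.hbL; omega))
    · exact h1
  have hDv : ∀ l ≤ D.L, D.p l ≠ v := by
    obtain ⟨i, h1, h2, rfl⟩ := hv'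
    exact hD.not_mem h1 h2
  obtain ⟨f₁, f₂, h1, h2, he⟩ := bd_eq_of_covAdj (covAdj_of_bd_ne_zero h)
  obtain ⟨f₁', f₂', h1', h2', he'⟩ := bd_eq_of_covAdj (covAdj_of_bd_ne_zero h')
  have r1 := h1.row (Or.inl hv.2.1)
  have r2 := h2.row (Or.inl hv.2.1)
  have r1' := h1'.row (Or.inl hv.2.1)
  have r2' := h2'.row (Or.inl hv.2.1)
  have a1 := D.ht_around hv.1 hv.2.1 hDv h1 h2
  have a2 := D.ht_around hv.1 hv.2.1 hDv h1 h1'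
  have a3 := D.ht_around hv.1 hv.2.1 hDv h1 h2'
  have b1 := C'.ht_around hv.1 hv.2.1 hC'v h1' h2'
  rw [he] at h
  rw [he'] at h'
  simp only [env] at h h'
  have c1 := hD.ht_le hDs _ f₁'.2 r1'.1 r1'.2
  have c2 := hD.ht_le hDs _ f₂'.2 r2'.1 r2'.2
  have m1 := D.ht_mem hK (q := f₁.2) r1.1 r1.2
  have m2 := D'.ht_mem hK (q := f₁'.2) r1'.1 r1'.2
  have m3 := D'.ht_mem hK (q := f₂'.2) r2'.1 r2'.2
  have m4 := C'.ht_mem hK (q := f₁'.2) r1'.1 r1'.2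
  have m5 := C.ht_mem hK (q := f₁.2) r1.1 r1.2
  have m6 := C.ht_mem hK (q := f₂.2) r2.1 r2.2
  omega

/-- Envelopes of nested pairs of crossings are disjoint. -/
theorem not_bd_env {C D C' D' : Crossing A B K} (hC : Disj C C')
    (hCs : AngleLt (C.p C.a) (C'.p C'.a)) (hD : Disj D D')
    (hDs : AngleLt (D.p D.a) (D'.p D'.a)) {v w w' : ℤ × ℤ} (hv : Annular A B K v)
    (h : bd (env C D) v w ≠ 0) (h' : bd (env C' D') v w' ≠ 0) : False := by
  rcases mem_of_bd_env hv h with hi | hi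
  · exact not_bd_env_aux hC hD hDs hv h h' hi
  · rw [env_comm] at h h'
    exact not_bd_env_aux hD hC hCs hv h h' hi

end Crossing

/-! ### The projection of the cover onto the lattice. -/

/-- The rotation of angle `π / 3` of the triangular lattice. -/
def rot : Equiv.Perm (ℤ × ℤ) where
  toFun v := (-v.2, v.1 + v.2)
  invFun v := (v.1 + v.2, -v.1)
  left_inv v := by ext <;> simp
  right_inv v := by ext <;> simp

theorem rot_apply (x y : ℤ) : rot (x, y) = (-y, x + y) := rfl

theorem rot_pow_six : rot ^ (6 : ℤ) = 1 := by
  ext ⟨x, y⟩ <;> simp only [show (6 : ℤ) = ((6 : ℕ) : ℤ) from rfl, zpow_natCast, pow_succ, pow_zero,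
    Equiv.Perm.mul_apply, Equiv.Perm.one_apply, one_mul, rot_apply] <;> ring

/-- The quadratic form of the triangular lattice. -/
def form (v : ℤ × ℤ) : ℤ := v.1 ^ 2 + v.1 * v.2 + v.2 ^ 2

theorem zpow_induction {P : Equiv.Perm (ℤ × ℤ) → Prop} (h1 : P 1)
    (h2 : ∀ σ, P σ ↔ P (rot * σ)) (c : ℤ) : P (rot ^ c) := by
  induction c using Int.induction_on with
  | zero => simpa using h1
  | succ c ih =>
    rw [add_comm, zpow_add, zpow_one]
    exact (h2 _).1 ih
  | pred c ih =>
    rw [h2, ← zpow_one_add]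
    convert ih using 2
    ring

theorem form_rot_zpow (c : ℤ) (v : ℤ × ℤ) : form ((rot ^ c) v) = form v := by
  revert v
  refine zpow_induction (P := fun σ => ∀ v, form (σ v) = form v) (fun v => rfl) (fun σ => ?_) c
  refine forall_congr' fun v => ?_
  have : form (rot (σ v)) = form (σ v) := by
    obtain ⟨x, y⟩ := σ v
    simp only [rot_apply, form]; ring
  rw [Equiv.Perm.mul_apply, this]

theorem adj_rot_zpow (c : ℤ) (u v : ℤ × ℤ) :
    triangular.Adj ((rot ^ c) u) ((rot ^ c) v) ↔ triangular.Adj u v := by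
  revert u v
  refine zpow_induction (P := fun σ => ∀ u v, triangular.Adj (σ u) (σ v) ↔ triangular.Adj u v)
    (fun u v => Iff.rfl) (fun σ => ?_) c
  refine forall_congr' fun u => forall_congr' fun v => ?_
  have : triangular.Adj (rot (σ u)) (rot (σ v)) ↔ triangular.Adj (σ u) (σ v) := by
    obtain ⟨x, y⟩ := σ u
    obtain ⟨x', y'⟩ := σ v
    simp only [rot_apply, triangular]
    constructor <;> intro h <;> rw [← h] <;> ring
  rw [Equiv.Perm.mul_apply, Equiv.Perm.mul_apply, this]

/-- The site over which `v` lies, when its nearest axis is taken to be the first one. -/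
def loc (v : ℤ × ℤ) : ℤ × ℤ := if 0 ≤ off v then (v.1 - off v, off v) else (v.1, off v)

/-- The site over which a vertex of the cover lies. -/
def proj (v : ℤ × ℤ) : ℤ × ℤ := (rot ^ ax v) (loc v)

/-- In a sector the projection can be computed from its first axis even past the middle, where the
next axis is nearer: the two formulas differ by one rotation of angle `π / 3`. This avoids the
discontinuity of the nearest axis when adjacency is checked. -/
theorem proj_nonneg {v : ℤ × ℤ} {c d : ℤ} (hv : 1 ≤ v.1) (h : v.2 = v.1 * c + d) (h0 : 0 ≤ d)
    (h1 : d ≤ v.1) : proj v = (rot ^ c) (v.1 - d, d) := by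
  unfold proj loc
  obtain ⟨b1, b2⟩ := off_bounds hv
  have e := snd_eq v
  rcases le_or_gt (2 * d) v.1 with h2 | h2
  · have hax : ax v = c := ax_eq hv (by rw [h]; ring_nf; omega) (by rw [h]; ring_nf; omega)
    have hd : off v = d := by rw [hax] at e; omega
    rw [hax, hd, if_pos h0]
  · have hax : ax v = c + 1 := ax_eq hv (by rw [h]; ring_nf; omega) (by rw [h]; ring_nf; omega)
    have hd : off v = d - v.1 := by rw [hax] at e; linarith
    rw [hax, hd]
    rcases h1.lt_or_eq with h1 | h1
    · rw [if_neg (by omega), zpow_add, zpow_one, Equiv.Perm.mul_apply, rot_apply]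
      congr 1
      ext <;> simp
    · rw [if_pos (by omega), zpow_add, zpow_one, Equiv.Perm.mul_apply, rot_apply]
      congr 1
      ext <;> simp [h1]

theorem proj_nonpos {v : ℤ × ℤ} {c d : ℤ} (hv : 1 ≤ v.1) (h : v.2 = v.1 * c + d) (h0 : d ≤ 0)
    (h1 : -v.1 ≤ d) : proj v = (rot ^ c) (v.1, d) := by
  rw [proj_nonneg (c := c - 1) (d := d + v.1) hv (by rw [h]; ring) (by omega) (by omega)]
  conv_rhs => rw [show c = c - 1 + 1 by ring, zpow_add, zpow_one, Equiv.Perm.mul_apply, rot_apply]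
  congr 1
  ext <;> simp
  ring

theorem form_proj (v : ℤ × ℤ) : form (proj v) = nsq v := by
  unfold proj loc nsq
  rw [form_rot_zpow]
  split_ifs with h
  · rw [abs_of_nonneg h]; simp only [form]; ring
  · rw [abs_of_neg (by omega)]; simp only [form]; ring

theorem adj_of_rep {u v x y : ℤ × ℤ} (c : ℤ) (hu : proj u = (rot ^ c) x)
    (hv : proj v = (rot ^ c) y)
    (h : (x.1 - y.1) ^ 2 + (x.1 - y.1) * (x.2 - y.2) + (x.2 - y.2) ^ 2 = 1) :
    triangular.Adj (proj u) (proj v) := by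
  rw [hu, hv, adj_rot_zpow]
  exact h

theorem adj_proj_up {u v : ℤ × ℤ} (hu : 1 ≤ u.1) (h : Up u v) :
    triangular.Adj (proj u) (proj v) := by
  obtain ⟨h0, h1, h2, h3⟩ := h
  obtain ⟨b1, b2⟩ := off_bounds hu
  have e := snd_eq u
  generalize ax u = c at *
  generalize off u = d at *
  -- The deviation of `v` from the child of `u`; the edge condition becomes `|d - k t| ≤ k`, which
  -- leaves three values of `t`.
  obtain ⟨t, ht⟩ : ∃ t, v.2 = u.2 + c + t := ⟨v.2 - u.2 - c, by ring⟩
  have e1 : (u.1 + 1) * u.2 - u.1 * v.2 = d - u.1 * t := by rw [ht, e]; ring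
  rw [e1] at h2 h3
  have ev : v.2 = v.1 * c + (d + t) := by rw [ht, e, h1]; ring
  have t1 : t ≤ 1 := by nlinarith
  have t2 : -1 ≤ t := by nlinarith
  have : t = -1 ∨ t = 0 ∨ t = 1 := by omega
  rcases le_or_gt 0 d with hd | hd
  · have pu := proj_nonneg hu e hd (by omega)
    rcases this with rfl | rfl | rfl
    · obtain rfl : d = 0 := by linarith
      refine adj_of_rep c pu (proj_nonpos (by omega) ev (by omega) (by omega)) ?_
      simp only [h1]; ring
    · refine adj_of_rep c pu (proj_nonneg (by omega) ev (by omega) (by omega)) ?_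
      simp only [h1]; ring
    · refine adj_of_rep c pu (proj_nonneg (by omega) ev (by omega) (by omega)) ?_
      simp only [h1]; ring
  · have pu := proj_nonpos hu e hd.le (by omega)
    rcases this with rfl | rfl | rfl
    · refine adj_of_rep c pu (proj_nonpos (by omega) ev (by omega) (by omega)) ?_
      simp only [h1]; ring
    · refine adj_of_rep c pu (proj_nonpos (by omega) ev (by omega) (by omega)) ?_
      simp only [h1]; ring
    · linarith

theorem adj_proj_rt {u v : ℤ × ℤ} (h : Rt u v) : triangular.Adj (proj u) (proj v) := by
  obtain ⟨h0, h1, h2⟩ := h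
  obtain ⟨b1, b2⟩ := off_bounds h0
  have e := snd_eq u
  generalize ax u = c at *
  generalize off u = d at *
  have ev : v.2 = v.1 * c + (d + 1) := by rw [h2, e, h1]; ring
  rcases le_or_gt 0 d with hd | hd
  · refine adj_of_rep c (proj_nonneg h0 e hd (by omega))
      (proj_nonneg (by omega) ev (by omega) (by omega)) ?_
    simp only [h1]; ring
  · refine adj_of_rep c (proj_nonpos h0 e hd.le (by omega))
      (proj_nonpos (by omega) ev (by omega) (by omega)) ?_
    simp only [h1]; ring

theorem adj_proj {u v : ℤ × ℤ} (hu : 1 ≤ u.1) (hv : 1 ≤ v.1) (h : CovAdj u v) :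
    triangular.Adj (proj u) (proj v) := by
  rcases h with h | h | h | h
  · exact adj_proj_up hu h
  · exact (adj_proj_up hv h).symm
  · exact adj_proj_rt h
  · exact (adj_proj_rt h).symm

/-- The differences of adjacent sites. -/
theorem unit_vectors {a b : ℤ} (h : a ^ 2 + a * b + b ^ 2 = 1) :
    (a = 1 ∧ b = 0) ∨ (a = 0 ∧ b = 1) ∨ (a = -1 ∧ b = 1) ∨ (a = -1 ∧ b = 0) ∨
    (a = 0 ∧ b = -1) ∨ (a = 1 ∧ b = -1) := by
  have h1 : a ^ 2 ≤ 1 := by nlinarith [sq_nonneg (a + 2 * b)]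
  have h2 : b ^ 2 ≤ 1 := by nlinarith [sq_nonneg (2 * a + b)]
  have a1 : a ≤ 1 := by nlinarith
  have a2 : -1 ≤ a := by nlinarith
  have b1 : b ≤ 1 := by nlinarith
  have b2 : -1 ≤ b := by nlinarith
  interval_cases a <;> interval_cases b <;> simp_all

theorem exists_loc_of_adj {v y : ℤ × ℤ} (h : triangular.Adj (proj v) y) :
    ∃ a b : ℤ, y = (rot ^ ax v) ((loc v).1 + a, (loc v).2 + b) ∧
      ((a = 1 ∧ b = 0) ∨ (a = 0 ∧ b = 1) ∨ (a = -1 ∧ b = 1) ∨ (a = -1 ∧ b = 0) ∨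
      (a = 0 ∧ b = -1) ∨ (a = 1 ∧ b = -1)) := by
  obtain ⟨y', rfl⟩ := (rot ^ ax v).surjective y
  unfold proj at h
  rw [adj_rot_zpow] at h
  refine ⟨y'.1 - (loc v).1, y'.2 - (loc v).2, by simp, unit_vectors ?_⟩
  have h : ((loc v).1 - y'.1) ^ 2 + ((loc v).1 - y'.1) * ((loc v).2 - y'.2) +
    ((loc v).2 - y'.2) ^ 2 = 1 := h
  rw [← h]; ring

/-- Edges of the lattice avoiding the origin lift to the cover. -/
theorem exists_lift_adj {u y : ℤ × ℤ} (hu : 1 ≤ u.1) (h : triangular.Adj (proj u) y)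
    (hy : y ≠ (0, 0)) : ∃ w, CovAdj u w ∧ 1 ≤ w.1 ∧ proj w = y := by
  obtain ⟨a, b, rfl, hab⟩ := exists_loc_of_adj h
  clear h
  obtain ⟨k, m⟩ := u
  simp only at hu
  obtain ⟨b1, b2⟩ := off_bounds (v := (k, m)) hu
  have e := snd_eq (k, m)
  unfold loc at hy ⊢
  generalize ax (k, m) = c at *
  generalize off (k, m) = d at *
  simp only at b1 b2 e hy
  have hz : (rot ^ c) (0, 0) = (0, 0) := by
    refine zpow_induction (P := fun σ => σ (0, 0) = (0, 0)) rfl (fun σ => ?_) c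
    rw [Equiv.Perm.mul_apply, ← Equiv.apply_eq_iff_eq rot]
    rfl
  have fin : ∀ w x, CovAdj (k, m) w → 1 ≤ w.1 → proj w = (rot ^ c) x → ∀ x', x' = x →
      ∃ w, CovAdj (k, m) w ∧ 1 ≤ w.1 ∧ proj w = (rot ^ c) x' := by
    rintro w x h1 h2 h3 x' rfl
    exact ⟨w, h1, h2, h3⟩
  have up : ∀ t, d - k * t ≤ k → -k ≤ d - k * t → CovAdj (k, m) (k + 1, m + c + t) := by
    intro t h1 h2
    refine Or.inl ⟨by simp only; omega, rfl, ?_, ?_⟩ <;> simp only <;> rw [e] <;> linarith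
  have dn : 2 ≤ k → ∀ t, d + k * t ≤ k - 1 → -(k - 1) ≤ d + k * t →
      CovAdj (k, m) (k - 1, m - c + t) := by
    intro hk t h1 h2
    refine Or.inr (Or.inl ⟨by simp only; omega, by simp, ?_, ?_⟩) <;> simp only <;> rw [e] <;>
      linarith
  have rt : CovAdj (k, m) (k, m + 1) := Or.inr (Or.inr (Or.inl ⟨hu, rfl, rfl⟩))
  have lt : CovAdj (k, m) (k, m - 1) := Or.inr (Or.inr (Or.inr ⟨hu, rfl, by simp⟩))
  -- On each side of the axis, the six neighbors are matched with ring edges (`rt`, `lt`) and with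
  -- the outward and inward edges of deviation `t` (`up t`, `dn t`).
  rcases le_or_gt 0 d with hd | hd
  · rw [if_pos hd] at hy ⊢
    simp only at hy ⊢
    rcases hab with ⟨rfl, rfl⟩ | ⟨rfl, rfl⟩ | ⟨rfl, rfl⟩ | ⟨rfl, rfl⟩ | ⟨rfl, rfl⟩ | ⟨rfl, rfl⟩
    · refine fin _ _ (up 0 (by omega) (by omega)) (by simp only; omega)
        (proj_nonneg (c := c) (d := d) (by simp only; omega) (by simp only; rw [e]; ring) hd
          (by simp only; omega)) _ ?_
      ext <;> simp only <;> ring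
    · refine fin _ _ (up 1 (by omega) (by omega)) (by simp only; omega)
        (proj_nonneg (c := c) (d := d + 1) (by simp only; omega) (by simp only; rw [e]; ring)
          (by omega) (by simp only; omega)) _ ?_
      ext <;> simp only <;> ring
    · refine fin _ _ rt hu
        (proj_nonneg (c := c) (d := d + 1) (by simp only; omega) (by simp only; rw [e]; ring)
          (by omega) (by simp only; omega)) _ ?_
      ext <;> simp only; ring
    · rcases hu.lt_or_eq with hk | hk
      · refine fin _ _ (dn (by omega) 0 (by omega) (by omega)) (by simp only; omega)
          (proj_nonneg (c := c) (d := d) (by simp only; omega) (by simp only; rw [e]; ring) hd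
            (by simp only; omega)) _ ?_
        ext <;> simp only <;> ring
      -- From ring `1` the inward neighbor is the origin, which is excluded.
      · exfalso
        apply hy
        obtain rfl : d = 0 := by omega
        rw [← hk]
        simpa using hz
    · rcases hd.lt_or_eq with hd' | hd'
      · refine fin _ _ (dn (by omega) (-1) (by omega) (by omega)) (by simp only; omega)
          (proj_nonneg (c := c) (d := d - 1) (by simp only; omega) (by simp only; rw [e]; ring)
            (by omega) (by simp only; omega)) _ ?_
        ext <;> simp only <;> ring
      · subst hd'
        refine fin _ _ lt hu
          (proj_nonpos (c := c) (d := -1) (by simp only; omega) (by simp only; rw [e]; ring)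
            (by omega) (by simp only; omega)) _ ?_
        ext <;> simp
    · rcases hd.lt_or_eq with hd' | hd'
      · refine fin _ _ lt hu
          (proj_nonneg (c := c) (d := d - 1) (by simp only; omega) (by simp only; rw [e]; ring)
            (by omega) (by simp only; omega)) _ ?_
        ext <;> simp only <;> ring
      · subst hd'
        refine fin _ _ (up (-1) (by omega) (by omega)) (by simp only; omega)
          (proj_nonpos (c := c) (d := -1) (by simp only; omega) (by simp only; rw [e]; ring)
            (by omega) (by simp only; omega)) _ ?_
        ext <;> simp
  · rw [if_neg (by omega)] at hy ⊢
    simp only at hy ⊢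
    rcases hab with ⟨rfl, rfl⟩ | ⟨rfl, rfl⟩ | ⟨rfl, rfl⟩ | ⟨rfl, rfl⟩ | ⟨rfl, rfl⟩ | ⟨rfl, rfl⟩
    · refine fin _ _ (up 0 (by omega) (by omega)) (by simp only; omega)
        (proj_nonpos (c := c) (d := d) (by simp only; omega) (by simp only; rw [e]; ring) hd.le
          (by simp only; omega)) _ ?_
      ext <;> simp
    · refine fin _ _ rt hu
        (proj_nonpos (c := c) (d := d + 1) (by simp only; omega) (by simp only; rw [e]; ring)
          (by omega) (by simp only; omega)) _ ?_
      ext <;> simp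
    · refine fin _ _ (dn (by omega) 1 (by omega) (by omega)) (by simp only; omega)
        (proj_nonpos (c := c) (d := d + 1) (by simp only; omega) (by simp only; rw [e]; ring)
          (by omega) (by simp only; omega)) _ ?_
      ext <;> simp only <;> ring
    · refine fin _ _ (dn (by omega) 0 (by omega) (by omega)) (by simp only; omega)
        (proj_nonpos (c := c) (d := d) (by simp only; omega) (by simp only; rw [e]; ring) hd.le
          (by simp only; omega)) _ ?_
      ext <;> simp only <;> ring
    · refine fin _ _ lt hu
        (proj_nonpos (c := c) (d := d - 1) (by simp only; omega) (by simp only; rw [e]; ring)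
          (by omega) (by simp only; omega)) _ ?_
      ext <;> simp only <;> ring
    · refine fin _ _ (up (-1) (by omega) (by omega)) (by simp only; omega)
        (proj_nonpos (c := c) (d := d - 1) (by simp only; omega) (by simp only; rw [e]; ring)
          (by omega) (by simp only; omega)) _ ?_
      ext <;> simp only; ring

/-- No neighbor is nearer to the origin than the parent. Hence a site with any neighbor in the ball
has its parent there, which turns the external boundary into `InnerBd`; `le_nsq_child` serves
`OuterBd` in the same way. -/
theorem nsq_par_le {v y : ℤ × ℤ} (hv : 2 ≤ v.1) (h : triangular.Adj (proj v) y) :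
    nsq (par v) ≤ form y := by
  obtain ⟨a, b, rfl, hab⟩ := exists_loc_of_adj h
  rw [form_rot_zpow, nsq_par hv]
  obtain ⟨b1, b2⟩ := off_bounds (v := v) (by omega)
  unfold loc
  generalize off v = d at *
  split_ifs with hd
  · rw [abs_of_nonneg hd]
    rcases hab with ⟨rfl, rfl⟩ | ⟨rfl, rfl⟩ | ⟨rfl, rfl⟩ | ⟨rfl, rfl⟩ | ⟨rfl, rfl⟩ | ⟨rfl, rfl⟩ <;>
    · simp only [form]; nlinarith
  · rw [abs_of_neg (by omega)]
    rcases hab with ⟨rfl, rfl⟩ | ⟨rfl, rfl⟩ | ⟨rfl, rfl⟩ | ⟨rfl, rfl⟩ | ⟨rfl, rfl⟩ | ⟨rfl, rfl⟩ <;>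
    · simp only [form]; nlinarith

theorem le_nsq_child {v y : ℤ × ℤ} (hv : 1 ≤ v.1) (h : triangular.Adj (proj v) y) :
    form y ≤ nsq (child v) := by
  obtain ⟨a, b, rfl, hab⟩ := exists_loc_of_adj h
  rw [form_rot_zpow, nsq_child hv]
  obtain ⟨b1, b2⟩ := off_bounds (v := v) (by omega)
  unfold loc
  generalize off v = d at *
  split_ifs with hd
  · rw [abs_of_nonneg hd]
    rcases hab with ⟨rfl, rfl⟩ | ⟨rfl, rfl⟩ | ⟨rfl, rfl⟩ | ⟨rfl, rfl⟩ | ⟨rfl, rfl⟩ | ⟨rfl, rfl⟩ <;>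
    · simp only [form]; nlinarith
  · rw [abs_of_neg (by omega)]
    rcases hab with ⟨rfl, rfl⟩ | ⟨rfl, rfl⟩ | ⟨rfl, rfl⟩ | ⟨rfl, rfl⟩ | ⟨rfl, rfl⟩ | ⟨rfl, rfl⟩ <;>
    · simp only [form]; nlinarith

theorem exists_lift {x : ℤ × ℤ} (hx : x ≠ (0, 0)) : ∃ v, 1 ≤ v.1 ∧ proj v = x := by
  have key : ∀ (c a b : ℤ), 1 ≤ a → 0 ≤ b → ∃ v, 1 ≤ v.1 ∧ proj v = (rot ^ c) (a, b) := by
    intro c a b ha hb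
    refine ⟨(a + b, (a + b) * c + b), by simp only; omega, ?_⟩
    rw [proj_nonneg (c := c) (d := b) (by simp only; omega) rfl hb (by simp only; omega)]
    simp
  have e : ∀ c : ℕ, ∀ y, (rot ^ (c : ℤ)) y = (rot ^ c) y := fun c y => by rw [zpow_natCast]
  obtain ⟨p, q⟩ := x
  have hpq : p ≠ 0 ∨ q ≠ 0 := by
    by_contra! h
    exact hx (by rw [h.1, h.2])
  have : (1 ≤ p ∧ 0 ≤ q) ∨ (p ≤ 0 ∧ 1 ≤ p + q) ∨ (1 ≤ q ∧ p + q ≤ 0) ∨ (p ≤ -1 ∧ q ≤ 0) ∨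
      (0 ≤ p ∧ p + q ≤ -1) ∨ (q ≤ -1 ∧ 0 ≤ p + q) := by omega
  rcases this with h | h | h | h | h | h
  · simpa using key 0 p q h.1 h.2
  · convert key (1 : ℕ) (p + q) (-p) h.2 (by omega) using 4
    rw [e]; simp [rot_apply]
  · convert key (2 : ℕ) q (-p - q) h.1 (by omega) using 4
    rw [e]; simp [pow_succ, rot_apply]
  · convert key (3 : ℕ) (-p) (-q) (by omega) (by omega) using 4
    rw [e]; simp [pow_succ, rot_apply]
  · convert key (4 : ℕ) (-p - q) p (by omega) (by omega) using 4
    rw [e]; simp [pow_succ, rot_apply]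
  · convert key (5 : ℕ) (-q) (p + q) (by omega) (by omega) using 4
    rw [e]; simp [pow_succ, rot_apply]

/-! ### Deck transformations. -/

/-- The deck transformations of the cover: rotation by `2πc`. -/
def turn (c : ℤ) (v : ℤ × ℤ) : ℤ × ℤ := (v.1, v.2 + 6 * v.1 * c)

theorem ax_turn {v : ℤ × ℤ} (hv : 1 ≤ v.1) (c : ℤ) : ax (turn c v) = ax v + 6 * c := by
  obtain ⟨b1, b2⟩ := off_bounds hv
  have e := snd_eq v
  refine ax_eq hv ?_ ?_ <;> simp only [turn] <;> rw [e] <;> ring_nf at * <;> omega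

theorem off_turn {v : ℤ × ℤ} (hv : 1 ≤ v.1) (c : ℤ) : off (turn c v) = off v := by
  have := ax_turn hv c
  unfold off
  rw [this]
  simp only [turn]
  ring

theorem nsq_turn {v : ℤ × ℤ} (hv : 1 ≤ v.1) (c : ℤ) : nsq (turn c v) = nsq v := by
  unfold nsq
  rw [off_turn hv]
  rfl

theorem proj_turn {v : ℤ × ℤ} (hv : 1 ≤ v.1) (c : ℤ) : proj (turn c v) = proj v := by
  unfold proj loc
  rw [ax_turn hv, off_turn hv, zpow_add, zpow_mul, rot_pow_six, one_zpow, mul_one]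
  rfl

theorem par_turn {v : ℤ × ℤ} (hv : 1 ≤ v.1) (c : ℤ) : par (turn c v) = turn c (par v) := by
  unfold par
  rw [ax_turn hv]
  simp only [turn]
  ext <;> simp only; ring

theorem child_turn {v : ℤ × ℤ} (hv : 1 ≤ v.1) (c : ℤ) : child (turn c v) = turn c (child v) := by
  unfold child
  rw [ax_turn hv]
  simp only [turn]
  ext <;> simp only; ring

theorem turn_turn (c c' : ℤ) (v : ℤ × ℤ) : turn c (turn c' v) = turn (c + c') v := by
  simp only [turn]
  ext <;> simp only; ring

theorem turn_zero (v : ℤ × ℤ) : turn 0 v = v := by simp [turn]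

theorem turn_injective (c : ℤ) : Function.Injective (turn c) := by
  intro u v h
  have := congrArg (turn (-c)) h
  rwa [turn_turn, turn_turn, neg_add_cancel, turn_zero, turn_zero] at this

theorem up_turn {u v : ℤ × ℤ} (c : ℤ) : Up (turn c u) (turn c v) ↔ Up u v := by
  simp only [Up, turn]
  refine and_congr_right fun _ => and_congr_right fun h => ?_
  rw [h]
  ring_nf

theorem rt_turn {u v : ℤ × ℤ} (c : ℤ) : Rt (turn c u) (turn c v) ↔ Rt u v := by
  simp only [Rt, turn]
  refine and_congr_right fun _ => and_congr_right fun h => ?_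
  rw [h]
  constructor <;> intro h <;> linarith

theorem covAdj_turn {u v : ℤ × ℤ} (c : ℤ) : CovAdj (turn c u) (turn c v) ↔ CovAdj u v := by
  simp only [CovAdj, up_turn, rt_turn]

/-- A turn moves positions by `6k` in ring `k` and by `6(k + 1)` in the next one, hence the edge
indices of the layer by their sum `12k + 6`. -/
theorem lastUp_turn {k m : ℤ} (hk : 1 ≤ k) (c : ℤ) :
    lastUp k (m + 6 * k * c) = lastUp k m + (12 * k + 6) * c := by
  unfold lastUp
  rw [← Int.add_mul_ediv_right _ _ (by omega : k ≠ 0)]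
  congr 1
  ring

theorem lastDown_turn {k m : ℤ} (hk : 1 ≤ k) (c : ℤ) :
    lastDown k (m + 6 * k * c) = lastDown k m + (12 * (k - 1) + 6) * c := by
  unfold lastDown
  rw [← Int.add_mul_ediv_right _ _ (by omega : k ≠ 0)]
  congr 1
  ring

theorem bd_turn {g g' : ℤ → ℤ → ℤ} {c : ℤ} (h : ∀ k q, g' k (q + (12 * k + 6) * c) = g k q)
    (u v : ℤ × ℤ) : bd g' (turn c u) (turn c v) = bd g u v := by
  have key : ∀ u v, fwd g' (turn c u) (turn c v) = fwd g u v := by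
    intro u v
    unfold fwd
    simp only [up_turn, rt_turn]
    congr 1
    · split_ifs with hU
      · have e := hU.2.1
        rw [← h, ← h]
        simp only [turn]
        rw [e]
        ring_nf
      · rfl
    · split_ifs with hR
      · rw [← h, ← h]
        simp only [turn]
        rw [lastUp_turn hR.1, lastDown_turn hR.1]
      · rfl
  unfold bd
  rw [key, key]

/-! ### Euclidean norms and arguments of lifted sites. -/

theorem norm_pos_sq (v : ℤ × ℤ) : ‖pos v‖ ^ 2 = (form v : ℝ) := by
  have h3 : Real.sqrt 3 * Real.sqrt 3 = 3 := Real.mul_self_sqrt (by norm_num)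
  rw [← Complex.normSq_eq_norm_sq, Complex.normSq_apply]
  simp only [pos, form]
  push_cast
  linear_combination ((v.2 : ℝ) ^ 2 / 4) * h3

theorem mem_ball_iff (v : ℤ × ℤ) (n : ℕ) : v ∈ ball n ↔ form v ≤ (n : ℤ) ^ 2 := by
  have : v ∈ ball n ↔ ‖pos v‖ ≤ n := Iff.rfl
  rw [this, ← sq_le_sq₀ (norm_nonneg _) (by positivity), norm_pos_sq]
  exact_mod_cast Iff.rfl

theorem pos_rot (v : ℤ × ℤ) : pos (rot v) = Complex.exp (((Real.pi / 3 : ℝ) : ℂ) * Complex.I) *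
    pos v := by
  have h3 : Real.sqrt 3 * Real.sqrt 3 = 3 := Real.mul_self_sqrt (by norm_num)
  rw [Complex.exp_mul_I, ← Complex.ofReal_cos, ← Complex.ofReal_sin, Real.cos_pi_div_three,
    Real.sin_pi_div_three]
  obtain ⟨x, y⟩ := v
  rw [rot_apply]
  apply Complex.ext <;> simp [pos]
  · linear_combination (y : ℝ) / 4 * h3
  · ring

theorem pos_rot_zpow (c : ℤ) (v : ℤ × ℤ) :
    pos ((rot ^ c) v) = Complex.exp (((Real.pi / 3 * c : ℝ) : ℂ) * Complex.I) * pos v := by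
  induction c using Int.induction_on with
  | zero => simp
  | succ c ih =>
    rw [add_comm, zpow_add, zpow_one, Equiv.Perm.mul_apply, pos_rot, ih, ← mul_assoc,
      ← Complex.exp_add]
    congr 2
    push_cast
    ring
  | pred c ih =>
    have h : pos ((rot ^ (-(c : ℤ))) v) =
        Complex.exp (((Real.pi / 3 : ℝ) : ℂ) * Complex.I) * pos ((rot ^ (-(c : ℤ) - 1)) v) := by
      rw [← pos_rot, ← Equiv.Perm.mul_apply, ← zpow_one_add]
      congr 3
      ring
    rw [ih] at h
    have h' := congrArg (fun z => Complex.exp (-(((Real.pi / 3 : ℝ) : ℂ) * Complex.I)) * z) h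
    rw [← mul_assoc, ← mul_assoc, ← Complex.exp_add, ← Complex.exp_add, neg_add_cancel,
      Complex.exp_zero, one_mul] at h'
    rw [← h']
    congr 2
    push_cast
    ring

/-- The angle of a vertex of the cover with its nearest axis. -/
noncomputable def relAngle (v : ℤ × ℤ) : ℝ :=
  Real.arctan (Real.sqrt 3 * off v / (2 * v.1 - |(off v : ℝ)|))

/-- The angle of a vertex of the cover. -/
noncomputable def angle (v : ℤ × ℤ) : ℝ := Real.pi / 3 * ax v + relAngle v

theorem off_bounds_real {v : ℤ × ℤ} (hv : 1 ≤ v.1) :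
    (1 : ℝ) ≤ v.1 ∧ -(v.1 : ℝ) < 2 * off v ∧ 2 * (off v : ℝ) ≤ v.1 := by
  obtain ⟨h1, h2⟩ := off_bounds hv
  exact ⟨by exact_mod_cast hv, by exact_mod_cast h1, by exact_mod_cast h2⟩

theorem den_pos {v : ℤ × ℤ} (hv : 1 ≤ v.1) : 0 < 2 * (v.1 : ℝ) - |(off v : ℝ)| := by
  obtain ⟨h0, h1, h2⟩ := off_bounds_real hv
  have : |(off v : ℝ)| ≤ v.1 := by rw [abs_le]; constructor <;> linarith
  linarith

theorem relAngle_bounds {v : ℤ × ℤ} (hv : 1 ≤ v.1) :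
    -(Real.pi / 6) < relAngle v ∧ relAngle v ≤ Real.pi / 6 := by
  obtain ⟨h0, h1, h2⟩ := off_bounds_real hv
  have hd := den_pos hv
  have h3 : Real.sqrt 3 * Real.sqrt 3 = 3 := Real.mul_self_sqrt (by norm_num)
  have hs : 0 < Real.sqrt 3 := by positivity
  have e1 : Real.pi / 6 = Real.arctan (1 / Real.sqrt 3) := by
    rw [← Real.tan_pi_div_six, Real.arctan_tan] <;> linarith [Real.pi_pos]
  unfold relAngle
  rw [e1, ← Real.arctan_neg]
  constructor
  · apply Real.arctan_strictMono
    rw [lt_div_iff₀ hd, neg_mul, div_mul_eq_mul_div, ← neg_div, div_lt_iff₀ hs]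
    rcases le_or_gt 0 (off v : ℝ) with h | h
    · rw [abs_of_nonneg h] at hd ⊢
      nlinarith
    · rw [abs_of_neg h] at hd ⊢
      nlinarith
  · apply Real.arctan_strictMono.monotone
    rw [div_le_div_iff₀ hd hs]
    rcases le_or_gt 0 (off v : ℝ) with h | h
    · rw [abs_of_nonneg h] at hd ⊢
      nlinarith
    · rw [abs_of_neg h] at hd ⊢
      nlinarith

theorem pos_loc {v : ℤ × ℤ} (hv : 1 ≤ v.1) :
    pos (loc v) = ‖pos (loc v)‖ * Complex.exp ((relAngle v : ℂ) * Complex.I) := by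
  have hd := den_pos hv
  have hre : (pos (loc v)).re = (2 * (v.1 : ℝ) - |(off v : ℝ)|) / 2 := by
    unfold loc
    split_ifs with h
    · rw [abs_of_nonneg (by exact_mod_cast h)]
      simp [pos]; ring
    · rw [abs_of_neg (by exact_mod_cast (not_le.1 h))]
      simp [pos]; ring
  have him : (pos (loc v)).im = (off v : ℝ) * (Real.sqrt 3 / 2) := by
    unfold loc
    split_ifs with h <;> simp [pos]
  have harg : Complex.arg (pos (loc v)) = relAngle v := by
    have hpos : 0 < (pos (loc v)).re := by rw [hre]; linarith
    have h1 := Complex.abs_arg_lt_pi_div_two_iff.2 (Or.inl hpos)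
    rw [abs_lt] at h1
    rw [← Real.arctan_tan h1.1 h1.2, Complex.tan_arg, hre, him]
    unfold relAngle
    congr 1
    field_simp
  conv_lhs => rw [← Complex.norm_mul_exp_arg_mul_I (pos (loc v)), harg]

theorem pos_proj {v : ℤ × ℤ} (hv : 1 ≤ v.1) :
    pos (proj v) = ‖pos (proj v)‖ * Complex.exp ((angle v : ℂ) * Complex.I) := by
  have h1 : pos (proj v) = Complex.exp (((Real.pi / 3 * ax v : ℝ) : ℂ) * Complex.I) *
    pos (loc v) := pos_rot_zpow _ _
  have h2 : ‖pos (proj v)‖ = ‖pos (loc v)‖ := by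
    rw [h1, norm_mul, Complex.norm_exp_ofReal_mul_I, one_mul]
  rw [h2, h1]
  conv_lhs => rw [pos_loc hv]
  unfold angle
  rw [Complex.ofReal_add, add_mul, Complex.exp_add]
  ring

/-- The order of the ratios `m / k`, that is of the positions along hexagons, agrees with the
Euclidean one: on each side of an axis the tangent of the relative angle is an increasing function
of `d / k`. -/
theorem angle_lt {u v : ℤ × ℤ} (hu : 1 ≤ u.1) (hv : 1 ≤ v.1) (h : AngleLt u v) :
    angle u < angle v := by
  have h1 := ax_le_of_angle hu hv (le_of_lt h)
  obtain ⟨a1, a2⟩ := relAngle_bounds hu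
  obtain ⟨b1, b2⟩ := relAngle_bounds hv
  have hpi := Real.pi_pos
  unfold angle
  rcases h1.lt_or_eq with h1 | h1
  · have : (ax u : ℝ) + 1 ≤ ax v := by exact_mod_cast h1
    nlinarith
  · rw [h1]
    gcongr
    unfold relAngle
    apply Real.arctan_strictMono
    rw [div_lt_div_iff₀ (den_pos hu) (den_pos hv)]
    have h2 : off u * v.1 < off v * u.1 := by
      unfold AngleLt at h
      rw [snd_eq u, snd_eq v, h1] at h
      nlinarith
    have h3 : (off u : ℝ) * v.1 < off v * u.1 := by exact_mod_cast h2
    have hs : 0 < Real.sqrt 3 := by positivity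
    rw [mul_assoc, mul_assoc]
    refine mul_lt_mul_of_pos_left ?_ hs
    obtain ⟨u0, -, -⟩ := off_bounds_real hu
    obtain ⟨v0, -, -⟩ := off_bounds_real hv
    have du := den_pos hu
    have dv := den_pos hv
    rcases le_or_gt 0 (off u : ℝ) with hu' | hu' <;> rcases le_or_gt 0 (off v : ℝ) with hv' | hv'
    · rw [abs_of_nonneg hu', abs_of_nonneg hv']; linarith
    · nlinarith
    · have := mul_neg_of_neg_of_pos hu' dv
      have := mul_nonneg hv' du.le
      linarith
    · rw [abs_of_neg hu', abs_of_neg hv']; linarith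

theorem angle_le {u v : ℤ × ℤ} (hu : 1 ≤ u.1) (hv : 1 ≤ v.1) (h : u.2 * v.1 ≤ v.2 * u.1) :
    angle u ≤ angle v := by
  rcases h.lt_or_eq with h' | h'
  · exact (angle_lt hu hv h').le
  · have h1 : ax u = ax v :=
      le_antisymm (ax_le_of_angle hu hv h) (ax_le_of_angle hv hu h'.ge)
    unfold angle relAngle
    rw [h1]
    refine le_of_eq ?_
    congr 2
    rw [div_eq_div_iff (den_pos hu).ne' (den_pos hv).ne']
    have h2 : off u * v.1 = off v * u.1 := by
      rw [snd_eq u, snd_eq v, h1] at h'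
      nlinarith
    have h3 : (off u : ℝ) * v.1 = off v * u.1 := by exact_mod_cast h2
    obtain ⟨u0, -, -⟩ := off_bounds_real hu
    obtain ⟨v0, -, -⟩ := off_bounds_real hv
    rw [mul_assoc, mul_assoc]
    congr 1
    rcases le_or_gt 0 (off u : ℝ) with hu' | hu' <;> rcases le_or_gt 0 (off v : ℝ) with hv' | hv'
    · rw [abs_of_nonneg hu', abs_of_nonneg hv']; linarith
    · nlinarith
    · nlinarith
    · rw [abs_of_neg hu', abs_of_neg hv']; linarith

theorem angleLt_iff {u v : ℤ × ℤ} (hu : 1 ≤ u.1) (hv : 1 ≤ v.1) :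
    AngleLt u v ↔ angle u < angle v := by
  refine ⟨angle_lt hu hv, fun h => ?_⟩
  by_contra hc
  exact absurd (angle_le hv hu (not_lt.1 hc)) (not_le.2 h)

theorem angle_turn {v : ℤ × ℤ} (hv : 1 ≤ v.1) (c : ℤ) :
    angle (turn c v) = angle v + 2 * Real.pi * c := by
  unfold angle relAngle
  rw [ax_turn hv, off_turn hv]
  push_cast
  simp only [turn]
  ring

theorem nsq_pos {v : ℤ × ℤ} (hv : 1 ≤ v.1) : 1 ≤ nsq v := by
  obtain ⟨h1, h2⟩ := off_bounds hv
  unfold nsq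
  have : |off v| ≤ v.1 - |off v| := by
    have : |off v| * 2 ≤ v.1 := by
      rcases le_or_gt 0 (off v) with h | h
      · rw [abs_of_nonneg h]; omega
      · rw [abs_of_neg h]; omega
    omega
  have h0 := abs_nonneg (off v)
  rw [← sq_abs (off v)]
  nlinarith

theorem pos_proj_ne_zero {v : ℤ × ℤ} (hv : 1 ≤ v.1) : pos (proj v) ≠ 0 := by
  intro h
  have h1 := norm_pos_sq (proj v)
  rw [h, form_proj, norm_zero] at h1
  have h2 : (nsq v : ℝ) = 0 := by rw [← h1]; norm_num
  have h3 := nsq_pos hv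
  have : nsq v = 0 := by exact_mod_cast h2
  omega

/-- Any argument of a site is the angle of a lift of the site. -/
theorem exists_lift_angle {x : ℤ × ℤ} (hx : x ≠ (0, 0)) {θ : ℝ}
    (h : pos x = ‖pos x‖ * Complex.exp ((θ : ℂ) * Complex.I)) :
    ∃ v, 1 ≤ v.1 ∧ proj v = x ∧ angle v = θ := by
  obtain ⟨v, hv, rfl⟩ := exists_lift hx
  have h1 := pos_proj hv
  have h0 : (‖pos (proj v)‖ : ℂ) ≠ 0 := by
    simpa using pos_proj_ne_zero hv
  rw [h] at h1
  have h2 : Complex.exp ((θ : ℂ) * Complex.I) = Complex.exp ((angle v : ℂ) * Complex.I) := by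
    have := h1
    rw [← h] at this
    exact mul_left_cancel₀ h0 (h.symm.trans this)
  obtain ⟨c, hc⟩ := Complex.exp_eq_exp_iff_exists_int.1 h2
  refine ⟨turn c v, hv, proj_turn hv c, ?_⟩
  rw [angle_turn hv]
  have := congrArg Complex.im hc
  simp at this
  linarith

/-- Two vertices over the same site differ by a rotation. -/
theorem eq_turn_of_proj_eq {u v : ℤ × ℤ} (hu : 1 ≤ u.1) (hv : 1 ≤ v.1) (h : proj u = proj v) :
    ∃ c, v = turn c u := by
  have h1 := pos_proj hu
  have h2 := pos_proj hv
  have h0 : (‖pos (proj v)‖ : ℂ) ≠ 0 := by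
    simpa using pos_proj_ne_zero hv
  rw [h] at h1
  obtain ⟨c, hc⟩ := Complex.exp_eq_exp_iff_exists_int.1
    (mul_left_cancel₀ h0 (h2.symm.trans h1))
  have h3 : angle v = angle (turn c u) := by
    rw [angle_turn hu]
    have := congrArg Complex.im hc
    simp at this
    linarith
  refine ⟨c, ?_⟩
  have hn : nsq v = nsq (turn c u) := by
    rw [nsq_turn hu, ← form_proj, ← form_proj, h]
  have hu' : 1 ≤ (turn c u).1 := hu
  generalize turn c u = w at *
  have k1 : v.2 * w.1 = w.2 * v.1 := by
    rcases lt_trichotomy (v.2 * w.1) (w.2 * v.1) with h | h | h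
    · exact absurd (angle_lt hv hu' h) (by rw [h3]; exact lt_irrefl _)
    · exact h
    · exact absurd (angle_lt hu' hv h) (by rw [h3]; exact lt_irrefl _)
  have hax : ax v = ax w :=
    le_antisymm (ax_le_of_angle hv hu' k1.le) (ax_le_of_angle hu' hv k1.ge)
  have hoff : off v * w.1 = off w * v.1 := by
    rw [snd_eq v, snd_eq w, hax] at k1
    nlinarith
  -- Along a ray from the origin the squared distance increases strictly with the ring, so an angle
  -- and a distance determine a vertex.
  have main : ∀ v w : ℤ × ℤ, 1 ≤ v.1 → 1 ≤ w.1 → off v * w.1 = off w * v.1 → v.1 < w.1 →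
      nsq v < nsq w := by
    intro v w hv hw he hlt
    obtain ⟨b1, b2⟩ := off_bounds hv
    obtain ⟨b3, b4⟩ := off_bounds hw
    have he' : |off v| * w.1 = |off w| * v.1 := by
      have := congrArg abs he
      rwa [abs_mul, abs_mul, abs_of_pos (by omega : 0 < w.1), abs_of_pos (by omega : 0 < v.1)]
        at this
    have a0 : 0 ≤ |off v| := abs_nonneg _
    have a1 : |off v| * 2 ≤ v.1 := by
      rcases le_or_gt 0 (off v) with h | h
      · rw [abs_of_nonneg h]; omega
      · rw [abs_of_neg h]; omega
    have a2 : |off v| ≤ |off w| := by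
      by_contra! hc
      nlinarith
    have a3 : v.1 - |off v| + 1 ≤ w.1 - |off w| := by
      by_contra! hc
      nlinarith
    have a4 := nsq_child_le (u := v) (v := w) hv (by omega) a2
    have a5 := nsq_child hv
    have a6 : nsq v = v.1 ^ 2 - v.1 * |off v| + off v ^ 2 := rfl
    nlinarith
  rcases lt_trichotomy v.1 w.1 with hk | hk | hk
  · have := main v w hv hu' hoff hk; omega
  · refine Prod.ext hk ?_
    rw [hk] at k1
    exact mul_right_cancel₀ (by omega : w.1 ≠ 0) k1
  · have := main w v hu' hv hoff.symm hk; omega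

/-- The ratios `m / k` of neighbors differ by at most one, and a difference of one is an angle of `π
/ 3`. The bound `π` is what identifies the increment of angle with a principal argument. -/
theorem abs_angle_sub_lt {u v : ℤ × ℤ} (hu : 1 ≤ u.1) (hv : 1 ≤ v.1) (h : CovAdj u v) :
    |angle v - angle u| < Real.pi := by
  have hpi := Real.pi_pos
  have step : ∀ u : ℤ × ℤ, 1 ≤ u.1 → ∀ t : ℤ, angle (u.1, u.2 + u.1 * t) =
      angle u + Real.pi / 3 * t := by
    intro u hu t
    obtain ⟨b1, b2⟩ := off_bounds hu
    have e := snd_eq u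
    have h1 : ax (u.1, u.2 + u.1 * t) = ax u + t := by
      refine ax_eq hu ?_ ?_ <;> simp only <;> rw [e] <;> ring_nf at * <;> omega
    have h2 : off (u.1, u.2 + u.1 * t) = off u := by
      unfold off; rw [h1]; simp only; ring
    unfold angle relAngle
    rw [h1, h2]
    push_cast
    ring
  have key : ∀ u v : ℤ × ℤ, 1 ≤ u.1 → 1 ≤ v.1 → Up u v ∨ Rt u v →
      |angle v - angle u| < Real.pi := by
    intro u v hu hv h
    have s1 := step u hu 1
    have s2 := step u hu (-1)
    push_cast at s1 s2
    have h1 : angle v ≤ angle (u.1, u.2 + u.1 * 1) := by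
      refine angle_le (v := (u.1, u.2 + u.1 * 1)) hv hu ?_
      rcases h with ⟨_, h1, h2, h3⟩ | ⟨_, h1, h2⟩ <;> simp only <;> rw [h1]
      · nlinarith
      · rw [h2]; nlinarith
    have h2 : angle (u.1, u.2 + u.1 * -1) ≤ angle v := by
      refine angle_le (u := (u.1, u.2 + u.1 * -1)) hu hv ?_
      rcases h with ⟨_, h1, h2, h3⟩ | ⟨_, h1, h2⟩ <;> simp only <;> rw [h1]
      · nlinarith
      · rw [h2]; nlinarith
    rw [s1] at h1
    rw [s2] at h2
    rw [abs_lt]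
    constructor <;> linarith
  rcases h with h | h | h | h
  · exact key u v hu hv (Or.inl h)
  · rw [abs_sub_comm]; exact key v u hv hu (Or.inl h)
  · exact key u v hu hv (Or.inr h)
  · rw [abs_sub_comm]; exact key v u hv hu (Or.inr h)

/-! ### Winding angles computed on lifts. -/

/-- Two continuous determinations of the argument have the same variation. -/
theorem sub_eq_sub_of_exp_eq {a b : ℝ} (hab : a ≤ b) {θ θ' : ℝ → ℝ}
    (hθ : ContinuousOn θ (Set.Icc a b)) (hθ' : ContinuousOn θ' (Set.Icc a b))
    (h : ∀ t ∈ Set.Icc a b, Complex.exp ((θ t : ℂ) * Complex.I) =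
      Complex.exp ((θ' t : ℂ) * Complex.I)) : θ b - θ a = θ' b - θ' a := by
  have hpi := Real.pi_pos
  have hint : ∀ t ∈ Set.Icc a b, ∃ m : ℤ, θ t - θ' t = m * (2 * Real.pi) := by
    intro t ht
    obtain ⟨m, hm⟩ := Complex.exp_eq_exp_iff_exists_int.1 (h t ht)
    refine ⟨m, ?_⟩
    have := congrArg Complex.im hm
    simp at this
    linarith
  obtain ⟨m, hm⟩ := hint a ⟨le_rfl, hab⟩
  obtain ⟨m', hm'⟩ := hint b ⟨hab, le_rfl⟩
  have hcont : ContinuousOn (fun t => θ t - θ' t) (Set.Icc a b) := hθ.sub hθ'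
  have hconv := (isPreconnected_Icc.image _ hcont).ordConnected
  -- The difference of the two determinations takes values in `2πℤ`, so its connected image contains
  -- no half-odd multiple of `2π` and is a single point.
  have hno : ∀ k : ℤ, ((k : ℝ) + 1 / 2) * (2 * Real.pi) ∉
      (fun t => θ t - θ' t) '' Set.Icc a b := by
    rintro k ⟨t, ht, he⟩
    obtain ⟨l, hl⟩ := hint t ht
    simp only at he
    rw [hl] at he
    have h1 := mul_right_cancel₀ (by positivity) he
    have h2 : (2 * l : ℤ) = 2 * k + 1 := by
      have : (2 * (l : ℝ)) = 2 * k + 1 := by linarith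
      exact_mod_cast this
    omega
  have ha : m * (2 * Real.pi) ∈ (fun t => θ t - θ' t) '' Set.Icc a b := ⟨a, ⟨le_rfl, hab⟩, hm⟩
  have hb : m' * (2 * Real.pi) ∈ (fun t => θ t - θ' t) '' Set.Icc a b := ⟨b, ⟨hab, le_rfl⟩, hm'⟩
  have hmm : m = m' := by
    rcases lt_trichotomy m m' with hlt | hlt | hlt
    · have h1 : (m : ℝ) + 1 ≤ m' := by exact_mod_cast hlt
      exact absurd (hconv.out ha hb ⟨by nlinarith, by nlinarith⟩) (hno m)
    · exact hlt
    · have h1 : (m' : ℝ) + 1 ≤ m := by exact_mod_cast hlt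
      exact absurd (hconv.out hb ha ⟨by nlinarith, by nlinarith⟩) (hno m')
  rw [hmm] at hm
  linarith

/-- The quotient stays at distance `t / ‖p‖ < 1` from `1`, hence in the right half-plane, where the
principal argument is continuous. -/
theorem re_div_pos {p q : ℂ} (hp : 1 < ‖p‖) (hpq : ‖q - p‖ = 1) {t : ℝ} (h0 : 0 ≤ t)
    (h1 : t ≤ 1) : 0 < (AffineMap.lineMap p q t / p).re := by
  have hp0 : p ≠ 0 := by
    intro h; rw [h, norm_zero] at hp; linarith
  have e : AffineMap.lineMap p q t / p = 1 + (t : ℂ) * ((q - p) / p) := by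
    rw [AffineMap.lineMap_apply]
    simp only [vsub_eq_sub, vadd_eq_add, Complex.real_smul]
    field_simp
    ring
  have h2 : ‖(t : ℂ) * ((q - p) / p)‖ < 1 := by
    rw [norm_mul, norm_div, hpq, Complex.norm_real, Real.norm_of_nonneg h0]
    have : 1 / ‖p‖ < 1 := by rw [div_lt_one (by linarith)]; exact hp
    have h3 : 0 < 1 / ‖p‖ := by positivity
    nlinarith
  have h3 := (abs_lt.1 ((Complex.abs_re_le_norm _).trans_lt h2)).1
  rw [e, Complex.add_re, Complex.one_re]
  linarith

section Winding

variable {x y : ℤ × ℤ} (p : triangular.Walk x y) (f : ℕ → ℤ × ℤ)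

/-- The continuous determination of the argument along a path given by a lift of the path. -/
noncomputable def liftAngle (t : ℝ) : ℝ :=
  angle (f ⌊t⌋₊) + Complex.arg (curve p t / pos (p.getVert ⌊t⌋₊))

variable (hrow : ∀ i ≤ p.length, 1 ≤ (f i).1)
  (hadj : ∀ i < p.length, CovAdj (f i) (f (i + 1)))
  (hproj : ∀ i ≤ p.length, proj (f i) = p.getVert i)
  (hn : ∀ i ≤ p.length, 1 < nsq (f i))

include hproj hn in
theorem one_lt_norm {i : ℕ} (hi : i ≤ p.length) : 1 < ‖pos (p.getVert i)‖ := by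
  rw [← hproj i hi]
  have h1 := norm_pos_sq (proj (f i))
  rw [form_proj] at h1
  have h2 : (1 : ℝ) < (nsq (f i) : ℝ) := by exact_mod_cast hn i hi
  rw [← h1] at h2
  exact (one_lt_sq_iff₀ (norm_nonneg _)).1 h2

theorem norm_sub_getVert {i : ℕ} (hi : i < p.length) :
    ‖pos (p.getVert (i + 1)) - pos (p.getVert i)‖ = 1 := by
  rw [norm_sub_rev, ← triangular_adj_iff]
  exact p.adj_getVert_succ hi

theorem curve_of_mem {i : ℕ} {t : ℝ} (h : (i : ℝ) ≤ t) (h' : t < i + 1) :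
    curve p t = AffineMap.lineMap (pos (p.getVert i)) (pos (p.getVert (i + 1))) (t - i) := by
  have : ⌊t⌋₊ = i := by
    rw [Nat.floor_eq_iff (by have := i.cast_nonneg (α := ℝ); linarith)]
    exact ⟨h, h'⟩
  unfold curve
  rw [this]

include hproj hn in
theorem re_curve_div_pos {t : ℝ} (h0 : 0 ≤ t) (ht : t ≤ p.length) :
    0 < (curve p t / pos (p.getVert ⌊t⌋₊)).re := by
  have h1 := Nat.floor_le h0
  have h2 := Nat.lt_floor_add_one t
  have h3 : ⌊t⌋₊ ≤ p.length := Nat.floor_le_of_le ht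
  rw [curve_of_mem p h1 h2]
  rcases h3.lt_or_eq with h3 | h3
  · exact re_div_pos (one_lt_norm p f hproj hn h3.le) (norm_sub_getVert p h3) (by linarith)
      (by linarith)
  · have h4 : t - ⌊t⌋₊ = 0 := by
      rw [h3] at h1 ⊢; linarith
    have h5 : pos (p.getVert ⌊t⌋₊) ≠ 0 := by
      have := one_lt_norm p f hproj hn h3.le
      intro h
      rw [h, norm_zero] at this
      linarith
    rw [h4, AffineMap.lineMap_apply_zero, div_self h5]
    simp

include hproj hn hrow in
theorem curve_eq_liftAngle {t : ℝ} (ht : t ≤ p.length) :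
    curve p t = ‖curve p t‖ * Complex.exp ((liftAngle p f t : ℂ) * Complex.I) := by
  have h3 : ⌊t⌋₊ ≤ p.length := Nat.floor_le_of_le ht
  have h4 := pos_proj (hrow _ h3)
  rw [hproj _ h3] at h4
  have h5 : pos (p.getVert ⌊t⌋₊) ≠ 0 := by
    have := one_lt_norm p f hproj hn h3
    intro h
    rw [h, norm_zero] at this
    linarith
  have h6 := Complex.norm_mul_exp_arg_mul_I (curve p t / pos (p.getVert ⌊t⌋₊))
  have h7 : curve p t = pos (p.getVert ⌊t⌋₊) * (curve p t / pos (p.getVert ⌊t⌋₊)) := by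
    field_simp
  have h8 : ‖curve p t‖ = ‖pos (p.getVert ⌊t⌋₊)‖ * ‖curve p t / pos (p.getVert ⌊t⌋₊)‖ := by
    rw [← norm_mul, ← h7]
  unfold liftAngle
  rw [Complex.ofReal_add, add_mul, Complex.exp_add, h8]
  generalize Complex.arg (curve p t / pos (p.getVert ⌊t⌋₊)) = β at *
  generalize curve p t / pos (p.getVert ⌊t⌋₊) = z at *
  rw [h7]
  conv_lhs => rw [h4, ← h6]
  push_cast
  ring

-- On the `i`-th segment the determination is the angle of `f i` plus a continuous principal
-- argument. The pieces agree at the sites because adjacent lifts differ in angle by less than `π`.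
include hproj hrow hadj hn in
theorem continuousOn_liftAngle : ContinuousOn (liftAngle p f) (Set.Icc 0 p.length) := by
  suffices key : ∀ i ≤ p.length, ContinuousOn (liftAngle p f) (Set.Icc 0 i) from key _ le_rfl
  intro i
  induction i with
  | zero => intro _; simp
  | succ i ih =>
    intro hi
    have hsplit : Set.Icc (0 : ℝ) ((i + 1 : ℕ) : ℝ) = Set.Icc 0 (i : ℝ) ∪ Set.Icc (i : ℝ) (i + 1) := by
      rw [Set.Icc_union_Icc_eq_Icc (by positivity) (by linarith)]
      push_cast; rfl
    rw [hsplit]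
    refine (ih (by omega)).union_of_isClosed ?_ isClosed_Icc isClosed_Icc
    set P := pos (p.getVert i) with hP
    set Q := pos (p.getVert (i + 1)) with hQ
    have hP1 : 1 < ‖P‖ := one_lt_norm p f hproj hn (by omega)
    have hPQ : ‖Q - P‖ = 1 := norm_sub_getVert p hi
    have hQ1 : 1 < ‖Q‖ := one_lt_norm p f hproj hn hi
    have hP0 : P ≠ 0 := by
      intro h; rw [h, norm_zero] at hP1; linarith
    have hQ0 : Q ≠ 0 := by
      intro h; rw [h, norm_zero] at hQ1; linarith
    have heq : Set.EqOn (liftAngle p f)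
        (fun t => angle (f i) + Complex.arg (AffineMap.lineMap P Q (t - i) / P))
        (Set.Icc (i : ℝ) (i + 1)) := by
      rintro t ⟨h1, h2⟩
      rcases h2.lt_or_eq with h2 | h2
      · have hfl : ⌊t⌋₊ = i := by
          rw [Nat.floor_eq_iff (by have := i.cast_nonneg (α := ℝ); linarith)]
          exact ⟨h1, h2⟩
        unfold liftAngle
        rw [curve_of_mem p h1 h2, hfl]
      -- At the right endpoint the integer part already refers to the next site, so the two formulas
      -- have to be compared.
      · have hfl : ⌊t⌋₊ = i + 1 := by
          rw [h2]
          exact_mod_cast Nat.floor_natCast (i + 1)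
        unfold liftAngle
        rw [curve_of_mem p (i := i + 1) (by rw [h2]; push_cast; rfl)
          (by rw [h2]; push_cast; linarith), hfl]
        have e1 : t - ((i + 1 : ℕ) : ℝ) = 0 := by rw [h2]; push_cast; ring
        have e2 : t - (i : ℝ) = 1 := by rw [h2]; ring
        simp only [e1, e2, AffineMap.lineMap_apply_zero, AffineMap.lineMap_apply_one]
        rw [← hQ, div_self hQ0, Complex.arg_one, add_zero]
        have hlt := abs_angle_sub_lt (hrow i (by omega)) (hrow (i + 1) hi) (hadj i (by omega))
        rw [abs_lt] at hlt
        have hP' := pos_proj (hrow i (by omega))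
        have hQ' := pos_proj (hrow (i + 1) hi)
        rw [hproj i (by omega), ← hP] at hP'
        rw [hproj (i + 1) hi, ← hQ] at hQ'
        have hdiv : Q / P = ((‖Q‖ / ‖P‖ : ℝ) : ℂ) *
            Complex.exp (((angle (f (i + 1)) - angle (f i) : ℝ) : ℂ) * Complex.I) := by
          rw [div_eq_iff hP0]
          conv_lhs => rw [hQ']
          conv_rhs => rw [hP']
          have : (‖P‖ : ℂ) ≠ 0 := by simpa using hP0
          have e3 : (‖(‖P‖ : ℂ) * Complex.exp ((angle (f i) : ℂ) * Complex.I)‖ : ℝ) = ‖P‖ := by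
            rw [← hP']
          rw [e3]
          have e4 : Complex.exp ((angle (f (i + 1)) : ℂ) * Complex.I) =
              Complex.exp (((angle (f (i + 1)) - angle (f i) : ℝ) : ℂ) * Complex.I) *
              Complex.exp ((angle (f i) : ℂ) * Complex.I) := by
            rw [← Complex.exp_add]
            congr 1
            push_cast
            ring
          rw [e4]
          push_cast
          field_simp
        have hpos : 0 < ‖Q‖ / ‖P‖ := div_pos (by linarith) (by linarith)
        have hmod : toIocMod Real.two_pi_pos (-Real.pi) (angle (f (i + 1)) - angle (f i)) =
            angle (f (i + 1)) - angle (f i) := by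
          rw [toIocMod_eq_self]
          constructor <;> linarith
        rw [hdiv, Complex.arg_real_mul _ hpos, Complex.arg_exp_mul_I, hmod]
        ring
    refine ContinuousOn.congr ?_ heq
    refine continuousOn_const.add fun t ht => ?_
    refine ContinuousAt.continuousWithinAt ?_
    refine ContinuousAt.comp (g := Complex.arg) (Complex.continuousAt_arg (Or.inl ?_)) ?_
    · exact re_div_pos hP1 hPQ (by linarith [ht.1]) (by linarith [ht.2])
    · refine ContinuousAt.div ?_ continuousAt_const hP0
      exact (AffineMap.lineMap_continuous.comp (continuous_id.sub continuous_const)).continuousAt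

include hproj hrow hadj hn in
/-- The winding angle of a path is the variation of the angle along a lift. -/
theorem isWindingAngle_iff (α : ℝ) :
    IsWindingAngle p α ↔ α = angle (f p.length) - angle (f 0) := by
  have hc := continuousOn_liftAngle p f hrow hadj hproj hn
  have hL : liftAngle p f p.length = angle (f p.length) := by
    have h := one_lt_norm p f hproj hn le_rfl
    unfold liftAngle
    rw [curve_of_mem p (i := p.length) le_rfl (by linarith), Nat.floor_natCast, sub_self,
      AffineMap.lineMap_apply_zero, div_self, Complex.arg_one, add_zero]
    intro h0; rw [h0, norm_zero] at h; linarith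
  have h0 : liftAngle p f 0 = angle (f 0) := by
    have h := one_lt_norm p f hproj hn (Nat.zero_le _)
    unfold liftAngle
    rw [curve_of_mem p (i := 0) (by simp) (by simp), Nat.floor_zero, Nat.cast_zero, sub_self,
      AffineMap.lineMap_apply_zero, div_self, Complex.arg_one, add_zero]
    intro h0; rw [h0, norm_zero] at h; linarith
  constructor
  · rintro ⟨θ, hθ, hθ', rfl⟩
    rw [← hL, ← h0]
    refine sub_eq_sub_of_exp_eq (Nat.cast_nonneg _) hθ hc fun t ht => ?_
    have h1 := hθ' t ht
    have h2 := curve_eq_liftAngle p f hrow hproj hn ht.2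
    have h3 : (‖curve p t‖ : ℂ) ≠ 0 := by
      have := re_curve_div_pos p f hproj hn ht.1 ht.2
      intro h
      have h4 : curve p t = 0 := by simpa using h
      rw [h4, zero_div] at this
      simp at this
    exact mul_left_cancel₀ h3 (h1.symm.trans h2)
  · rintro rfl
    exact ⟨liftAngle p f, hc, fun t ht => curve_eq_liftAngle p f hrow hproj hn ht.2,
      by rw [hL, h0]⟩

end Winding

/-! ### Lifting arms and extending them to crossings. -/

theorem exists_lift_walk {x y : ℤ × ℤ} (p : triangular.Walk x y) (h0 : (0, 0) ∉ p.support)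
    {u : ℤ × ℤ} (hu : 1 ≤ u.1) (hx : proj u = x) :
    ∃ f : ℕ → ℤ × ℤ, f 0 = u ∧ (∀ i, 1 ≤ (f i).1) ∧ (∀ i, proj (f i) = p.getVert i) ∧
      ∀ i < p.length, CovAdj (f i) (f (i + 1)) := by
  induction p generalizing u with
  | nil => exact ⟨fun _ => u, rfl, fun _ => hu, fun i => by simpa using hx, by simp⟩
  | cons h q ih =>
    rw [SimpleGraph.Walk.support_cons, List.mem_cons, not_or] at h0
    subst hx
    obtain ⟨w, hw, hw1, hwx⟩ := exists_lift_adj hu h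
      (fun hy => h0.2 (by rw [← hy]; exact q.start_mem_support))
    obtain ⟨g, hg0, hg1, hg2, hg3⟩ := ih h0.2 hw1 hwx
    refine ⟨fun i => Nat.casesOn i u g, rfl, ?_, ?_, ?_⟩
    · rintro (_ | i)
      · exact hu
      · exact hg1 i
    · rintro (_ | i)
      · simp
      · simpa using hg2 i
    · rintro (_ | i) hi
      · simp only [hg0]; exact hw
      · exact hg3 i (by simpa using hi)

theorem par_eq_zero {v : ℤ × ℤ} (hv : v.1 = 1) : par v = (0, 0) := by
  obtain ⟨k, m⟩ := v
  simp only at hv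
  subst hv
  have : ax (1, m) = m := ax_eq (by simp) (by simp) (by simp)
  simp [par, this]

theorem nsq_par_le_self {v : ℤ × ℤ} (hv : 1 ≤ v.1) : nsq (par v) ≤ nsq v := by
  rcases hv.lt_or_eq with h | h
  · obtain ⟨h1, h2⟩ := off_bounds hv
    have : |off v| * 2 ≤ v.1 := by rcases abs_cases (off v) with ⟨h, _⟩ | ⟨h, _⟩ <;> omega
    rw [nsq_par (by omega)]
    unfold nsq
    nlinarith
  · rw [par_eq_zero h.symm]
    have := nsq_pos hv
    have h0 : nsq (0, 0) = 0 := by simp [nsq, off]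
    omega

theorem nsq_le_child_self {v : ℤ × ℤ} (hv : 1 ≤ v.1) : nsq v ≤ nsq (child v) := by
  obtain ⟨h1, h2⟩ := off_bounds hv
  have : |off v| * 2 ≤ v.1 := by rcases abs_cases (off v) with ⟨h, _⟩ | ⟨h, _⟩ <;> omega
  rw [nsq_child hv]
  unfold nsq
  nlinarith

theorem three_mul_sq_le (v : ℤ × ℤ) : 3 * v.1 ^ 2 ≤ 4 * nsq v := by
  have : 4 * nsq v = (v.1 - 2 * |off v|) ^ 2 + 3 * v.1 ^ 2 := by
    unfold nsq
    nlinarith [sq_abs (off v)]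
  nlinarith [sq_nonneg (v.1 - 2 * |off v|)]

theorem fst_par_iterate (v : ℤ × ℤ) (m : ℕ) : (par^[m] v).1 = v.1 - m := by
  induction m with
  | zero => simp
  | succ m ih =>
    rw [Function.iterate_succ_apply']
    simp only [par]
    rw [ih]
    push_cast
    ring

theorem fst_child_iterate (v : ℤ × ℤ) (m : ℕ) : (child^[m] v).1 = v.1 + m := by
  induction m with
  | zero => simp
  | succ m ih =>
    rw [Function.iterate_succ_apply']
    simp only [child]
    rw [ih]
    push_cast
    ring

theorem InnerBd.nsq_iterate {A : ℤ} {s : ℤ × ℤ} (hs : InnerBd A s) {m : ℕ} (hm : 1 ≤ m)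
    (hm' : (m : ℤ) ≤ s.1) : nsq (par^[m] s) ≤ A := by
  induction m, hm using Nat.le_induction with
  | base => exact hs.2.2
  | succ m hm ih =>
    push_cast at hm'
    rw [Function.iterate_succ_apply']
    exact (nsq_par_le_self (by rw [fst_par_iterate]; omega)).trans (ih (by omega))

theorem OuterBd.nsq_iterate {B : ℤ} {e : ℤ × ℤ} (he : OuterBd B e) {m : ℕ} (hm : 1 ≤ m) :
    B < nsq (child^[m] e) := by
  induction m, hm using Nat.le_induction with
  | base => exact he.2.2
  | succ m hm ih =>
    rw [Function.iterate_succ_apply']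
    have := he.1
    exact ih.trans_le (nsq_le_child_self (by rw [fst_child_iterate]; omega))

/-- A path across an annulus in the cover extends to a crossing. -/
theorem exists_crossing {A B K : ℤ} {f : ℕ → ℤ × ℤ} {n : ℕ}
    (hK : ∀ v : ℤ × ℤ, nsq v ≤ B → v.1 < K)
    (hrow : ∀ i ≤ n, 1 ≤ (f i).1) (hadj : ∀ i < n, CovAdj (f i) (f (i + 1)))
    (hinj : ∀ i ≤ n, ∀ l ≤ n, f i = f l → i = l) (hann : ∀ i ≤ n, A < nsq (f i) ∧ nsq (f i) ≤ B)
    (hs : InnerBd A (f 0)) (he : OuterBd B (f n)) :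
    ∃ C : Crossing A B K, C.b = C.a + n ∧ ∀ i ≤ n, C.p (C.a + i) = f i := by
  obtain ⟨a, ha⟩ : ∃ a : ℕ, (a : ℤ) = (f 0).1 := ⟨(f 0).1.toNat, by have := hs.1; omega⟩
  have h2a : 2 ≤ a := by have := hs.1; omega
  have heK := hK _ (hann n le_rfl).2
  obtain ⟨t, ht⟩ : ∃ t : ℕ, (t : ℤ) = K - (f n).1 := ⟨(K - (f n).1).toNat, by omega⟩
  have ht1 : 1 ≤ t := by omega
  -- Ancestors of the first site, the given path, then descendants of the last site up to ring `K`.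
  -- The three pieces are told apart by the distance to the origin.
  let p : ℕ → ℤ × ℤ := fun i => if i < a then par^[a - i] (f 0) else
    if i ≤ a + n then f (i - a) else child^[i - (a + n)] (f n)
  have p_low : ∀ i ≤ a, p i = par^[a - i] (f 0) := by
    intro i hi
    rcases hi.lt_or_eq with h | rfl
    · simp only [p, if_pos h]
    · simp [p]
  have p_mid : ∀ i ≤ n, p (a + i) = f i := by
    intro i hi
    simp [p, hi]
  have p_high : ∀ i, p (a + n + i) = child^[i] (f n) := by
    intro i
    rcases Nat.eq_zero_or_pos i with rfl | h
    · simpa using p_mid n le_rfl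
    · have h1 : ¬ a + n + i < a := by omega
      have h2 : ¬ a + n + i ≤ a + n := by omega
      simp only [p, if_neg h1, if_neg h2]
      congr 2
      omega
  have region : ∀ i, (i < a ∧ nsq (p i) ≤ A ∧ (p i).1 = i) ∨
      (∃ l ≤ n, i = a + l) ∨
      (a + n < i ∧ B < nsq (p i) ∧ (p i).1 = (f n).1 + (i - (a + n) : ℕ)) := by
    intro i
    rcases lt_or_ge i a with h | h
    · refine Or.inl ⟨h, ?_, ?_⟩
      · rw [p_low i h.le]
        exact hs.nsq_iterate (by omega) (by omega)
      · rw [p_low i h.le, fst_par_iterate]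
        omega
    · rcases le_or_gt i (a + n) with h' | h'
      · exact Or.inr (Or.inl ⟨i - a, by omega, by omega⟩)
      · obtain ⟨l, rfl⟩ : ∃ l, i = a + n + l := ⟨i - (a + n), by omega⟩
        refine Or.inr (Or.inr ⟨h', ?_, ?_⟩)
        · rw [p_high]
          exact he.nsq_iterate (by omega)
        · rw [p_high, fst_child_iterate]
          omega
  have low : ∀ i < a, p i = par (p (i + 1)) := by
    intro i hi
    rw [p_low i hi.le, p_low (i + 1) hi, ← Function.iterate_succ_apply' par]
    congr 2
    omega
  have high : ∀ i, a + n ≤ i → p (i + 1) = child (p i) := by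
    intro i hi
    obtain ⟨l, rfl⟩ : ∃ l, i = a + n + l := ⟨i - (a + n), by omega⟩
    rw [add_assoc, p_high, p_high, Function.iterate_succ_apply']
  have pos : ∀ i, 0 < i → 1 ≤ (p i).1 := by
    intro i hi
    rcases region i with ⟨_, _, h⟩ | ⟨l, hl, rfl⟩ | ⟨_, _, h⟩
    · omega
    · rw [p_mid l hl]; exact hrow l hl
    · have := he.1; omega
  refine ⟨{ p := p, L := a + n + t, a := a, b := a + n, a_pos := h2a, hab := by omega,
            hbL := by omega, low := low, high := fun i hi _ => high i hi,
            inside := ?_, annular := ?_, outside := ?_, adj := ?_, inj := ?_, zero := ?_,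
            top := ?_, lt_top := ?_, pos := fun i hi _ => pos i hi }, rfl, p_mid⟩
  rotate_left 5
  · intro i hi
    rcases region i with h | ⟨l, hl, rfl⟩ | h
    · exact h.2.1
    all_goals omega
  · intro i h1 h2
    obtain ⟨l, rfl⟩ : ∃ l, i = a + l := ⟨i - a, by omega⟩
    rw [p_mid l (by omega)]
    exact hann l (by omega)
  · intro i hi _
    rcases region i with h | ⟨l, hl, rfl⟩ | h
    · omega
    · omega
    · exact h.2.1
  · intro i hi
    rcases lt_or_ge i a with h | h
    · rw [low i h]
      exact Or.inl (up_par (pos _ (by omega)))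
    · rcases lt_or_ge i (a + n) with h' | h'
      · obtain ⟨l, rfl⟩ : ∃ l, i = a + l := ⟨i - a, by omega⟩
        rw [add_assoc, p_mid l (by omega), p_mid (l + 1) (by omega)]
        exact hadj l (by omega)
      · rw [high i h']
        exact Or.inl (up_child (pos _ (by omega)))
  · intro i _ l _ h
    have hAB := hann 0 (by omega)
    rcases region i with ⟨i1, i2, i3⟩ | ⟨i', hi', rfl⟩ | ⟨i1, i2, i3⟩ <;>
      rcases region l with ⟨l1, l2, l3⟩ | ⟨l', hl', rfl⟩ | ⟨l1, l2, l3⟩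
    · rw [h] at i3; omega
    · rw [h, p_mid l' hl'] at i2
      have := hann l' hl'; omega
    · rw [h] at i2; omega
    · rw [← h, p_mid i' hi'] at l2
      have := hann i' hi'; omega
    · rw [p_mid i' hi', p_mid l' hl'] at h
      rw [hinj i' hi' l' hl' h]
    · rw [← h, p_mid i' hi'] at l2
      have := hann i' hi'; omega
    · rw [h] at i2; omega
    · rw [h, p_mid l' hl'] at i2
      have := hann l' hl'; omega
    · rw [h] at i3; omega
  · have h1 := low 0 (by omega)
    have h2 := p_low 1 (by omega)
    rw [h1]
    refine par_eq_zero ?_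
    rw [h2, fst_par_iterate]
    omega
  · rw [p_high, fst_child_iterate]
    omega
  · intro i hi
    rcases region i with ⟨i1, i2, i3⟩ | ⟨l, hl, rfl⟩ | ⟨i1, i2, i3⟩
    · have := hK _ (hann 0 (by omega)).2
      omega
    · rw [p_mid l hl]
      exact hK _ (hann l hl).2
    · omega

theorem turn_apex (c : ℤ) : turn c (0, 0) = (0, 0) := by simp [turn]

namespace Crossing

variable {A B K : ℤ}

/-- The image of a crossing under a deck transformation of the cover. -/
def turn (c : ℤ) (C : Crossing A B K) : Crossing A B K where
  p i := Percolation.turn c (C.p i)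
  L := C.L
  adj i hi := (covAdj_turn c).2 (C.adj i hi)
  inj i hi l hl h := C.inj i hi l hl (turn_injective c h)
  zero := by rw [C.zero, turn_apex]
  top := C.top
  lt_top := C.lt_top
  pos := C.pos
  a := C.a
  b := C.b
  a_pos := C.a_pos
  hab := C.hab
  hbL := C.hbL
  low i hi := by
    rw [C.low i hi, par_turn]
    exact C.pos _ (by omega) (by have := C.hab; have := C.hbL; omega)
  high i hi hL := by
    rw [C.high i hi hL, child_turn]
    exact C.pos _ (by have := C.hab; have := C.a_pos; omega) hL.le
  inside i hi := by
    rcases Nat.eq_zero_or_pos i with rfl | h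
    · have := C.inside 0 hi
      rwa [C.zero, turn_apex, ← C.zero]
    · rw [nsq_turn (C.pos i h (by have := C.hab; have := C.hbL; omega))]
      exact C.inside i hi
  annular i h1 h2 := by
    rw [nsq_turn (C.pos i (by have := C.a_pos; omega) (by have := C.hbL; omega))]
    exact C.annular i h1 h2
  outside i h1 h2 := by
    rw [nsq_turn (C.pos i (by omega) h2)]
    exact C.outside i h1 h2

theorem turn_p (c : ℤ) (C : Crossing A B K) (i : ℕ) :
    (C.turn c).p i = Percolation.turn c (C.p i) := rfl

theorem turn_add (c c' : ℤ) (C : Crossing A B K) : C.turn (c + c') = (C.turn c').turn c := by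
  simp only [turn, turn_turn]

theorem ht_turn (c : ℤ) (C : Crossing A B K) (k q : ℤ) :
    (C.turn c).ht k (q + (12 * k + 6) * c) = C.ht k q := by
  have key : ∀ u v : ℤ × ℤ, upInd k (q + (12 * k + 6) * c) (Percolation.turn c u)
      (Percolation.turn c v) = upInd k q u v := by
    intro u v
    unfold upInd
    refine if_congr ?_ rfl rfl
    rw [up_turn]
    refine and_congr_right fun h => and_congr_right fun hk => ?_
    have h1 := h.2.1
    simp only [Percolation.turn] at hk ⊢
    rw [h1, hk]
    constructor <;> intro h <;> linarith
  unfold RingPath.ht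
  refine Finset.sum_congr rfl fun i _ => ?_
  simp only [turn, key]

theorem bd_env_turn (c : ℤ) (C D : Crossing A B K) (u v : ℤ × ℤ) :
    bd (env (C.turn c) (D.turn c)) (Percolation.turn c u) (Percolation.turn c v) =
      bd (env C D) u v :=
  bd_turn (fun k q => by unfold env; rw [ht_turn, ht_turn]) u v

end Crossing

theorem pos_ne_zero_of_not_mem_ball {v : ℤ × ℤ} {n : ℕ} (h : v ∉ ball n) : v ≠ (0, 0) := by
  rintro rfl
  exact h (by rw [mem_ball_iff]; simp [form])

/-- Ring and distance are comparable: `3k² ≤ 4N²`. The value `2N + 2` is a convenient ring beyond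
the outer ball. -/
theorem lt_of_nsq_le {N : ℕ} (v : ℤ × ℤ) (h : nsq v ≤ (N : ℤ) ^ 2) : v.1 < 2 * N + 2 := by
  have := three_mul_sq_le v
  by_contra! hc
  nlinarith

theorem mem_annulus_iff {v : ℤ × ℤ} {n N : ℕ} :
    v ∈ annulus n N ↔ (n : ℤ) ^ 2 < form v ∧ form v ≤ (N : ℤ) ^ 2 := by
  rw [annulus, Set.mem_sdiff, mem_ball_iff, mem_ball_iff, not_le]
  exact and_comm

theorem innerBd_of_mem {s : ℤ × ℤ} {n : ℕ} (hn : 1 ≤ n) (hs : 1 ≤ s.1)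
    (h : proj s ∈ externalBoundary n) : InnerBd ((n : ℤ) ^ 2) s := by
  obtain ⟨h1, u, hu, hu'⟩ := h
  rw [mem_ball_iff, form_proj, not_le] at h1
  rw [mem_ball_iff] at hu'
  -- The sites of ring `1` are at distance one, inside the ball as `n ≥ 1`.
  have h2 : 2 ≤ s.1 := by
    by_contra! hc
    obtain ⟨b1, b2⟩ := off_bounds hs
    have h3 : s.1 = 1 := by omega
    have h4 : off s = 0 := by omega
    have : nsq s = 1 := by simp [nsq, h3, h4]
    have : (1 : ℤ) ≤ n := by exact_mod_cast hn
    nlinarith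
  exact ⟨h2, h1, (nsq_par_le h2 hu).trans hu'⟩

theorem outerBd_of_mem {e : ℤ × ℤ} {N : ℕ} (he : 1 ≤ e.1)
    (h : proj e ∈ internalBoundary N) : OuterBd ((N : ℤ) ^ 2) e := by
  obtain ⟨h1, u, hu, hu'⟩ := h
  rw [mem_ball_iff, form_proj] at h1
  rw [mem_ball_iff, not_le] at hu'
  exact ⟨he, h1, hu'.trans_le (le_nsq_child he hu)⟩

/-- An arm lifts to a crossing, starting at any given determination of its initial argument. -/
theorem Arm.exists_crossing {ω : ℤ × ℤ → Color} {c : Color} {n N : ℕ} (hn : 1 ≤ n)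
    (γ : Arm ω c n N) {θ : ℝ}
    (hθ : pos γ.start = ‖pos γ.start‖ * Complex.exp ((θ : ℂ) * Complex.I)) :
    ∃ C : Crossing ((n : ℤ) ^ 2) ((N : ℤ) ^ 2) (2 * N + 2), angle (C.p C.a) = θ ∧
      C.b = C.a + γ.path.length ∧ ∀ i ≤ γ.path.length, proj (C.p (C.a + i)) = γ.path.getVert i := by
  obtain ⟨u, hu, hx, hθu⟩ := exists_lift_angle
    (pos_ne_zero_of_not_mem_ball (γ.mem_annulus _ γ.path.start_mem_support).2) hθ
  obtain ⟨f, hf0, hf1, hf2, hf3⟩ := exists_lift_walk γ.path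
    (fun h => pos_ne_zero_of_not_mem_ball (γ.mem_annulus _ h).2 rfl) hu hx
  have hend : proj (f γ.path.length) = γ.finish := by rw [hf2, SimpleGraph.Walk.getVert_length]
  obtain ⟨C, hC1, hC2⟩ := Percolation.exists_crossing (A := (n : ℤ) ^ 2) (B := (N : ℤ) ^ 2)
    (K := 2 * N + 2) (f := f) (n := γ.path.length) lt_of_nsq_le (fun i _ => hf1 i) hf3
    (fun i hi l hl h => γ.isPath.getVert_injOn hi hl (by rw [← hf2, ← hf2, h]))
    (fun i _ => by
      rw [← form_proj, hf2]
      exact mem_annulus_iff.1 (γ.mem_annulus _ (γ.path.getVert_mem_support i)))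
    (innerBd_of_mem hn (hf1 0) (by rw [hf0, hx]; exact γ.start_mem))
    (outerBd_of_mem (hf1 _) (by rw [hend]; exact γ.finish_mem))
  refine ⟨C, ?_, hC1, fun i hi => by rw [hC2 i hi, hf2]⟩
  have := hC2 0 (Nat.zero_le _)
  rw [add_zero] at this
  rw [this, hf0, hθu]

/-! ### Periodic families of lifted arms. -/

/-- The lifts to the cover of the arms of a configuration, in counterclockwise order. -/
structure ArmFamily (ω : ℤ × ℤ → Color) (c : Color) (n N j : ℕ) where
  C : ℤ → Crossing ((n : ℤ) ^ 2) ((N : ℤ) ^ 2) (2 * N + 2)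
  shift : ∀ i t : ℤ, C (i + j * t) = (C i).turn t
  start_mono : StrictMono fun i => angle ((C i).p (C i).a)
  disj : ∀ i l, i ≠ l → (C i).Disj (C l)
  color : ∀ i m, (C i).a ≤ m → m ≤ (C i).b → ω (proj ((C i).p m)) = c
  start_mem : ∀ i, proj ((C i).p (C i).a) ∈ externalBoundary n
  finish_mem : ∀ i, proj ((C i).p (C i).b) ∈ internalBoundary N

/-- Each arm is lifted from the argument of its start provided by the cyclic order, and the `j`
lifts are then repeated by full turns: index `i` is arm `i % j` turned `i / j` times. -/
theorem ArmConfiguration.exists_family {ω : ℤ × ℤ → Color} {c : Color} {n N j : ℕ} (hj : 1 ≤ j)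
    (hn : 1 ≤ n) (r : ArmConfiguration ω (fun _ : Fin j => c) n N) (i₀ : Fin j) {α : ℝ}
    (hα : IsWindingAngle (r.arm i₀).path α) :
    ∃ Γ : ArmFamily ω c n N j, α = angle ((Γ.C (i₀ : ℕ)).p (Γ.C (i₀ : ℕ)).b) -
      angle ((Γ.C (i₀ : ℕ)).p (Γ.C (i₀ : ℕ)).a) := by
  obtain ⟨θ, hθ1, hθ2, hθ3⟩ := r.ordered
  choose D hD1 hD2 hD3 using fun i => (r.arm i).exists_crossing hn (hθ3 i)
  have hj0 : (0 : ℤ) < j := by exact_mod_cast hj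
  let idx : ℤ → Fin j := fun i => ⟨(i % j).toNat, by
    have := Int.emod_nonneg i hj0.ne'
    have := Int.emod_lt_of_pos i hj0
    omega⟩
  have idx_val : ∀ i, ((idx i : ℕ) : ℤ) = i % j := fun i =>
    Int.toNat_of_nonneg (Int.emod_nonneg i hj0.ne')
  have idx_coe : ∀ i : Fin j, idx ((i : ℕ) : ℤ) = i := fun i => by
    ext
    have := idx_val ((i : ℕ) : ℤ)
    rw [Int.emod_eq_of_lt (by positivity) (by exact_mod_cast i.2)] at this
    exact_mod_cast this
  have row : ∀ i m, (D i).a ≤ m → m ≤ (D i).b → 1 ≤ ((D i).p m).1 := fun i m h h' =>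
    ((D i).annular_p h h').1
  have vert : ∀ i m, (D i).a ≤ m → m ≤ (D i).b → ∃ l ≤ (r.arm i).path.length, m = (D i).a + l ∧
      proj ((D i).p m) = (r.arm i).path.getVert l := by
    intro i m h h'
    rw [hD2] at h'
    obtain ⟨l, rfl⟩ : ∃ l, m = (D i).a + l := ⟨m - (D i).a, by omega⟩
    exact ⟨l, by omega, rfl, hD3 i l (by omega)⟩
  let C : ℤ → Crossing ((n : ℤ) ^ 2) ((N : ℤ) ^ 2) (2 * N + 2) :=
    fun i => (D (idx i)).turn (i / j)
  have hC : ∀ i m, (D (idx i)).a ≤ m → m ≤ (D (idx i)).b →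
      proj ((C i).p m) = proj ((D (idx i)).p m) := fun i m h h' =>
    proj_turn (row _ m h h') _
  have startC : ∀ i, angle ((C i).p (C i).a) = θ (idx i) + 2 * Real.pi * ((i / j : ℤ) : ℝ) := by
    intro i
    rw [← hD1]
    exact angle_turn (row _ _ le_rfl (D (idx i)).hab) _
  refine ⟨{ C := C, shift := ?_, start_mono := ?_, disj := ?_, color := ?_, start_mem := ?_,
            finish_mem := ?_ }, ?_⟩
  · intro i t
    have h1 : idx (i + j * t) = idx i := by
      ext
      have := idx_val (i + j * t)
      rw [Int.add_mul_emod_self_left, ← idx_val] at this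
      exact_mod_cast this
    simp only [C]
    rw [h1, Int.add_mul_ediv_left _ _ hj0.ne', add_comm (i / j) t, Crossing.turn_add]
  · intro i l hil
    simp only [startC]
    have e1 := Int.mul_ediv_add_emod i j
    have e2 := Int.mul_ediv_add_emod l j
    -- Lifts in different turns are ordered because the `θ i` spread over less than `2π`, lifts in
    -- the same turn because `θ` is strictly increasing.
    rcases (Int.ediv_le_ediv hj0 hil.le).lt_or_eq with h | h
    · have h1 := hθ2 (idx l) (idx i)
      have h2 : ((i / j : ℤ) : ℝ) + 1 ≤ ((l / j : ℤ) : ℝ) := by exact_mod_cast h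
      have := Real.pi_pos
      nlinarith
    · have h1 : idx i < idx l := by
        rw [Fin.lt_def]
        have a1 := idx_val i
        have a2 := idx_val l
        rw [h] at e1
        omega
      rw [h]
      linarith [hθ1 h1]
  · intro i l hil m h1 h2 m' h3 h4 he
    obtain ⟨x, hx, hmx, ex⟩ := vert (idx i) m h1 h2
    obtain ⟨y, hy, hmy, ey⟩ := vert (idx l) m' h3 h4
    have e := congrArg proj he
    rw [hC i m h1 h2, hC l m' h3 h4, ex, ey] at e
    -- Two lifts of one arm can meet only at the same index, the arm being self-avoiding; there they
    -- differ by a nontrivial turn, which changes the angle.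
    by_cases hidx : idx i = idx l
    · have hdiv : i / j ≠ l / j := by
        intro h
        apply hil
        rw [← Int.mul_ediv_add_emod i j, ← Int.mul_ediv_add_emod l j, h, ← idx_val, ← idx_val, hidx]
      have hl : (D (idx l)).turn (l / j) = (D (idx i)).turn (l / j) := by rw [hidx]
      have e' : (r.arm (idx i)).path.getVert x = (r.arm (idx i)).path.getVert y := by
        rw [e, hidx]
      have hxy : x = y := (r.arm (idx i)).isPath.getVert_injOn hx (by
        show y ≤ _
        rwa [hidx]) e'
      have hmm : m' = m := by rw [hmx, hmy, hxy, hidx]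
      simp only [C] at he
      rw [hl, Crossing.turn_p, Crossing.turn_p, hmm] at he
      have h5 := row (idx i) m h1 h2
      have h6 := congrArg angle he
      rw [angle_turn h5, angle_turn h5] at h6
      apply hdiv
      have := Real.pi_pos
      have h7 : ((i / j : ℤ) : ℝ) = ((l / j : ℤ) : ℝ) := by
        have h8 : 2 * Real.pi * ((i / j : ℤ) : ℝ) = 2 * Real.pi * ((l / j : ℤ) : ℝ) := by linarith
        exact mul_left_cancel₀ (by positivity) h8
      exact_mod_cast h7
    · exact r.disjoint _ _ hidx _ ((r.arm (idx i)).path.getVert_mem_support x)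
        (by rw [e]; exact (r.arm (idx l)).path.getVert_mem_support y)
  · intro i m h1 h2
    obtain ⟨x, hx, hmx, ex⟩ := vert (idx i) m h1 h2
    rw [hC i m h1 h2, ex]
    exact (r.arm (idx i)).color_eq _ ((r.arm (idx i)).path.getVert_mem_support x)
  · intro i
    have h := hD3 (idx i) 0 (Nat.zero_le _)
    rw [add_zero, SimpleGraph.Walk.getVert_zero] at h
    have h' := hC i (D (idx i)).a le_rfl (D (idx i)).hab
    rw [h] at h'
    exact h' ▸ (r.arm (idx i)).start_mem
  · intro i
    have h := hD3 (idx i) _ le_rfl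
    rw [← hD2, SimpleGraph.Walk.getVert_length] at h
    have h' := hC i (D (idx i)).b (D (idx i)).hab le_rfl
    rw [h] at h'
    exact h' ▸ (r.arm (idx i)).finish_mem
  · have h0 : ((i₀ : ℕ) : ℤ) / j = 0 :=
      Int.ediv_eq_zero_of_lt (by positivity) (by exact_mod_cast i₀.2)
    have hC0 : C ((i₀ : ℕ) : ℤ) = (D i₀).turn 0 := by simp only [C]; rw [h0, idx_coe]
    simp only [hC0]
    have hw := isWindingAngle_iff (r.arm i₀).path (fun i => (D i₀).p ((D i₀).a + i))
      (fun i hi => row i₀ _ (by omega) (by rw [hD2]; omega))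
      (fun i hi => (D i₀).adj _ (by have := (D i₀).hbL; rw [hD2] at this; omega))
      (fun i hi => hD3 i₀ i hi) (fun i hi => by
        have := ((D i₀).annular ((D i₀).a + i) (by omega) (by rw [hD2]; omega)).1
        have : (1 : ℤ) ≤ n := by exact_mod_cast hn
        nlinarith) α
    rw [hw, ← hD2, add_zero] at hα
    rw [hα]
    show _ = angle (turn 0 _) - angle (turn 0 _)
    rw [turn_zero, turn_zero]
    rfl

/-! ### Envelopes of two families as arm configurations. -/

theorem angle_firstOf {u v : ℤ × ℤ} (hu : 1 ≤ u.1) (hv : 1 ≤ v.1) :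
    angle (Crossing.firstOf u v) = min (angle u) (angle v) := by
  unfold Crossing.firstOf
  split_ifs with h
  · exact (min_eq_right ((angleLt_iff hv hu).1 h).le).symm
  · rw [angleLt_iff hv hu, not_lt] at h
    exact (min_eq_left h).symm

theorem Crossing.annular_of_reachable {A B K : ℤ} (C D : Crossing A B K) {v : ℤ × ℤ}
    (h : (envGraph C D).Reachable (Crossing.firstOf (C.p C.a) (D.p D.a)) v) : Annular A B K v := by
  obtain ⟨q⟩ := h.symm
  cases q with
  | nil =>
    rcases start_cases C D with ⟨h1, _⟩ | ⟨h1, _⟩ <;> rw [h1]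
    · exact C.annular_p le_rfl C.hab
    · exact D.annular_p le_rfl D.hab
  | cons h _ => exact h.2.1

namespace ArmFamily

variable {ω : ℤ × ℤ → Color} {c : Color} {n N j : ℕ} (Γ Δ : ArmFamily ω c n N j)

/-- The initial angle of a lifted arm. -/
noncomputable def startAngle (i : ℤ) : ℝ := angle ((Γ.C i).p (Γ.C i).a)

/-- The final angle of a lifted arm. -/
noncomputable def endAngle (i : ℤ) : ℝ := angle ((Γ.C i).p (Γ.C i).b)

theorem row_start (i : ℤ) : 1 ≤ ((Γ.C i).p (Γ.C i).a).1 :=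
  ((Γ.C i).annular_p le_rfl (Γ.C i).hab).1

theorem row_end (i : ℤ) : 1 ≤ ((Γ.C i).p (Γ.C i).b).1 :=
  ((Γ.C i).annular_p (Γ.C i).hab le_rfl).1

theorem angleLt_start {i l : ℤ} (h : i < l) :
    AngleLt ((Γ.C i).p (Γ.C i).a) ((Γ.C l).p (Γ.C l).a) :=
  (angleLt_iff (Γ.row_start i) (Γ.row_start l)).2 (Γ.start_mono h)

theorem startAngle_strictMono : StrictMono Γ.startAngle := Γ.start_mono

theorem endAngle_strictMono : StrictMono Γ.endAngle := fun i l h =>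
  (angleLt_iff (Γ.row_end i) (Γ.row_end l)).1 ((Γ.disj i l h.ne).angleLt_end (Γ.angleLt_start h))

theorem startAngle_shift (i t : ℤ) :
    Γ.startAngle (i + j * t) = Γ.startAngle i + 2 * Real.pi * t := by
  unfold startAngle
  rw [Γ.shift]
  exact angle_turn (Γ.row_start i) t

theorem endAngle_shift (i t : ℤ) :
    Γ.endAngle (i + j * t) = Γ.endAngle i + 2 * Real.pi * t := by
  unfold endAngle
  rw [Γ.shift]
  exact angle_turn (Γ.row_end i) t

theorem not_bd_env {k i l : ℤ} (hil : i ≠ l) {v w w' : ℤ × ℤ}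
    (hv : Crossing.Annular ((n : ℤ) ^ 2) ((N : ℤ) ^ 2) (2 * N + 2) v)
    (h : bd (Crossing.env (Γ.C i) (Δ.C (i + k))) v w ≠ 0)
    (h' : bd (Crossing.env (Γ.C l) (Δ.C (l + k))) v w' ≠ 0) : False := by
  have key : ∀ {i l : ℤ} {w w' : ℤ × ℤ}, i < l →
      bd (Crossing.env (Γ.C i) (Δ.C (i + k))) v w ≠ 0 →
      bd (Crossing.env (Γ.C l) (Δ.C (l + k))) v w' ≠ 0 → False := fun hil h h' =>
    Crossing.not_bd_env (Γ.disj _ _ hil.ne) (Γ.angleLt_start hil) (Δ.disj _ _ (by omega))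
      (Δ.angleLt_start (by omega)) hv h h'
  rcases hil.lt_or_gt with h1 | h1
  · exact key h1 h h'
  · exact key h1 h' h

/-- Both properties needed after projection come from here: for `l = i` it gives `t = 0`, so an
envelope projects injectively; for distinct `i` and `l` between `0` and `j - 1` it is impossible, so
the projected arms are disjoint. -/
theorem eq_turn {k i l : ℤ} {u v w w' : ℤ × ℤ}
    (hu : Crossing.Annular ((n : ℤ) ^ 2) ((N : ℤ) ^ 2) (2 * N + 2) u)
    (hv : Crossing.Annular ((n : ℤ) ^ 2) ((N : ℤ) ^ 2) (2 * N + 2) v)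
    (h : bd (Crossing.env (Γ.C i) (Δ.C (i + k))) u w ≠ 0)
    (h' : bd (Crossing.env (Γ.C l) (Δ.C (l + k))) v w' ≠ 0) (he : proj u = proj v) :
    ∃ t, v = turn t u ∧ l = i + j * t := by
  obtain ⟨t, rfl⟩ := eq_turn_of_proj_eq hu.1 hv.1 he
  refine ⟨t, rfl, ?_⟩
  by_contra hl
  refine Γ.not_bd_env Δ (k := k) (Ne.symm hl) hv (w := turn t w) ?_ h'
  rw [add_right_comm, Γ.shift, Δ.shift, Crossing.bd_env_turn]
  exact h

/-- Two families, the second one shifted by `k`, have a common lower envelope, which is the family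
of the lifts of the arms of a configuration. -/
theorem exists_configuration (hj : 1 ≤ j) (hn : 1 ≤ n) (k : ℤ) :
    ∃ r : ArmConfiguration ω (fun _ : Fin j => c) n N, ∀ i : Fin j,
      IsWindingAngle (r.arm i).path
        (min (Γ.endAngle (i : ℕ)) (Δ.endAngle ((i : ℕ) + k)) -
          min (Γ.startAngle (i : ℕ)) (Δ.startAngle ((i : ℕ) + k))) := by
  have hq : ∀ i : Fin j, ∃ q : (Crossing.envGraph (Γ.C (i : ℕ)) (Δ.C ((i : ℕ) + k))).Walk _ _,
      q.IsPath := fun i =>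
    (Crossing.reachable_env (Γ.C (i : ℕ)) (Δ.C ((i : ℕ) + k))).exists_isPath
  choose q hq using hq
  have reach : ∀ i, ∀ v ∈ (q i).support,
      (Crossing.envGraph (Γ.C (i : ℕ)) (Δ.C ((i : ℕ) + k))).Reachable
        (Crossing.firstOf ((Γ.C (i : ℕ)).p (Γ.C (i : ℕ)).a)
          ((Δ.C ((i : ℕ) + k)).p (Δ.C ((i : ℕ) + k)).a)) v := by
    classical
    exact fun i v hv => ⟨(q i).takeUntil v hv⟩
  have ann : ∀ i, ∀ v ∈ (q i).support,
      Crossing.Annular ((n : ℤ) ^ 2) ((N : ℤ) ^ 2) (2 * N + 2) v := fun i v hv =>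
    Crossing.annular_of_reachable _ _ (reach i v hv)
  have bdv : ∀ i, ∀ v ∈ (q i).support, ∃ w,
      bd (Crossing.env (Γ.C (i : ℕ)) (Δ.C ((i : ℕ) + k))) v w ≠ 0 := fun i v hv =>
    Crossing.exists_bd_of_reachable _ _ (reach i v hv)
  let φ : ∀ i : Fin j, Crossing.envGraph (Γ.C (i : ℕ)) (Δ.C ((i : ℕ) + k)) →g triangular :=
    fun i => ⟨proj, fun h => adj_proj h.2.1.1 h.2.2.1 (covAdj_of_bd_ne_zero h.1)⟩
  have mem : ∀ i, ∀ x ∈ ((q i).map (φ i)).support, ∃ v ∈ (q i).support, proj v = x := by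
    intro i x hx
    rw [SimpleGraph.Walk.support_map, List.mem_map] at hx
    exact hx
  let γ : Fin j → Arm ω c n N := fun i =>
    { start := _
      finish := _
      path := (q i).map (φ i)
      isPath := by
        rw [SimpleGraph.Walk.isPath_def, SimpleGraph.Walk.support_map]
        refine List.Nodup.map_on ?_ ((SimpleGraph.Walk.isPath_def _).1 (hq i))
        intro u hu v hv he
        obtain ⟨w, hw⟩ := bdv i u hu
        obtain ⟨w', hw'⟩ := bdv i v hv
        obtain ⟨t, rfl, ht⟩ := Γ.eq_turn Δ (ann i u hu) (ann i v hv) hw hw' he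
        have hj0 : (0 : ℤ) < j := by exact_mod_cast hj
        have : t = 0 := by
          rcases mul_eq_zero.1 (by omega : (j : ℤ) * t = 0) with h | h <;> omega
        rw [this, turn_zero]
      start_mem := by
        show proj _ ∈ _
        rcases Crossing.start_cases (Γ.C (i : ℕ)) (Δ.C ((i : ℕ) + k)) with ⟨h, _⟩ | ⟨h, _⟩ <;>
          rw [h]
        · exact Γ.start_mem _
        · exact Δ.start_mem _
      finish_mem := by
        show proj _ ∈ _
        rcases Crossing.end_cases (Γ.C (i : ℕ)) (Δ.C ((i : ℕ) + k)) with ⟨h, _⟩ | ⟨h, _⟩ <;>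
          rw [h]
        · exact Γ.finish_mem _
        · exact Δ.finish_mem _
      mem_annulus := fun x hx => by
        obtain ⟨v, hv, rfl⟩ := mem i x hx
        rw [mem_annulus_iff, form_proj]
        exact (ann i v hv).2.2
      color_eq := fun x hx => by
        obtain ⟨v, hv, rfl⟩ := mem i x hx
        obtain ⟨w, hw⟩ := bdv i v hv
        rcases Crossing.mem_of_bd_env (ann i v hv) hw with ⟨m, h1, h2, rfl⟩ | ⟨m, h1, h2, rfl⟩
        · exact Γ.color _ m h1 h2
        · exact Δ.color _ m h1 h2 }
  have hstart : ∀ i : Fin j, angle (Crossing.firstOf ((Γ.C (i : ℕ)).p (Γ.C (i : ℕ)).a)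
      ((Δ.C ((i : ℕ) + k)).p (Δ.C ((i : ℕ) + k)).a)) =
      min (Γ.startAngle (i : ℕ)) (Δ.startAngle ((i : ℕ) + k)) := fun i =>
    angle_firstOf (Γ.row_start _) (Δ.row_start _)
  have hend : ∀ i : Fin j, angle (Crossing.firstOf ((Γ.C (i : ℕ)).p (Γ.C (i : ℕ)).b)
      ((Δ.C ((i : ℕ) + k)).p (Δ.C ((i : ℕ) + k)).b)) =
      min (Γ.endAngle (i : ℕ)) (Δ.endAngle ((i : ℕ) + k)) := fun i =>
    angle_firstOf (Γ.row_end _) (Δ.row_end _)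
  refine ⟨⟨γ, ?_, ?_⟩, ?_⟩
  · intro i l hil x hx hx'
    obtain ⟨u, hu, rfl⟩ := mem i x hx
    obtain ⟨v, hv, he⟩ := mem l _ hx'
    obtain ⟨w, hw⟩ := bdv i u hu
    obtain ⟨w', hw'⟩ := bdv l v hv
    obtain ⟨t, rfl, ht⟩ := Γ.eq_turn Δ (ann i u hu) (ann l v hv) hw hw' he.symm
    apply hil
    have h1 := i.2
    have h2 := l.2
    have : t = 0 := by
      by_contra h0
      rcases lt_or_gt_of_ne h0 with h | h
      · nlinarith
      · nlinarith
    rw [this] at ht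
    ext
    omega
  · refine ⟨fun i => min (Γ.startAngle (i : ℕ)) (Δ.startAngle ((i : ℕ) + k)), ?_, ?_, ?_⟩
    · intro i l hil
      have hil' : ((i : ℕ) : ℤ) < (l : ℕ) := by exact_mod_cast hil
      exact min_lt_min (Γ.startAngle_strictMono hil') (Δ.startAngle_strictMono (by omega))
    · intro i l
      have h1 : ((l : ℕ) : ℤ) < (i : ℕ) + j * 1 := by have := l.2; omega
      have h2 := Γ.startAngle_strictMono h1
      have h3 : Δ.startAngle ((l : ℕ) + k) < Δ.startAngle (((i : ℕ) + k) + j * 1) :=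
        Δ.startAngle_strictMono (by omega)
      rw [startAngle_shift, Int.cast_one, mul_one] at h2 h3
      show min _ _ < min _ _ + _
      rw [← min_add_add_right]
      exact min_lt_min h2 h3
    · intro i
      beta_reduce
      rw [← hstart i]
      refine pos_proj ?_
      exact (ann i _ (q i).start_mem_support).1
  · intro i
    have hmem : ∀ m, (q i).getVert m ∈ (q i).support := fun m => (q i).getVert_mem_support m
    show IsWindingAngle ((q i).map (φ i)) _
    rw [isWindingAngle_iff ((q i).map (φ i)) (q i).getVert (fun m _ => (ann i _ (hmem m)).1)
      (fun m hm => ?_) (fun m _ => ((q i).getVert_map (φ i) m).symm) (fun m _ => ?_),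
      SimpleGraph.Walk.length_map, SimpleGraph.Walk.getVert_length, SimpleGraph.Walk.getVert_zero,
      hstart, hend]
    · rw [SimpleGraph.Walk.length_map] at hm
      exact covAdj_of_bd_ne_zero ((q i).adj_getVert_succ hm).1
    · have := (ann i _ (hmem m)).2.2.1
      have : (1 : ℤ) ≤ n := by exact_mod_cast hn
      nlinarith

end ArmFamily

/-! ### From interpolating sequences to chains with small gaps. -/

/-- Between the values of a finite sequence there is an increasing chain of values, whose gaps are
at most the steps of the sequence. -/
theorem exists_chain {S : Set ℝ} {Q : ℝ → Prop} (hQ : ∀ d d', d' ≤ d → Q d → Q d') {w : ℕ → ℝ}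
    {m : ℕ} (hS : ∀ k, w k ∈ S) (hstep : ∀ k, Q (w (k + 1) - w k)) (hlt : w 0 < w m) :
    ∃ (r : ℕ) (a : Fin (r + 1) → ℝ), (∀ i, a i ∈ S) ∧ a 0 = w 0 ∧ a (Fin.last r) = w m ∧
      StrictMono a ∧ ∀ i : Fin r, Q (a i.succ - a i.castSucc) := by
  classical
  let T : Finset ℝ := ((Finset.range (m + 1)).image w).filter fun x => w 0 ≤ x ∧ x ≤ w m
  have mem_T : ∀ x, x ∈ T ↔ (∃ k < m + 1, w k = x) ∧ w 0 ≤ x ∧ x ≤ w m := by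
    intro x
    simp [T]
  have h0 : w 0 ∈ T := (mem_T _).2 ⟨⟨0, by omega, rfl⟩, le_rfl, hlt.le⟩
  have hm : w m ∈ T := (mem_T _).2 ⟨⟨m, by omega, rfl⟩, hlt.le, le_rfl⟩
  obtain ⟨r, hr⟩ : ∃ r, T.card = r + 1 :=
    ⟨T.card - 1, by have := Finset.card_pos.2 ⟨_, h0⟩; omega⟩
  let a := T.orderEmbOfFin hr
  have ha : ∀ i, a i ∈ T := fun i => T.orderEmbOfFin_mem hr i
  have hsurj : ∀ x ∈ T, ∃ i, a i = x := by
    intro x hx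
    have : x ∈ Set.range a := by rw [Finset.range_orderEmbOfFin]; exact hx
    exact this
  refine ⟨r, a, ?_, ?_, ?_, a.strictMono, ?_⟩
  · intro i
    obtain ⟨⟨k, _, hk⟩, _⟩ := (mem_T _).1 (ha i)
    rw [← hk]
    exact hS k
  · obtain ⟨i, hi⟩ := hsurj _ h0
    refine le_antisymm ?_ ((mem_T _).1 (ha 0)).2.1
    rw [← hi]
    exact a.monotone (Fin.zero_le i)
  · obtain ⟨i, hi⟩ := hsurj _ hm
    refine le_antisymm ((mem_T _).1 (ha _)).2.2 ?_
    rw [← hi]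
    exact a.monotone (Fin.le_last i)
  · intro i
    have hx := (mem_T _).1 (ha i.castSucc)
    have hy := (mem_T _).1 (ha i.succ)
    have hxy : a i.castSucc < a i.succ := a.strictMono (Fin.castSucc_lt_succ)
    -- At the first time when the sequence reaches `a i.succ`, its previous value is below `a
    -- i.succ`, hence at most `a i.castSucc` because no listed value lies in between. That single
    -- step covers the gap.
    have hex : ∃ k, a i.succ ≤ w k := ⟨m, hy.2.2⟩
    have hkm : Nat.find hex ≤ m := Nat.find_min' hex hy.2.2
    obtain ⟨k, hk⟩ : ∃ k, Nat.find hex = k + 1 := by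
      refine Nat.exists_eq_succ_of_ne_zero fun h => ?_
      have := Nat.find_spec hex
      rw [h] at this
      linarith [hx.2.1]
    have h1 : a i.succ ≤ w (k + 1) := hk ▸ Nat.find_spec hex
    have h2 : w k < a i.succ := not_le.1 (Nat.find_min hex (m := k) (by omega))
    have h3 : w k ≤ a i.castSucc := by
      rcases lt_or_ge (w k) (w 0) with h | h
      · linarith [hx.2.1]
      · obtain ⟨l, hl⟩ := hsurj (w k) ((mem_T _).2 ⟨⟨k, by omega, rfl⟩, h, by linarith [hy.2.2]⟩)
        rw [← hl] at h2 ⊢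
        exact a.monotone (Fin.le_castSucc_iff.2 (a.lt_iff_lt.1 h2))
    exact hQ _ _ (by linarith) (hstep k)

theorem min_step {x y y' d : ℝ} (h : y ≤ y') (h' : y' - y ≤ d) :
    0 ≤ min x y' - min x y ∧ min x y' - min x y ≤ d := by
  rcases min_cases x y with ⟨h1, _⟩ | ⟨h1, _⟩ <;> rcases min_cases x y' with ⟨h2, _⟩ | ⟨h2, _⟩ <;>
    rw [h1, h2] <;> constructor <;> linarith

/-- One step of a strictly increasing sequence is at most `j` steps, which amount to exactly `2π`;
it is strictly less when `j ≥ 2`. -/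
theorem periodic_step {E : ℤ → ℝ} {j : ℕ} (hj : 1 ≤ j) (hE : StrictMono E)
    (hshift : ∀ i t : ℤ, E (i + j * t) = E i + 2 * Real.pi * t) (k : ℤ) :
    E k ≤ E (k + 1) ∧ E (k + 1) - E k ≤ 2 * Real.pi ∧
      (2 ≤ j → E (k + 1) - E k < 2 * Real.pi) := by
  have h := hshift k 1
  rw [Int.cast_one, mul_one, mul_one] at h
  refine ⟨hE.monotone (by omega), ?_, fun h2 => ?_⟩
  · have : E (k + 1) ≤ E (k + j) := hE.monotone (by omega)
    linarith
  · have : E (k + 1) < E (k + j) := hE (by omega)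
    linarith

/-- The winding angles of two arms are joined by a sequence of winding angles with small steps. -/
theorem exists_sequence {ω : ℤ × ℤ → Color} {c : Color} {n N j : ℕ} (hj : 1 ≤ j) (hn : 1 ≤ n)
    {α α' : ℝ} (hα : α ∈ angleSet ω (fun _ : Fin j => c) n N)
    (hα' : α' ∈ angleSet ω (fun _ : Fin j => c) n N) :
    ∃ (w : ℕ → ℝ) (m : ℕ), w 0 = α ∧ w m = α' ∧
      (∀ k, w k ∈ angleSet ω (fun _ : Fin j => c) n N) ∧
      ∀ k, w (k + 1) - w k ≤ 2 * Real.pi ∧ (2 ≤ j → w (k + 1) - w k < 2 * Real.pi) := by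
  obtain ⟨r, i₀, h₀⟩ := hα
  obtain ⟨r', i₁, h₁⟩ := hα'
  obtain ⟨Γ, hΓ⟩ := r.exists_family hj hn i₀ h₀
  obtain ⟨Δ, hΔ⟩ := r'.exists_family hj hn i₁ h₁
  replace hΓ : α = Γ.endAngle (i₀ : ℕ) - Γ.startAngle (i₀ : ℕ) := hΓ
  replace hΔ : α' = Δ.endAngle (i₁ : ℕ) - Δ.startAngle (i₁ : ℕ) := hΔ
  let W : ℤ → ℝ := fun k => min (Γ.endAngle (i₀ : ℕ)) (Δ.endAngle ((i₀ : ℕ) + k)) -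
    min (Γ.startAngle (i₀ : ℕ)) (Δ.startAngle ((i₀ : ℕ) + k))
  have hW : ∀ k, W k ∈ angleSet ω (fun _ : Fin j => c) n N := fun k => by
    obtain ⟨r, hr⟩ := Γ.exists_configuration Δ hj hn k
    exact ⟨r, i₀, hr i₀⟩
  -- Both minima are nondecreasing in `k`, so the drop of `W` is at most the growth of the minimum
  -- of the starting angles.
  have hstep : ∀ k, W k - W (k + 1) ≤ 2 * Real.pi ∧ (2 ≤ j → W k - W (k + 1) < 2 * Real.pi) := by
    intro k
    obtain ⟨e1, e2, e3⟩ := periodic_step hj Δ.endAngle_strictMono Δ.endAngle_shift ((i₀ : ℕ) + k)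
    obtain ⟨s1, s2, s3⟩ :=
      periodic_step hj Δ.startAngle_strictMono Δ.startAngle_shift ((i₀ : ℕ) + k)
    have h1 := min_step (x := Γ.endAngle (i₀ : ℕ)) e1 le_rfl
    have h2 := min_step (x := Γ.startAngle (i₀ : ℕ)) s1 le_rfl
    simp only [W]
    rw [← add_assoc]
    exact ⟨by linarith, fun h => by linarith [s3 h]⟩
  -- Enough turns to carry `Δ` past `Γ` in either direction, at starts and ends; the term `j` only
  -- serves to make the number of steps nonnegative.
  obtain ⟨t, ht⟩ := exists_nat_ge (max (j : ℝ) (max (max |Γ.endAngle (i₀ : ℕ) - Δ.endAngle (i₀ : ℕ)|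
    |Γ.startAngle (i₀ : ℕ) - Δ.startAngle (i₀ : ℕ)|)
    (max |Γ.endAngle (i₀ : ℕ) - Δ.endAngle (i₁ : ℕ)|
    |Γ.startAngle (i₀ : ℕ) - Δ.startAngle (i₁ : ℕ)|)))
  simp only [max_le_iff, abs_le] at ht
  have ht0 : (0 : ℝ) ≤ t := t.cast_nonneg
  have hpi : (t : ℝ) ≤ 2 * Real.pi * t := by nlinarith [Real.pi_gt_three]
  have hfirst : W (j * t) = α := by
    simp only [W]
    rw [Δ.endAngle_shift, Δ.startAngle_shift, min_eq_left, min_eq_left, hΓ]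
    all_goals push_cast; linarith
  -- The shift by `i₁ - i₀` makes the arm `i₁` of `Δ`, whose winding angle is `α'`, face the arm
  -- `i₀` of `Γ`; the negative turns make both minima select it.
  have hlast : W ((i₁ : ℕ) - (i₀ : ℕ) + j * (-t)) = α' := by
    simp only [W]
    rw [show ((i₀ : ℕ) : ℤ) + ((i₁ : ℕ) - (i₀ : ℕ) + j * (-t)) = (i₁ : ℕ) + j * (-t) by ring,
      Δ.endAngle_shift, Δ.startAngle_shift, min_eq_right, min_eq_right, hΔ]
    · ring
    all_goals push_cast; linarith
  have hnonneg : (0 : ℤ) ≤ 2 * (j * t) + (i₀ : ℕ) - (i₁ : ℕ) := by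
    have h1 : (j : ℤ) ≤ t := by exact_mod_cast ht.1
    have h2 := i₁.2
    nlinarith
  refine ⟨fun k => W (j * t - k), (2 * (j * t) + (i₀ : ℕ) - (i₁ : ℕ) : ℤ).toNat, ?_, ?_,
    fun k => hW _, fun k => ?_⟩
  · beta_reduce
    rwa [Nat.cast_zero, sub_zero]
  · beta_reduce
    rw [← hlast, Int.toNat_of_nonneg hnonneg]
    congr 1
    ring
  · have := hstep (j * t - (k + 1 : ℕ))
    rwa [show (j : ℤ) * t - (k + 1 : ℕ) + 1 = j * t - k by push_cast; ring] at this

end Percolation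

theorem proposition4 (ω : ℤ × ℤ → Percolation.Color) (c : Percolation.Color)
    (j : ℕ) (hj : 1 ≤ j) (n N : ℕ) (hn : 1 ≤ n) (hnN : n < N) :
    (∀ α ∈ Percolation.angleSet ω (fun _ : Fin j => c) n N,
      ∀ α' ∈ Percolation.angleSet ω (fun _ : Fin j => c) n N, α < α' →
        ∃ (r : ℕ) (a : Fin (r + 1) → ℝ),
          (∀ i, a i ∈ Percolation.angleSet ω (fun _ : Fin j => c) n N) ∧
          a 0 = α ∧ a (Fin.last r) = α' ∧ StrictMono a ∧
          (∀ i : Fin r, a i.succ - a i.castSucc ≤ 2 * Real.pi) ∧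
          (2 ≤ j → ∀ i : Fin r, a i.succ - a i.castSucc < 2 * Real.pi)) ∧
    (Percolation.completedAngleSet ω (fun _ : Fin j => c) n N).OrdConnected := by
  have chain : ∀ α ∈ Percolation.angleSet ω (fun _ : Fin j => c) n N,
      ∀ α' ∈ Percolation.angleSet ω (fun _ : Fin j => c) n N, α < α' →
        ∃ (r : ℕ) (a : Fin (r + 1) → ℝ),
          (∀ i, a i ∈ Percolation.angleSet ω (fun _ : Fin j => c) n N) ∧
          a 0 = α ∧ a (Fin.last r) = α' ∧ StrictMono a ∧
          (∀ i : Fin r, a i.succ - a i.castSucc ≤ 2 * Real.pi) ∧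
          (2 ≤ j → ∀ i : Fin r, a i.succ - a i.castSucc < 2 * Real.pi) := by
    intro α hα α' hα' hlt
    obtain ⟨w, m, rfl, rfl, hS, hstep⟩ := Percolation.exists_sequence hj hn hα hα'
    obtain ⟨r, a, h1, h2, h3, h4, h5⟩ := Percolation.exists_chain
      (Q := fun d => d ≤ 2 * Real.pi ∧ (2 ≤ j → d < 2 * Real.pi))
      (fun d d' h hd => ⟨h.trans hd.1, fun hj => h.trans_lt (hd.2 hj)⟩) hS hstep hlt
    exact ⟨r, a, h1, h2, h3, h4, fun i => (h5 i).1, fun hj i => (h5 i).2 hj⟩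
  refine ⟨chain, ⟨?_⟩⟩
  intro x hx y hy z ⟨hxz, hzy⟩
  simp only [Percolation.completedAngleSet, Set.mem_iUnion, exists_prop, Set.mem_Ioc] at hx hy ⊢
  obtain ⟨α, hα, hx1, hx2⟩ := hx
  obtain ⟨α', hα', hy1, hy2⟩ := hy
  by_contra! hc
  have hz : α + Real.pi < z := hc α hα (by linarith)
  obtain ⟨r, a, ha, h0, hlast, _, hgap, _⟩ := chain α hα α' hα' (by linarith)
  -- A point missed by the union stays above each interval in turn: a gap of at most `2π` puts the
  -- lower end of the next interval no higher than the upper end of the current one.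
  have key : ∀ i, a i + Real.pi < z := by
    intro i
    induction i using Fin.induction with
    | zero => rwa [h0]
    | succ i ih => exact hc _ (ha _) (by linarith [hgap i])
  have := key (Fin.last r)
  rw [hlast] at this
  linarith
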